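/- **Model (AMPC).** A program with $P$ machines, local memory $S$ (in words) and word range $W$ works in synchronous rounds. Key-value pairs, each key and each value being one word, are kept in distributed data stores $D_0, D_1, \dots$; $D_0$ holds the input. In round $t\ge 1$ every machine executes at most $S$ instructions, each of which is a read from $D_{t-1}$, a write to $D_t$, a draw of a fresh independent uniform element of $\{0,\dots,b\}$ for some $b<W$, or a look-up in a read-only auxiliary table. The instructions are chosen adaptively, by arbitrary (uncharged) local computation from the at most $W^S$ local states, which persist between the rounds, and from the round, machine and step numbers. Several values written under the same key in one round are numbered in an arbitrary order, fixed as a function of the round, the key and the multiset of values. The total memory is $P\cdot S$ words; the auxiliary table is not counted. **Statement.** Rooted trees on the node set $\{0,\dots,n-1\}$ are given by parent pointers; the height $h$ of a tree is the maximal number of edges from the root to a node; two such trees are isomorphic if there is a bijection of their nodes that respects the relation "is a child of". There is an absolute constant $c_0$ such that for all real $0<\epsilon<1$ and $\alpha>0$ there are constants $C$ and $k$ and, for every $n\ge 1$, an AMPC program with at most $c_0/\epsilon^2$ rounds, local memory at most $C n^{\epsilon}$ words, total memory at most $C\,n\,(1+\log n)^k=\widetilde O(n)$ words and word range at most $(n+1)^k$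 (that is, words of $O(\log (n+1))$ bits), such that, for every $h$ and any two rooted trees $T,T'$ on $n$ nodes that both have height $h$, the program decides whether $T$ and $T'$ are nonisomorphic with * error probability less than $1/n^{\alpha}$, if the auxiliary table is the increasing list of the primes $p$ with $h n^{\alpha+1}\le p\le 2hn^{\alpha+1}$, and * error probability less than $1/2$, if the auxiliary table is empty. -/

import Mathlib

/-! ### Rooted trees -/

/-- A rooted tree on the node set `{0, …, n-1}`, given by its parent map. Iterating the parent map
from any node leads to the root; the value at the root itself is the convention
`parent root = root`. -/
structure LabeledRootedTree (n : ℕ) where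
  root : Fin n
  parent : Fin n → Fin n
  parent_root : parent root = root
  reaches_root : ∀ v, ∃ k : ℕ, parent^[k] v = root

namespace LabeledRootedTree

variable {n : ℕ}

/-- `u` is a child of `v`. -/
def IsChild (T : LabeledRootedTree n) (u v : Fin n) : Prop :=
  u ≠ T.root ∧ T.parent u = v

/-- The number of edges from `v` up to the root. -/
def depth (T : LabeledRootedTree n) (v : Fin n) : ℕ :=
  Nat.find (T.reaches_root v)

/-- The number of edges on a longest path from the root down to a leaf. -/
def height (T : LabeledRootedTree n) : ℕ :=
  Finset.univ.sup T.depth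

/-- Isomorphism of rooted trees: a bijection of the nodes that respects the child relation. -/
def Isomorphic (T T' : LabeledRootedTree n) : Prop :=
  ∃ φ : Fin n ≃ Fin n, ∀ u v, T.IsChild u v ↔ T'.IsChild (φ u) (φ v)

/-- The input of the isomorphism problem as a set of key-value pairs: the key `(false, v)` holds
the parent of `v` in `T` and `(true, v)` the parent of `v` in `T'`; roots have no entry. -/
def pairInput (T T' : LabeledRootedTree n) (q : Bool × Fin n) : Option (Fin n) :=
  if q.1 then (if q.2 = T'.root then none else some (T'.parent q.2))
  else (if q.2 = T.root then none else some (T.parent q.2))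

end LabeledRootedTree

/-! ### The adaptive massively parallel computation (AMPC) model -/

namespace AMPC

/-- One instruction of a machine, together with the local state that the machine enters afterwards
(as a function of the answer, where there is one). `Q` and `A` are the keys and values of the
input, `K` and `V` the keys and values of the distributed data stores, `St` the local states, and
`W` the number of values of a machine word. -/
inductive Instr (Q A K V St : Type) (W : ℕ) : Type
  /-- Read the input (kept in the data store of the first round). -/
  | input (q : Q) (next : Option A → St)
  /-- Read the `j`-th value stored under the key `k`. -/
  | read (k : K) (j : ℕ) (next : Option V → St)
  /-- Write a key-value pair into the data store of the next round. -/
  | write (k : K) (v : V) (next : St)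
  /-- Draw a fresh uniformly random element of `{0, …, b}`. -/
  | draw (b : Fin W) (next : Fin (b + 1) → St)
  /-- Look up the `j`-th entry of the auxiliary read-only table. -/
  | table (j : ℕ) (next : Option ℕ → St)
  /-- Local computation only. -/
  | compute (next : St)

/-- An AMPC program for inputs with keys in `Q` and values in `A`. There are `machines` machines
that work in synchronous rounds. Each has a local memory of `memory` words, a word taking
`wordSize` values, so that it has at most `wordSize ^ memory` local states; keys and values of the
data stores fit into a word each. In a round, every machine executes at most `memory` instructions
(reads, writes, draws, table look-ups), chosen adaptively: the next instruction is an
arbitrary function `code t i s x` of the number `t` of the round, the name `i` of the machine, the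
number `s` of the step in the round and the local state `x`. Local computation is free.
In the end, machine `0` holds the output. -/
structure Program (Q A : Type) where
  rounds : ℕ
  machines : ℕ
  memory : ℕ
  wordSize : ℕ
  machines_pos : 0 < machines
  State : Type
  Key : Type
  Val : Type
  finite_state : Finite State
  finite_key : Finite Key
  finite_val : Finite Val
  card_state : Nat.card State ≤ wordSize ^ memory
  card_key : Nat.card Key ≤ wordSize
  card_val : Nat.card Val ≤ wordSize
  init : Fin machines → State
  code : Fin rounds → Fin machines → Fin memory → State → Instr Q A Key Val State wordSize
  output : State → Bool

/-- Effect of one instruction: the new local state and the key-value pairs written, given the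
input `inp`, the readable data store `D`, the auxiliary table `tab` and the outcomes `coin` of the
random draws of this step. -/
def Instr.exec {Q A K V St : Type} {W : ℕ} (inp : Q → Option A) (D : K → List V)
    (tab : ℕ → Option ℕ) (coin : (b : Fin W) → Fin (b + 1)) :
    Instr Q A K V St W → St × List (K × V)
  | .input q next => (next (inp q), [])
  | .read k j next => (next (D k)[j]?, [])
  | .write k v next => (next, [(k, v)])
  | .draw b next => (next (coin b), [])
  | .table j next => (next (tab j), [])
  | .compute next => (next, [])

namespace Program

variable {Q A : Type} (M : Program Q A)

/-- The total memory, in words, of all machines. As a machine writes at most `memory` key-value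
pairs in a round, this also bounds the number of pairs in each data store. -/
def totalMemory : ℕ := M.machines * M.memory

/-- The outcomes of all random draws: round `t`, machine `i`, step `s` has its own independent
uniform element of `{0, …, b}` for every `b`. -/
abbrev Seed : Type :=
  Fin M.rounds → Fin M.machines → Fin M.memory → (b : Fin M.wordSize) → Fin (b + 1)

/-- A rule by which the values written under the same key in the same round are numbered. -/
structure Ordering where
  arrange : ℕ → M.Key → Multiset M.Val → List M.Val
  arrange_eq : ∀ t k m, (arrange t k m : Multiset M.Val) = m

/-- A configuration between two rounds: the local states of the machines and the current data
store, which lists for each key the values under this key. -/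
structure Config where
  state : Fin M.machines → M.State
  store : M.Key → List M.Val

/-- What machine `i` does in round `t`, beginning in the configuration `c`: its new local state and
the list of the key-value pairs it writes. -/
def localRun (inp : Q → Option A) (tab : ℕ → Option ℕ) (ω : M.Seed) (t : Fin M.rounds)
    (c : M.Config) (i : Fin M.machines) : M.State × List (M.Key × M.Val) :=
  (List.finRange M.memory).foldl
    (fun p s =>
      let r := (M.code t i s p.1).exec inp c.store tab (ω t i s)
      (r.1, p.2 ++ r.2))
    (c.state i, [])

open Classical in
/-- One round. The input is readable in the first round only; the later rounds read what was
written in the round before. -/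
noncomputable def round (inp : Q → Option A) (tab : ℕ → Option ℕ) (σ : M.Ordering) (ω : M.Seed)
    (c : M.Config) (t : Fin M.rounds) : M.Config :=
  let res := M.localRun (if (t : ℕ) = 0 then inp else fun _ => none) tab ω t c
  let written : Multiset (M.Key × M.Val) := ∑ i, ((res i).2 : Multiset (M.Key × M.Val))
  { state := fun i => (res i).1
    store := fun k => σ.arrange t k ((written.filter (fun kv => kv.1 = k)).map Prod.snd) }

/-- The output of a run on the input `inp`. -/
noncomputable def run (inp : Q → Option A) (tab : ℕ → Option ℕ) (σ : M.Ordering) (ω : M.Seed) :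
    Bool :=
  M.output
    (((List.finRange M.rounds).foldl (M.round inp tab σ ω) ⟨M.init, fun _ => []⟩).state
      ⟨0, M.machines_pos⟩)

/-- The probability, over uniform random draws, that the output differs from the truth value of
`P`. -/
noncomputable def errorProb (inp : Q → Option A) (tab : ℕ → Option ℕ) (σ : M.Ordering) (P : Prop) :
    ℝ :=
  (Nat.card {ω : M.Seed // ¬ (M.run inp tab σ ω = true ↔ P)} : ℝ) / (Nat.card M.Seed : ℝ)

end Program

end AMPC

open Classical in
/-- The increasing list of all primes `p` with `a ≤ p ≤ 2 * a`, as a table. -/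
noncomputable def primeTable (a : ℝ) (j : ℕ) : Option ℕ :=
  let l : List ℕ := (List.range (⌊2 * a⌋₊ + 1)).filter
    (fun p : ℕ => decide (p.Prime ∧ a ≤ (p : ℝ) ∧ (p : ℝ) ≤ 2 * a))
  l[j]?

/-- No table is available. -/
def noTable (_ : ℕ) : Option ℕ := none

/-! ### Binary trees -/

/-- Binary trees with labels in `α`. -/
inductive BinTree (α : Type) : Type
  | nil : BinTree α
  | node (a : α) (l r : BinTree α) : BinTree α

namespace BinTree

variable {α : Type}

/-- Twice the number of nodes, which is the length of the Euler tour. -/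
def len : BinTree α → ℕ
  | nil => 0
  | node _ l r => 2 + l.len + r.len

/-- The labels in preorder. -/
def labels : BinTree α → List α
  | nil => []
  | node a l r => a :: (l.labels ++ r.labels)

/-- The Euler tour of the forest that is encoded by a binary tree (left: first child, right: next
sibling); `false` marks the way down to a node, `true` the way up. -/
def tour : BinTree α → List (Bool × α)
  | nil => []
  | node a l r => (false, a) :: (l.tour ++ (true, a) :: r.tour)

/-- The subtrees at the positions of the Euler tour. -/
def subs : BinTree α → List (BinTree α)
  | nil => []
  | node a l r => node a l r :: (l.subs ++ nil :: r.subs)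

/-- The hash of the encoded forest, the product of the hashes of its trees; the hash of a tree is
`x + y * h` for the hash `h` of the forest of its children. -/
def ev {R : Type*} [CommSemiring R] (x y : R) : BinTree α → R
  | nil => 1
  | node _ l r => (x + y * l.ev x y) * r.ev x y

lemma length_tour (t : BinTree α) : t.tour.length = t.len := by
  induction t with
  | nil => rfl
  | node a l r hl hr => simp [tour, len, hl, hr]; omega

lemma length_subs (t : BinTree α) : t.subs.length = t.len := by
  induction t with
  | nil => rfl
  | node a l r hl hr => simp [subs, len, hl, hr]; omega

lemma len_eq_two_mul (t : BinTree α) : t.len = 2 * t.labels.length := by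
  induction t with
  | nil => rfl
  | node a l r hl hr => simp [labels, len, hl, hr]; omega

lemma map_ev {R R' : Type*} [CommSemiring R] [CommSemiring R'] (f : R →+* R') (x y : R)
    (t : BinTree α) : f (t.ev x y) = t.ev (f x) (f y) := by
  induction t with
  | nil => simp [ev]
  | node a l r hl hr => simp [ev, hl, hr]

lemma count_tour [DecidableEq α] (t : BinTree α) (b : Bool) (v : α) :
    t.tour.count (b, v) = t.labels.count v := by
  induction t with
  | nil => simp [tour, labels]
  | node a l r hl hr =>
    cases b <;> simp [tour, labels, List.count_cons, hl, hr] <;> omega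

end BinTree

namespace LabeledRootedTree

variable {n : ℕ} (T : LabeledRootedTree n)

lemma iterate_depth (v : Fin n) : T.parent^[T.depth v] v = T.root :=
  Nat.find_spec (T.reaches_root v)

lemma depth_le_of_iterate {v : Fin n} {k : ℕ} (h : T.parent^[k] v = T.root) : T.depth v ≤ k :=
  Nat.find_min' _ h

lemma depth_root : T.depth T.root = 0 :=
  Nat.le_zero.mp (T.depth_le_of_iterate (k := 0) rfl)

lemma eq_root_of_depth_eq_zero {v : Fin n} (h : T.depth v = 0) : v = T.root := by
  simpa [h] using T.iterate_depth v

lemma depth_eq_parent {v : Fin n} (h : v ≠ T.root) : T.depth v = T.depth (T.parent v) + 1 := by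
  apply le_antisymm
  · apply T.depth_le_of_iterate
    simpa using T.iterate_depth (T.parent v)
  · have h0 : T.depth v ≠ 0 := fun h0 => h (T.eq_root_of_depth_eq_zero h0)
    obtain ⟨k, hk⟩ := Nat.exists_eq_succ_of_ne_zero h0
    rw [hk]
    have := T.iterate_depth v
    rw [hk, Function.iterate_succ_apply] at this
    exact Nat.succ_le_succ (T.depth_le_of_iterate this)

lemma depth_le_height (v : Fin n) : T.depth v ≤ T.height :=
  Finset.le_sup (f := T.depth) (Finset.mem_univ v)

lemma depth_iterate (v : Fin n) (k : ℕ) : T.depth (T.parent^[k] v) = T.depth v - k := by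
  induction k with
  | zero => simp
  | succ k ih =>
    rw [Function.iterate_succ_apply']
    by_cases h : T.parent^[k] v = T.root
    · rw [h, T.parent_root, T.depth_root]
      rw [h, T.depth_root] at ih
      omega
    · have := T.depth_eq_parent h
      omega

/-- The children of `v` with label at least `lo`. -/
def childrenFrom (v : Fin n) (lo : ℕ) : Finset (Fin n) :=
  Finset.univ.filter fun u => u ≠ T.root ∧ T.parent u = v ∧ lo ≤ u

lemma mem_childrenFrom {u v : Fin n} {lo : ℕ} :
    u ∈ T.childrenFrom v lo ↔ u ≠ T.root ∧ T.parent u = v ∧ lo ≤ u := by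
  simp [childrenFrom]

/-- The least child of `v` with label at least `lo`. -/
def nextFrom (v : Fin n) (lo : ℕ) : Option (Fin n) :=
  if h : (T.childrenFrom v lo).Nonempty then some ((T.childrenFrom v lo).min' h) else none

lemma nextFrom_eq_none {v : Fin n} {lo : ℕ} :
    T.nextFrom v lo = none ↔ T.childrenFrom v lo = ∅ := by
  unfold nextFrom
  split_ifs with h
  · simp [h.ne_empty]
  · simpa using h

lemma nextFrom_eq_some {v u : Fin n} {lo : ℕ} :
    T.nextFrom v lo = some u ↔
      u ∈ T.childrenFrom v lo ∧ ∀ w ∈ T.childrenFrom v lo, u ≤ w := by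
  unfold nextFrom
  split_ifs with h
  · simp only [Option.some.injEq]
    constructor
    · rintro rfl
      exact ⟨Finset.min'_mem _ _, fun w hw => Finset.min'_le _ _ hw⟩
    · rintro ⟨h1, h2⟩
      exact le_antisymm (Finset.min'_le _ _ h1) (h2 _ (Finset.min'_mem _ _))
  · simp only [false_iff, not_and]
    intro h1
    exact absurd ⟨u, h1⟩ h

/-- The least child of `v`. -/
def firstChild (v : Fin n) : Option (Fin n) := T.nextFrom v 0

/-- The next sibling of `v` in the order of the labels. -/
def nextSibling (v : Fin n) : Option (Fin n) :=
  if v = T.root then none else T.nextFrom (T.parent v) (v + 1)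

/-- A measure that decreases from a node to its first child and to its next sibling. -/
def encodeMeasure : Option (Fin n) → ℕ
  | none => 0
  | some v => (T.height - T.depth v) * (n + 1) + (n - v)

lemma encodeMeasure_firstChild (v : Fin n) :
    T.encodeMeasure (T.firstChild v) < T.encodeMeasure (some v) := by
  have hv := v.2
  rcases h : T.firstChild v with _ | u
  · simp only [encodeMeasure]; omega
  · have hu := ((T.nextFrom_eq_some).mp h).1
    rw [mem_childrenFrom] at hu
    have h1 := T.depth_eq_parent hu.1
    rw [hu.2.1] at h1
    have h2 := T.depth_le_height u
    obtain ⟨k, hk⟩ : ∃ k, T.height - T.depth v = k + 1 := ⟨T.height - T.depth v - 1, by omega⟩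
    have h3 : T.height - T.depth u = k := by omega
    simp only [encodeMeasure, hk, h3]
    rw [add_mul]
    omega

lemma encodeMeasure_nextSibling (v : Fin n) :
    T.encodeMeasure (T.nextSibling v) < T.encodeMeasure (some v) := by
  have hv := v.2
  unfold nextSibling
  split_ifs with hr
  · simp only [encodeMeasure]; omega
  rcases h : T.nextFrom (T.parent v) (v + 1) with _ | u
  · simp only [encodeMeasure]; omega
  · have hu := ((T.nextFrom_eq_some).mp h).1
    rw [mem_childrenFrom] at hu
    have h1 := T.depth_eq_parent hu.1
    rw [hu.2.1, ← T.depth_eq_parent hr] at h1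
    simp only [encodeMeasure, h1]
    have := hu.2.2
    omega

/-- The forest of a node, its later siblings and all their descendants as a binary tree. -/
def encode : Option (Fin n) → BinTree (Fin n)
  | none => .nil
  | some v => .node v (encode (T.firstChild v)) (encode (T.nextSibling v))
termination_by o => T.encodeMeasure o
decreasing_by
  · exact T.encodeMeasure_firstChild v
  · exact T.encodeMeasure_nextSibling v

lemma encode_none : T.encode none = .nil := by rw [encode]

lemma encode_some (v : Fin n) :
    T.encode (some v) = .node v (T.encode (T.firstChild v)) (T.encode (T.nextSibling v)) := by
  rw [encode]

lemma encode_induction {P : Option (Fin n) → Prop} (h0 : P none)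
    (h1 : ∀ v, P (T.firstChild v) → P (T.nextSibling v) → P (some v)) (o : Option (Fin n)) :
    P o := by
  induction hk : T.encodeMeasure o using Nat.strong_induction_on generalizing o with
  | _ k ih =>
    cases o with
    | none => exact h0
    | some v =>
      subst hk
      exact h1 v (ih _ (T.encodeMeasure_firstChild v) _ rfl)
        (ih _ (T.encodeMeasure_nextSibling v) _ rfl)

/-- The roots of the trees in the encoded forest. -/
def forestRoots : Option (Fin n) → Finset (Fin n)
  | none => ∅
  | some v => if v = T.root then {v} else T.childrenFrom (T.parent v) v

lemma forestRoots_nextFrom (v : Fin n) (lo : ℕ) :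
    T.forestRoots (T.nextFrom v lo) = T.childrenFrom v lo := by
  rcases h : T.nextFrom v lo with _ | u
  · exact ((T.nextFrom_eq_none).mp h).symm
  · have hu := (T.nextFrom_eq_some).mp h
    have hu1 := hu.1
    rw [mem_childrenFrom] at hu1
    simp only [forestRoots, if_neg hu1.1]
    ext w
    simp only [mem_childrenFrom, hu1.2.1]
    constructor
    · rintro ⟨a, b, c⟩
      exact ⟨a, b, hu1.2.2.trans c⟩
    · rintro ⟨a, b, c⟩
      exact ⟨a, b, hu.2 w ((T.mem_childrenFrom).mpr ⟨a, b, c⟩)⟩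

lemma forestRoots_firstChild (v : Fin n) :
    T.forestRoots (T.firstChild v) = T.childrenFrom v 0 :=
  T.forestRoots_nextFrom v 0

lemma forestRoots_some (v : Fin n) :
    T.forestRoots (some v) = insert v (T.forestRoots (T.nextSibling v)) := by
  unfold nextSibling
  by_cases h : v = T.root
  · simp [forestRoots, h]
  · rw [if_neg h, forestRoots_nextFrom]
    simp only [forestRoots, if_neg h]
    ext w
    simp only [mem_childrenFrom, Finset.mem_insert]
    constructor
    · rintro ⟨a, b, c⟩
      by_cases hw : w = v
      · exact Or.inl hw
      · have : (w : ℕ) ≠ v := fun h => hw (Fin.ext h)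
        exact Or.inr ⟨a, b, by omega⟩
    · rintro (rfl | ⟨a, b, c⟩)
      · exact ⟨h, rfl, le_rfl⟩
      · exact ⟨a, b, by omega⟩

lemma notMem_forestRoots_nextSibling (v : Fin n) : v ∉ T.forestRoots (T.nextSibling v) := by
  unfold nextSibling
  split_ifs with h
  · simp [forestRoots]
  · rw [forestRoots_nextFrom, mem_childrenFrom]
    omega

/-- `w` is a descendant of `c` or `c` itself. -/
def Below (c w : Fin n) : Prop :=
  T.depth c ≤ T.depth w ∧ T.parent^[T.depth w - T.depth c] w = c

lemma below_root (w : Fin n) : T.Below T.root w := by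
  refine ⟨by rw [T.depth_root]; omega, ?_⟩
  rw [T.depth_root, Nat.sub_zero, T.iterate_depth]

lemma below_iff (c w : Fin n) :
    T.Below c w ↔ w = c ∨ ∃ u ∈ T.childrenFrom c 0, T.Below u w := by
  constructor
  · rintro ⟨h1, h2⟩
    rcases Nat.eq_zero_or_pos (T.depth w - T.depth c) with h | h
    · left
      simpa [h] using h2
    · right
      obtain ⟨k, hk⟩ := Nat.exists_eq_succ_of_ne_zero h.ne'
      rw [hk, Function.iterate_succ_apply'] at h2
      have hd := T.depth_iterate w k
      refine ⟨T.parent^[k] w, ?_, ?_⟩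
      · rw [mem_childrenFrom]
        refine ⟨fun hr => ?_, h2, Nat.zero_le _⟩
        rw [hr, T.depth_root] at hd
        omega
      · refine ⟨by omega, ?_⟩
        rw [hd]
        congr 1
        omega
  · rintro (rfl | ⟨u, hu, h1, h2⟩)
    · exact ⟨le_rfl, by simp⟩
    · rw [mem_childrenFrom] at hu
      have hd := T.depth_eq_parent hu.1
      rw [hu.2.1] at hd
      refine ⟨by omega, ?_⟩
      have : T.depth w - T.depth c = (T.depth w - T.depth u) + 1 := by omega
      rw [this, Function.iterate_succ_apply', h2, hu.2.1]

lemma not_below_of_child {c u : Fin n} (hu : u ∈ T.childrenFrom c 0) : ¬ T.Below u c := by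
  rw [mem_childrenFrom] at hu
  have hd := T.depth_eq_parent hu.1
  rw [hu.2.1] at hd
  rintro ⟨h1, -⟩
  omega

lemma eq_of_below_of_depth_eq {c c' w : Fin n} (h : T.Below c w) (h' : T.Below c' w)
    (hd : T.depth c = T.depth c') : c = c' := by
  rw [← h.2, ← h'.2, hd]

lemma depth_eq_of_mem_forestRoots_nextSibling {v c : Fin n}
    (h : c ∈ T.forestRoots (T.nextSibling v)) : T.depth c = T.depth v := by
  unfold nextSibling at h
  split_ifs at h with hr
  · simp [forestRoots] at h
  · rw [forestRoots_nextFrom, mem_childrenFrom] at h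
    rw [T.depth_eq_parent h.1, T.depth_eq_parent hr, h.2.1]

open Classical in
lemma count_labels_encode (o : Option (Fin n)) (w : Fin n) :
    (T.encode o).labels.count w = if ∃ c ∈ T.forestRoots o, T.Below c w then 1 else 0 := by
  induction o using T.encode_induction with
  | h0 => simp [encode_none, BinTree.labels, forestRoots]
  | h1 v hl hr =>
    rw [encode_some, BinTree.labels, List.count_cons, List.count_append, hl, hr,
      forestRoots_firstChild]
    have e1 : (∃ c ∈ T.forestRoots (some v), T.Below c w) ↔
        (w = v ∨ ∃ u ∈ T.childrenFrom v 0, T.Below u w) ∨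
          ∃ c ∈ T.forestRoots (T.nextSibling v), T.Below c w := by
      rw [← T.below_iff, forestRoots_some]
      simp
    rw [if_congr e1 rfl rfl]
    have e2 : ¬ ((∃ u ∈ T.childrenFrom v 0, T.Below u w) ∧ w = v) := by
      rintro ⟨⟨u, hu, hb⟩, rfl⟩
      exact T.not_below_of_child hu hb
    have e3 : ¬ ((w = v ∨ ∃ u ∈ T.childrenFrom v 0, T.Below u w) ∧
        ∃ c ∈ T.forestRoots (T.nextSibling v), T.Below c w) := by
      rw [← T.below_iff]
      rintro ⟨h1, c, hc, h2⟩
      have := T.eq_of_below_of_depth_eq h2 h1 (T.depth_eq_of_mem_forestRoots_nextSibling hc)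
      exact T.notMem_forestRoots_nextSibling v (this ▸ hc)
    have key : ∀ A B C : Prop, ¬ (B ∧ A) → ¬ ((A ∨ B) ∧ C) →
        (if B then 1 else 0) + (if C then 1 else 0) + (if A then 1 else 0) =
          if (A ∨ B) ∨ C then 1 else 0 := by
      intro A B C h1 h2
      by_cases A <;> by_cases B <;> by_cases C <;> simp_all
    have h4 := key _ _ _ e2 e3
    simp only [beq_iff_eq, eq_comm (a := v)]
    convert h4

lemma count_labels_root (w : Fin n) : (T.encode (some T.root)).labels.count w = 1 := by
  classical
  rw [count_labels_encode, if_pos]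
  exact ⟨T.root, by simp [forestRoots], T.below_root w⟩

lemma length_labels_root : (T.encode (some T.root)).labels.length = n := by
  have h1 : (T.encode (some T.root)).labels.Nodup :=
    List.nodup_iff_count_le_one.mpr fun a => (T.count_labels_root a).le
  have h2 : (T.encode (some T.root)).labels.toFinset = Finset.univ := by
    ext w
    simp only [List.mem_toFinset, Finset.mem_univ, iff_true]
    exact List.count_pos_iff.mp (by rw [T.count_labels_root]; norm_num)
  rw [← List.toFinset_card_of_nodup h1, h2, Finset.card_univ, Fintype.card_fin]

lemma len_encode_root : (T.encode (some T.root)).len = 2 * n := by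
  rw [BinTree.len_eq_two_mul, T.length_labels_root]

lemma nodup_tour_root : (T.encode (some T.root)).tour.Nodup :=
  List.nodup_iff_count_le_one.mpr fun ⟨b, v⟩ => by
    rw [BinTree.count_tour, T.count_labels_root]

/-- The hash of the tree of the descendants of `v`. -/
def hash {R : Type*} [CommSemiring R] (x y : R) (v : Fin n) : R :=
  x + y * (T.encode (T.firstChild v)).ev x y

lemma ev_encode {R : Type*} [CommSemiring R] (x y : R) (o : Option (Fin n)) :
    (T.encode o).ev x y = ∏ c ∈ T.forestRoots o, T.hash x y c := by
  induction o using T.encode_induction with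
  | h0 => simp [encode_none, BinTree.ev, forestRoots]
  | h1 v hl hr =>
    rw [encode_some, BinTree.ev, hr, forestRoots_some,
      Finset.prod_insert (T.notMem_forestRoots_nextSibling v), hash]

lemma hash_eq {R : Type*} [CommSemiring R] (x y : R) (v : Fin n) :
    T.hash x y v = x + y * ∏ c ∈ T.childrenFrom v 0, T.hash x y c := by
  conv_lhs => rw [hash, ev_encode, forestRoots_firstChild]

lemma ev_encode_root {R : Type*} [CommSemiring R] (x y : R) :
    (T.encode (some T.root)).ev x y = T.hash x y T.root := by
  rw [ev_encode]; simp [forestRoots]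

lemma map_hash {R R' : Type*} [CommSemiring R] [CommSemiring R'] (f : R →+* R') (x y : R)
    (v : Fin n) : f (T.hash x y v) = T.hash (f x) (f y) v := by
  simp [hash, BinTree.map_ev]

/-- Induction from the leaves to the root. -/
lemma children_induction {P : Fin n → Prop}
    (h : ∀ v, (∀ u ∈ T.childrenFrom v 0, P u) → P v) (v : Fin n) : P v := by
  induction hk : T.height - T.depth v using Nat.strong_induction_on generalizing v with
  | _ k ih =>
    refine h v fun u hu => ih _ ?_ u rfl
    rw [mem_childrenFrom] at hu
    have hd := T.depth_eq_parent hu.1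
    rw [hu.2.1] at hd
    have := T.depth_le_height u
    omega

/-- Induction from the root to the leaves. -/
lemma parent_induction {P : Fin n → Prop} (h0 : P T.root)
    (h : ∀ v, v ≠ T.root → P (T.parent v) → P v) (v : Fin n) : P v := by
  induction hk : T.depth v generalizing v with
  | zero => rw [T.eq_root_of_depth_eq_zero hk]; exact h0
  | succ k ih =>
    have hv : v ≠ T.root := by
      rintro rfl
      rw [T.depth_root] at hk
      omega
    exact h v hv (ih _ (by have := T.depth_eq_parent hv; omega))

end LabeledRootedTree

open Polynomial in
/-- A product of monic irreducible polynomials determines its factors. -/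
lemma Polynomial.multiset_eq_of_prod_eq {R : Type*} [CommRing R] [IsDomain R]
    [UniqueFactorizationMonoid R] {s t : Multiset R[X]} (hs : ∀ f ∈ s, f.Monic ∧ Irreducible f)
    (ht : ∀ f ∈ t, f.Monic ∧ Irreducible f) (h : s.prod = t.prod) : s = t := by
  have h1 := UniqueFactorizationMonoid.factors_unique (fun f hf => (hs f hf).2)
    (fun f hf => (ht f hf).2) (Associated.of_eq h)
  refine Multiset.rel_eq.mp (h1.mono ?_)
  intro f hf g hg hfg
  exact Polynomial.eq_of_monic_of_associated (hs f hf).1 (ht g hg).1 hfg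

namespace LabeledRootedTree

variable {n : ℕ} (T T' : LabeledRootedTree n)

section Polynomials

open Polynomial

variable (K : Type*) [Field K]

/-- The hash of the tree below `v` with indeterminates in the place of the random elements. -/
noncomputable abbrev polyHash (v : Fin n) : K[X][X] := T.hash (C X) X v

lemma polyHash_eq (v : Fin n) :
    T.polyHash K v = C X + X * ∏ c ∈ T.childrenFrom v 0, T.polyHash K c :=
  T.hash_eq _ _ v

lemma polyHash_monic (v : Fin n) : (T.polyHash K v).Monic ∧ 0 < (T.polyHash K v).natDegree := by
  induction v using T.children_induction with
  | h v ih =>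
    have h1 : (X * ∏ c ∈ T.childrenFrom v 0, T.polyHash K c : K[X][X]).Monic :=
      monic_X.mul (monic_prod_of_monic _ _ fun c hc => (ih c hc).1)
    have h2 : 0 < (X * ∏ c ∈ T.childrenFrom v 0, T.polyHash K c : K[X][X]).natDegree := by
      rw [natDegree_X_mul (monic_prod_of_monic _ _ fun c hc => (ih c hc).1).ne_zero]
      omega
    have h3 : (C X : K[X][X]).degree <
        (X * ∏ c ∈ T.childrenFrom v 0, T.polyHash K c : K[X][X]).degree :=
      lt_of_le_of_lt degree_C_le (natDegree_pos_iff_degree_pos.mp h2)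
    rw [polyHash_eq, add_comm]
    refine ⟨h1.add_of_left h3, ?_⟩
    rw [natDegree_add_eq_left_of_degree_lt h3]
    exact h2

lemma polyHash_map (v : Fin n) :
    ∃ d, (T.polyHash K v).map (evalRingHom (0 : K)) = X ^ d := by
  induction v using T.children_induction with
  | h v ih =>
    choose! d hd using ih
    refine ⟨1 + ∑ c ∈ T.childrenFrom v 0, d c, ?_⟩
    rw [polyHash_eq, Polynomial.map_add, Polynomial.map_mul, Polynomial.map_prod,
      Finset.prod_congr rfl hd, Finset.prod_pow_eq_pow_sum, pow_add]
    simp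

lemma polyHash_irreducible (v : Fin n) : Irreducible (T.polyHash K v) := by
  obtain ⟨hm, hd⟩ := T.polyHash_monic K v
  have hX : (Ideal.span {(X : K[X])}).IsPrime :=
    (Ideal.span_singleton_prime X_ne_zero).mpr prime_X
  refine irreducible_of_eisenstein_criterion hX ?_ ?_ (natDegree_pos_iff_degree_pos.mp hd) ?_
    hm.isPrimitive
  · rw [hm.leadingCoeff]
    exact fun h => hX.ne_top ((Ideal.eq_top_iff_one _).mpr h)
  · intro k hk
    obtain ⟨d, hd⟩ := T.polyHash_map K v
    have hdeg : (T.polyHash K v).natDegree = d := by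
      rw [← hm.natDegree_map (evalRingHom (0 : K)), hd, natDegree_X_pow]
    have hc : ((T.polyHash K v).map (evalRingHom (0 : K))).coeff k = 0 := by
      rw [hd, coeff_X_pow, if_neg]
      rw [degree_eq_natDegree hm.ne_zero, hdeg] at hk
      exact (Nat.cast_lt.mp hk).ne
    rw [coeff_map] at hc
    rw [Ideal.mem_span_singleton, X_dvd_iff, coeff_zero_eq_eval_zero]
    exact hc
  · rw [polyHash_eq, Ideal.span_singleton_pow, Ideal.mem_span_singleton]
    simp only [coeff_add, coeff_C_zero, mul_coeff_zero, coeff_X_zero, zero_mul, add_zero]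
    rw [X_pow_dvd_iff]
    intro h
    have := h 1 (by norm_num)
    simp at this

lemma polyHash_children {v v' : Fin n} (h : T.polyHash K v = T'.polyHash K v') :
    (T.childrenFrom v 0).val.map (T.polyHash K) = (T'.childrenFrom v' 0).val.map (T'.polyHash K) := by
  rw [polyHash_eq, polyHash_eq] at h
  have h1 := mul_left_cancel₀ X_ne_zero (add_left_cancel h)
  refine Polynomial.multiset_eq_of_prod_eq ?_ ?_ h1 <;>
  · intro f hf
    obtain ⟨c, -, rfl⟩ := Multiset.mem_map.mp hf
    exact ⟨(polyHash_monic _ K c).1, polyHash_irreducible _ K c⟩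

end Polynomials

/-- Finite sets with the same multiset of labels are in bijection. -/
lemma exists_bij_of_map_eq {α γ : Type*} [DecidableEq α] (f g : α → γ) (s t : Finset α)
    (h : s.val.map f = t.val.map g) :
    ∃ φ : α → α, (∀ a ∈ s, φ a ∈ t ∧ g (φ a) = f a) ∧ Set.InjOn φ s := by
  induction s using Finset.induction_on generalizing t with
  | empty => exact ⟨id, by simp, by simp⟩
  | insert a s ha ih =>
    rw [Finset.insert_val_of_notMem ha, Multiset.map_cons] at h
    have h1 : f a ∈ t.val.map g := by rw [← h]; exact Multiset.mem_cons_self _ _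
    obtain ⟨b, hb, hba⟩ := Multiset.mem_map.mp h1
    have hb' : b ∈ t := hb
    have h2 : s.val.map f = (t.erase b).val.map g := by
      have h3 : t.val = b ::ₘ (t.erase b).val := by
        rw [← Finset.insert_val_of_notMem (Finset.notMem_erase b t), Finset.insert_erase hb']
      rw [h3, Multiset.map_cons, hba] at h
      exact (Multiset.cons_inj_right _).mp h
    obtain ⟨φ, h3, h4⟩ := ih _ h2
    refine ⟨Function.update φ a b, ?_, ?_⟩
    · intro c hc
      by_cases hca : c = a
      · subst hca
        simpa using ⟨hb', hba⟩
      · rw [Function.update_of_ne hca]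
        have := h3 c (Finset.mem_of_mem_insert_of_ne hc hca)
        exact ⟨Finset.mem_of_mem_erase this.1, this.2⟩
    · intro c hc d hd hcd
      by_cases hca : c = a <;> by_cases hda : d = a
      · rw [hca, hda]
      · subst hca
        rw [Function.update_self, Function.update_of_ne hda] at hcd
        have := (h3 d (Finset.mem_of_mem_insert_of_ne hd hda)).1
        rw [← hcd] at this
        exact absurd this (Finset.notMem_erase _ _)
      · subst hda
        rw [Function.update_self, Function.update_of_ne hca] at hcd
        have := (h3 c (Finset.mem_of_mem_insert_of_ne hc hca)).1
        rw [hcd] at this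
        exact absurd this (Finset.notMem_erase _ _)
      · rw [Function.update_of_ne hca, Function.update_of_ne hda] at hcd
        exact h4 (Finset.mem_of_mem_insert_of_ne hc hca) (Finset.mem_of_mem_insert_of_ne hd hda) hcd

/-- The bijection between the nodes of two trees that arises from bijections between the
children of any two nodes. -/
noncomputable def transport (β : Fin n → Fin n → Fin n → Fin n) (v : Fin n) : Fin n :=
  if h : v = T.root then T'.root
  else β (T.parent v) (transport β (T.parent v)) v
termination_by T.depth v
decreasing_by have := T.depth_eq_parent h; omega

lemma isomorphic_of_polyHash_eq (K : Type*) [Field K]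
    (h : T.polyHash K T.root = T'.polyHash K T'.root) : T.Isomorphic T' := by
  classical
  have hβ : ∀ v v', ∃ φ : Fin n → Fin n, T.polyHash K v = T'.polyHash K v' →
      (∀ c ∈ T.childrenFrom v 0, φ c ∈ T'.childrenFrom v' 0 ∧
        T'.polyHash K (φ c) = T.polyHash K c) ∧ Set.InjOn φ (T.childrenFrom v 0) := by
    intro v v'
    by_cases hv : T.polyHash K v = T'.polyHash K v'
    · obtain ⟨φ, h1, h2⟩ := exists_bij_of_map_eq _ _ _ _ (T.polyHash_children T' K hv)
      exact ⟨φ, fun _ => ⟨h1, h2⟩⟩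
    · exact ⟨id, fun h => absurd h hv⟩
  choose β hβ using hβ
  set φ := T.transport T' β with hφ
  have hroot : φ T.root = T'.root := by rw [hφ, transport, dif_pos rfl]
  have hstep : ∀ v, v ≠ T.root → φ v = β (T.parent v) (φ (T.parent v)) v := by
    intro v hv
    rw [hφ, transport, dif_neg hv]
  have hmem : ∀ v, v ≠ T.root → v ∈ T.childrenFrom (T.parent v) 0 := fun v hv => by
    rw [mem_childrenFrom]
    exact ⟨hv, rfl, Nat.zero_le _⟩
  have hpoly : ∀ v, T.polyHash K v = T'.polyHash K (φ v) := by
    intro v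
    induction v using T.parent_induction with
    | h0 => rw [hroot, h]
    | h v hv ih =>
      rw [hstep v hv]
      exact (((hβ _ _ ih).1 v (hmem v hv)).2).symm
  have hchild : ∀ v, v ≠ T.root → φ v ≠ T'.root ∧ T'.parent (φ v) = φ (T.parent v) := by
    intro v hv
    have h1 := ((hβ _ _ (hpoly (T.parent v))).1 v (hmem v hv)).1
    rw [← hstep v hv, mem_childrenFrom] at h1
    exact ⟨h1.1, h1.2.1⟩
  have hinj : Function.Injective φ := by
    intro v
    induction v using T.parent_induction with
    | h0 =>
      intro w hw
      by_contra hne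
      rw [hroot] at hw
      exact (hchild w (Ne.symm hne)).1 hw.symm
    | h v hv ih =>
      intro w hw
      have hw0 : w ≠ T.root := by
        rintro rfl
        rw [hroot] at hw
        exact (hchild v hv).1 hw
      have hp : T.parent v = T.parent w := by
        apply ih
        rw [← (hchild v hv).2, ← (hchild w hw0).2, hw]
      refine (hβ _ _ (hpoly (T.parent v))).2 (hmem v hv) (hp ▸ hmem w hw0) ?_
      rw [← hstep v hv, hw, hstep w hw0, hp]
  refine ⟨Equiv.ofBijective φ ((Finite.injective_iff_bijective).mp hinj), fun u v => ?_⟩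
  simp only [Equiv.ofBijective_apply, IsChild]
  constructor
  · rintro ⟨hu, rfl⟩
    exact hchild u hu
  · rintro ⟨hu, hv⟩
    have hu0 : u ≠ T.root := by
      rintro rfl
      exact hu hroot
    refine ⟨hu0, hinj ?_⟩
    rw [← hv, (hchild u hu0).2]

variable {T T'} in
lemma hash_eq_of_isomorphic (h : T.Isomorphic T') {R : Type*} [CommSemiring R] (x y : R) :
    T.hash x y T.root = T'.hash x y T'.root := by
  obtain ⟨φ, hφ⟩ := h
  have hne : ∀ u, u ≠ T.root → φ u ≠ T'.root := fun u hu => ((hφ u _).mp ⟨hu, rfl⟩).1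
  have hroot : φ T.root = T'.root := by
    by_contra hr
    have := (hφ T.root (φ.symm (T'.parent (φ T.root)))).mpr ⟨hr, by simp⟩
    exact this.1 rfl
  have key : ∀ v, T.hash x y v = T'.hash x y (φ v) := by
    intro v
    induction v using T.children_induction with
    | h v ih =>
      rw [hash_eq, T'.hash_eq]
      congr 2
      refine Finset.prod_equiv φ (fun c => ?_) ih
      have := hφ c v
      simp only [IsChild] at this
      simp [mem_childrenFrom, this]
  rw [key, hroot]

open MvPolynomial in
lemma totalDegree_ev_le {α : Type} {K : Type*} [Field K] (t : BinTree α) :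
    (t.ev (X 0 : MvPolynomial (Fin 2) K) (X 1)).totalDegree ≤ t.labels.length := by
  induction t with
  | nil => simp [BinTree.ev]
  | node a l r hl hr =>
    simp only [BinTree.ev, BinTree.labels, List.length_cons, List.length_append]
    refine (totalDegree_mul _ _).trans ?_
    have h1 := totalDegree_add (X 0 : MvPolynomial (Fin 2) K) (X 1 * l.ev (X 0) (X 1))
    have h2 := totalDegree_mul (X 1 : MvPolynomial (Fin 2) K) (l.ev (X 0) (X 1))
    rw [totalDegree_X] at h1 h2
    have h3 := max_le (a := 1)
      (b := (X 1 * l.ev (X 0) (X 1) : MvPolynomial (Fin 2) K).totalDegree)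
      (c := 1 + l.labels.length) (by omega) (by omega)
    omega

open MvPolynomial in
/-- The hashes of nonisomorphic trees agree with small probability. -/
lemma card_hash_eq_le (K : Type) [Field K] [Fintype K] [DecidableEq K] (h : ¬ T.Isomorphic T') :
    ((Finset.univ.filter fun z : Fin 2 → K =>
      T.hash (z 0) (z 1) T.root = T'.hash (z 0) (z 1) T'.root).card : ℝ) ≤
      n / Fintype.card K * Fintype.card (Fin 2 → K) := by
  set D : MvPolynomial (Fin 2) K := T.hash (X 0) (X 1) T.root - T'.hash (X 0) (X 1) T'.root with hD
  have hD0 : D ≠ 0 := by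
    intro h0
    apply h
    apply T.isomorphic_of_polyHash_eq T' K
    have h1 := congrArg (aeval (R := K)
      (![Polynomial.C Polynomial.X, Polynomial.X] : Fin 2 → Polynomial (Polynomial K))) (sub_eq_zero.mp h0)
    rw [← AlgHom.coe_toRingHom, map_hash, map_hash] at h1
    simpa using h1
  have hdeg : D.totalDegree ≤ n := by
    refine (totalDegree_sub _ _).trans (max_le ?_ ?_) <;>
    · rw [← ev_encode_root]
      exact (totalDegree_ev_le _).trans (length_labels_root _).le
  have hsz := schwartz_zippel_totalDegree hD0 (Finset.univ : Finset K)
  have hset : (Finset.univ.filter fun z : Fin 2 → K =>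
      T.hash (z 0) (z 1) T.root = T'.hash (z 0) (z 1) T'.root) =
      {f ∈ Fintype.piFinset fun _ : Fin 2 => (Finset.univ : Finset K) | eval f D = 0} := by
    ext z
    simp only [Finset.mem_filter, Finset.mem_univ, true_and, Fintype.mem_piFinset, implies_true]
    rw [hD, map_sub, sub_eq_zero, map_hash, map_hash]
    simp
  rw [hset]
  have hK : (0 : ℝ) < Fintype.card K := by exact_mod_cast Fintype.card_pos
  have hsz' : (({f ∈ Fintype.piFinset fun _ : Fin 2 => (Finset.univ : Finset K) |
      eval f D = 0}.card : ℝ)) / (Fintype.card K : ℝ) ^ 2 ≤ D.totalDegree / Fintype.card K := by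
    have := (NNRat.cast_le (K := ℝ)).mpr hsz
    push_cast at this
    simpa using this
  rw [div_le_iff₀ (by positivity)] at hsz'
  refine hsz'.trans ?_
  rw [Fintype.card_fun, Fintype.card_fin]
  push_cast
  gcongr

end LabeledRootedTree

/-! ### Positions in lists -/

section Occurrences

variable {α : Type*} {L s u w : List α} {p : ℕ}

lemma List.occ_left (h : u ++ w <+: L.drop p) : u <+: L.drop p :=
  (List.prefix_append u w).trans h

lemma List.occ_right (h : u ++ w <+: L.drop p) : w <+: L.drop (p + u.length) := by
  obtain ⟨x, hx⟩ := h
  refine ⟨x, ?_⟩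
  rw [← List.drop_drop, ← hx, List.append_assoc, List.drop_left]

lemma List.occ_tail {a : α} (h : a :: w <+: L.drop p) : w <+: L.drop (p + 1) :=
  List.occ_right (u := [a]) h

lemma List.occ_getElem? {a : α} (h : a :: w <+: L.drop p) : L[p]? = some a := by
  obtain ⟨x, hx⟩ := h
  have : (L.drop p)[0]? = some a := by rw [← hx]; rfl
  simpa using this

end Occurrences

namespace BinTree

variable {α : Type}

/-- A function that assigns subtrees to positions as the Euler tour of a tree does. -/
def IsTourArray (Y : ℕ → BinTree α) : Prop :=
  ∀ p a l r, Y p = node a l r →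
    Y (p + 1) = l ∧ Y (p + 1 + l.len) = nil ∧ Y (p + 2 + l.len) = r

/-- The array with the entries of a list. -/
def ofList (M : List (BinTree α)) (p : ℕ) : BinTree α := M[p]?.getD nil

lemma ofList_of_occ {M : List (BinTree α)} {p : ℕ} {t : BinTree α}
    (h : t.subs ++ [nil] <+: M.drop p) : ofList M p = t := by
  cases t with
  | nil => simp [ofList, List.occ_getElem? h]
  | node a l r => simp [ofList, List.occ_getElem? h]

lemma occ_subs_node {M : List (BinTree α)} {p : ℕ} {a : α} {l r : BinTree α}
    (h : (node a l r).subs ++ [nil] <+: M.drop p) :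
    l.subs ++ [nil] <+: M.drop (p + 1) ∧ ofList M (p + 1 + l.len) = nil ∧
      r.subs ++ [nil] <+: M.drop (p + 2 + l.len) := by
  have h1 : l.subs ++ ([nil] ++ (r.subs ++ [nil])) <+: M.drop (p + 1) := by
    refine List.occ_tail (a := node a l r) ?_
    simpa [subs] using h
  have h2 := List.occ_right h1
  rw [length_subs] at h2
  have h3 := List.occ_right h2
  refine ⟨List.occ_left (w := r.subs ++ [nil]) (by simpa using h1), ?_, ?_⟩
  · simp [ofList, List.occ_getElem? h2]
  · convert h3 using 2
    simp; omega

lemma isTourArray_on {M : List (BinTree α)} {t : BinTree α} {p : ℕ}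
    (h : t.subs ++ [nil] <+: M.drop p) {q : ℕ} (h1 : p ≤ q) (h2 : q < p + t.len) {a : α}
    {l r : BinTree α} (hq : ofList M q = node a l r) :
    ofList M (q + 1) = l ∧ ofList M (q + 1 + l.len) = nil ∧ ofList M (q + 2 + l.len) = r := by
  induction t generalizing p with
  | nil => simp only [len] at h2; omega
  | node b l' r' hl hr =>
    obtain ⟨h3, h4, h5⟩ := occ_subs_node h
    simp only [len] at h2
    rcases Nat.lt_or_ge p q with hpq | hpq
    · rcases Nat.lt_or_ge q (p + 1 + l'.len) with h6 | h6
      · exact hl h3 hpq h6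
      · rcases Nat.lt_or_ge q (p + 2 + l'.len) with h7 | h7
        · rw [show q = p + 1 + l'.len by omega, h4] at hq
          cases hq
        · exact hr h5 h7 (by omega)
    · obtain rfl : q = p := by omega
      rw [ofList_of_occ h] at hq
      cases hq
      exact ⟨ofList_of_occ h3, h4, ofList_of_occ h5⟩

lemma tour_getElem?_iff (t : BinTree α) (k : ℕ) (v : α) :
    t.tour[k]? = some (false, v) ↔ ∃ l r, t.subs[k]? = some (node v l r) := by
  induction t generalizing k with
  | nil => simp [tour, subs]
  | node a l r hl hr =>
    simp only [tour, subs]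
    rcases k with _ | k
    · simp [eq_comm]
    · simp only [List.getElem?_cons_succ]
      rcases Nat.lt_or_ge k l.len with h | h
      · rw [List.getElem?_append_left (by rw [length_tour]; exact h),
          List.getElem?_append_left (by rw [length_subs]; exact h)]
        exact hl k
      · rw [List.getElem?_append_right (by rw [length_tour]; exact h),
          List.getElem?_append_right (by rw [length_subs]; exact h), length_tour, length_subs]
        rcases h : k - l.len with _ | j
        · simp
        · simpa using hr j

end BinTree

namespace LabeledRootedTree

variable {n : ℕ} (T : LabeledRootedTree n)

/-- The Euler tour as a partial map on arcs. -/
def nextArc : Bool × Fin n → Option (Bool × Fin n)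
  | (false, v) => some ((T.firstChild v).elim (true, v) fun u => (false, u))
  | (true, v) =>
    if v = T.root then none
    else some ((T.nextSibling v).elim (true, T.parent v) fun u => (false, u))

lemma ne_root_of_nextFrom {v u : Fin n} {lo : ℕ} (h : T.nextFrom v lo = some u) :
    u ≠ T.root ∧ T.parent u = v := by
  have := ((T.nextFrom_eq_some).mp h).1
  rw [mem_childrenFrom] at this
  exact ⟨this.1, this.2.1⟩

lemma ne_root_of_nextSibling {v u : Fin n} (h : T.nextSibling v = some u) :
    v ≠ T.root ∧ u ≠ T.root ∧ T.parent u = T.parent v := by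
  unfold nextSibling at h
  split_ifs at h with hr
  exact ⟨hr, T.ne_root_of_nextFrom h⟩

lemma isChain_tour (o : Option (Fin n)) (z : Bool × Fin n)
    (hz : ∀ v, o = some v → v ≠ T.root ∧ z = (true, T.parent v)) :
    List.IsChain (fun a b => T.nextArc a = some b) ((T.encode o).tour ++ [z]) ∧
      ((T.encode o).tour ++ [z]).head? = some (o.elim z fun u => (false, u)) := by
  induction o using T.encode_induction generalizing z with
  | h0 => simp [encode_none, BinTree.tour]
  | h1 v hl hr =>
    obtain ⟨hv, hz⟩ := hz v rfl
    obtain ⟨c1, d1⟩ := hl (true, v) fun u hu => by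
      obtain ⟨h1, h2⟩ := T.ne_root_of_nextFrom hu
      exact ⟨h1, by rw [h2]⟩
    obtain ⟨c2, d2⟩ := hr z fun u hu => by
      obtain ⟨-, h1, h2⟩ := T.ne_root_of_nextSibling hu
      exact ⟨h1, by rw [h2, hz]⟩
    rw [encode_some]
    refine ⟨?_, by simp [BinTree.tour]⟩
    simp only [BinTree.tour, List.cons_append, List.append_assoc]
    rw [List.isChain_cons, List.isChain_split, List.isChain_cons]
    refine ⟨?_, c1, ?_, c2⟩
    · intro y hy
      have : ((T.encode (T.firstChild v)).tour ++ (true, v) ::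
          ((T.encode (T.nextSibling v)).tour ++ [z])).head? =
          ((T.encode (T.firstChild v)).tour ++ [(true, v)]).head? := by
        simp [List.head?_append]
      rw [this, d1] at hy
      rw [nextArc, Option.mem_some_iff.mp hy]
    · intro y hy
      rw [d2] at hy
      rw [nextArc, if_neg hv, ← Option.mem_some_iff.mp hy, hz]

lemma isChain_tour_root :
    List.IsChain (fun a b => T.nextArc a = some b) (T.encode (some T.root)).tour := by
  obtain ⟨c1, d1⟩ := T.isChain_tour (T.firstChild T.root) (true, T.root) fun u hu => by
    obtain ⟨h1, h2⟩ := T.ne_root_of_nextFrom hu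
    exact ⟨h1, by rw [h2]⟩
  have hs : T.nextSibling T.root = none := if_pos rfl
  rw [encode_some, hs, encode_none]
  simp only [BinTree.tour]
  rw [List.isChain_cons]
  refine ⟨fun y hy => ?_, c1⟩
  rw [d1] at hy
  rw [nextArc, Option.mem_some_iff.mp hy]

lemma tour_root_eq : (T.encode (some T.root)).tour =
    (false, T.root) :: ((T.encode (T.firstChild T.root)).tour ++ [(true, T.root)]) := by
  have hs : T.nextSibling T.root = none := if_pos rfl
  rw [encode_some, hs, encode_none]
  rfl

/-- Where the arcs of a subtree are in the Euler tour. -/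
lemma tour_positions {β : Type*} (f : Bool × Fin n → β) (L : List β) (M : List (BinTree (Fin n)))
    (o : Option (Fin n)) (z : Bool × Fin n)
    (hz : ∀ v, o = some v → v ≠ T.root ∧ z = (true, T.parent v)) (p : ℕ)
    (hL : (T.encode o).tour.map f ++ [f z] <+: L.drop p)
    (hM : (T.encode o).subs ++ [.nil] <+: M.drop p) {q : ℕ} (h1 : p ≤ q)
    (h2 : q < p + (T.encode o).len) {v : Fin n} {l r : BinTree (Fin n)}
    (hq : BinTree.ofList M q = .node v l r) :
    v ≠ T.root ∧ L[q]? = some (f (false, v)) ∧ L[q + 1 + l.len]? = some (f (true, v)) ∧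
      L[q + 2 + l.len + r.len]? = some (f (true, T.parent v)) := by
  induction o using T.encode_induction generalizing z p with
  | h0 => simp only [encode_none, BinTree.len] at h2; omega
  | h1 w hl hr =>
    obtain ⟨hw, hzw⟩ := hz w rfl
    rw [encode_some] at hL hM h2
    obtain ⟨m1, m2, m3⟩ := BinTree.occ_subs_node hM
    have l1 : (T.encode (T.firstChild w)).tour.map f ++ ([f (true, w)] ++
        ((T.encode (T.nextSibling w)).tour.map f ++ [f z])) <+: L.drop (p + 1) := by
      refine List.occ_tail (a := f (false, w)) ?_
      simpa [BinTree.tour] using hL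
    have l2 := List.occ_right l1
    rw [List.length_map, BinTree.length_tour] at l2
    have l3 : (T.encode (T.nextSibling w)).tour.map f ++ [f z] <+:
        L.drop (p + 2 + (T.encode (T.firstChild w)).len) := by
      convert List.occ_right l2 using 2
      simp; omega
    simp only [BinTree.len] at h2
    rcases Nat.lt_or_ge p q with hpq | hpq
    · rcases Nat.lt_or_ge q (p + 1 + (T.encode (T.firstChild w)).len) with h6 | h6
      · refine hl (true, w) (fun u hu => ?_) (p + 1)
          (List.occ_left (w := (T.encode (T.nextSibling w)).tour.map f ++ [f z])
            (by simpa using l1)) m1 hpq h6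
        obtain ⟨h1, h2⟩ := T.ne_root_of_nextFrom hu
        exact ⟨h1, by rw [h2]⟩
      · rcases Nat.lt_or_ge q (p + 2 + (T.encode (T.firstChild w)).len) with h7 | h7
        · rw [show q = p + 1 + (T.encode (T.firstChild w)).len by omega, m2] at hq
          cases hq
        · refine hr z (fun u hu => ?_) _ l3 m3 h7 (by omega)
          obtain ⟨-, h1, h2⟩ := T.ne_root_of_nextSibling hu
          exact ⟨h1, by rw [h2, hzw]⟩
    · obtain rfl : q = p := by omega
      rw [BinTree.ofList_of_occ hM] at hq
      cases hq
      refine ⟨hw, ?_, List.occ_getElem? l2, ?_⟩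
      · exact List.occ_getElem? (w := ((T.encode (T.firstChild v)).tour ++ (true, v) ::
          (T.encode (T.nextSibling v)).tour).map f ++ [f z]) (by simpa [BinTree.tour] using hL)
      · have l4 := List.occ_right l3
        rw [List.length_map, BinTree.length_tour, hzw] at l4
        exact List.occ_getElem? l4

/-- `tour_positions` for the whole tree. -/
lemma tour_positions_root {β : Type*} (f : Bool × Fin n → β) (L : List β)
    (M : List (BinTree (Fin n))) (p : ℕ)
    (hL : (T.encode (some T.root)).tour.map f <+: L.drop p)
    (hM : (T.encode (some T.root)).subs ++ [.nil] <+: M.drop p) {q : ℕ} (h1 : p ≤ q)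
    (h2 : q < p + 2 * n) {v : Fin n} {l r : BinTree (Fin n)}
    (hq : BinTree.ofList M q = .node v l r) :
    L[q]? = some (f (false, v)) ∧ L[q + 1 + l.len]? = some (f (true, v)) ∧
      (v = T.root → r.len = 0) ∧
      (v ≠ T.root → L[q + 2 + l.len + r.len]? = some (f (true, T.parent v))) := by
  have hs : T.nextSibling T.root = none := if_pos rfl
  have hlen := T.len_encode_root
  have hM' := hM
  rw [encode_some, hs, encode_none] at hM' hlen
  rw [tour_root_eq] at hL
  simp only [BinTree.len] at hlen
  obtain ⟨m1, m2, m3⟩ := BinTree.occ_subs_node hM'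
  have l1 : (T.encode (T.firstChild T.root)).tour.map f ++ [f (true, T.root)] <+:
      L.drop (p + 1) := by
    refine List.occ_tail (a := f (false, T.root)) ?_
    simpa using hL
  have l2 := List.occ_right l1
  rw [List.length_map, BinTree.length_tour] at l2
  rcases Nat.lt_or_ge p q with hpq | hpq
  · rcases Nat.lt_or_ge q (p + 1 + (T.encode (T.firstChild T.root)).len) with h6 | h6
    · obtain ⟨h3, h4, h5, h7⟩ := T.tour_positions f L M (T.firstChild T.root) (true, T.root)
        (fun u hu => by
          obtain ⟨h1, h2⟩ := T.ne_root_of_nextFrom hu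
          exact ⟨h1, by rw [h2]⟩) (p + 1) l1 m1 hpq h6 hq
      exact ⟨h4, h5, fun h => absurd h h3, fun _ => h7⟩
    · rw [show q = p + 1 + (T.encode (T.firstChild T.root)).len by omega, m2] at hq
      cases hq
  · obtain rfl : q = p := by omega
    rw [BinTree.ofList_of_occ hM'] at hq
    cases hq
    exact ⟨List.occ_getElem? (w := ((T.encode (T.firstChild T.root)).tour ++
      [(true, T.root)]).map f) (by simpa using hL), List.occ_getElem? l2, fun _ => rfl,
      fun h => absurd rfl h⟩

end LabeledRootedTree

/-! ### The Euler tours of two trees in one cycle -/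

namespace TreePair

variable {n : ℕ} (F : Bool → LabeledRootedTree n)

/-- The number of an arc. -/
def arcId (b : Bool) (a : Bool × Fin n) : ℕ := (2 * b.toNat + a.1.toNat) * n + a.2

lemma arcId_lt (b : Bool) (a : Bool × Fin n) : arcId b a < 4 * n := by
  obtain ⟨d, v⟩ := a
  have := v.2
  cases b <;> cases d <;> simp [arcId] <;> omega

lemma arcId_inj {b b' : Bool} {a a' : Bool × Fin n} (h : arcId b a = arcId b' a') :
    b = b' ∧ a = a' := by
  obtain ⟨d, v⟩ := a
  obtain ⟨d', v'⟩ := a'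
  have := v.2
  have := v'.2
  have key : b = b' ∧ d = d' ∧ (v : ℕ) = v' := by
    cases b <;> cases d <;> cases b' <;> cases d' <;> simp [arcId] at h ⊢ <;> omega
  obtain ⟨rfl, rfl, h3⟩ := key
  obtain rfl : v = v' := Fin.ext h3
  exact ⟨rfl, rfl⟩

lemma exists_arcId {x : ℕ} (h : x < 4 * n) : ∃ (b : Bool) (a : Bool × Fin n), arcId b a = x := by
  have hn : 0 < n := by omega
  have h1 : x < 4 * n := h
  rcases Nat.lt_or_ge x (2 * n) with h2 | h2
  · rcases Nat.lt_or_ge x n with h3 | h3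
    · exact ⟨false, (false, ⟨x, h3⟩), by simp [arcId]⟩
    · exact ⟨false, (true, ⟨x - n, by omega⟩), by simp [arcId]; omega⟩
  · rcases Nat.lt_or_ge x (3 * n) with h3 | h3
    · exact ⟨true, (false, ⟨x - 2 * n, by omega⟩), by simp [arcId]; omega⟩
    · exact ⟨true, (true, ⟨x - 3 * n, by omega⟩), by simp [arcId]; omega⟩

/-- The successor of an arc in the cycle, where the numbers `4 * n`, `4 * n + 1` and `4 * n + 2`
stand for points before, between and behind the two Euler tours. -/
def succArc (b : Bool) (a : Bool × Fin n) : ℕ :=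
  ((F b).nextArc a).elim (4 * n + 1 + b.toNat) (arcId b)

open Classical in
/-- The successor map of the cycle. -/
noncomputable def succId (N x : ℕ) : ℕ :=
  if h : x < 4 * n then succArc F (exists_arcId h).choose (exists_arcId h).choose_spec.choose
  else if x = 4 * n then arcId false (false, (F false).root)
  else if x = 4 * n + 1 then arcId true (false, (F true).root)
  else if x + 1 < N then x + 1
  else 4 * n

lemma succId_arcId (N : ℕ) (b : Bool) (a : Bool × Fin n) :
    succId F N (arcId b a) = succArc F b a := by
  have h := arcId_lt b a
  rw [succId, dif_pos h]
  obtain ⟨h1, h2⟩ := arcId_inj (exists_arcId h).choose_spec.choose_spec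
  rw [h2, h1]

lemma succId_start (N : ℕ) : succId F N (4 * n) = arcId false (false, (F false).root) := by
  rw [succId, dif_neg (lt_irrefl _), if_pos rfl]

lemma succId_middle (N : ℕ) : succId F N (4 * n + 1) = arcId true (false, (F true).root) := by
  rw [succId, dif_neg (by omega), if_neg (by omega), if_pos rfl]

lemma succId_pad {N x : ℕ} (h : 4 * n + 2 ≤ x) :
    succId F N x = if x + 1 < N then x + 1 else 4 * n := by
  rw [succId, dif_neg (by omega), if_neg (by omega), if_neg (by omega)]

/-- The Euler tour of one of the trees. -/
def tourOf (b : Bool) : List ℕ := ((F b).encode (some (F b).root)).tour.map (arcId b)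

lemma length_tourOf (b : Bool) : (tourOf F b).length = 2 * n := by
  rw [tourOf, List.length_map, BinTree.length_tour, LabeledRootedTree.len_encode_root]

/-- The cycle that contains both Euler tours. -/
def cycle (N : ℕ) : List ℕ :=
  4 * n :: (tourOf F false ++ (4 * n + 1) :: (tourOf F true ++
    List.range' (4 * n + 2) (N - (4 * n + 2))))

lemma length_cycle {N : ℕ} (hN : 4 * n + 2 ≤ N) : (cycle F N).length = N := by
  simp [cycle, length_tourOf]
  omega

lemma mem_tourOf {b : Bool} {x : ℕ} : x ∈ tourOf F b ↔ ∃ a : Bool × Fin n, arcId b a = x := by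
  rw [tourOf, List.mem_map]
  constructor
  · rintro ⟨a, -, h⟩
    exact ⟨a, h⟩
  · rintro ⟨⟨d, v⟩, h⟩
    refine ⟨(d, v), ?_, h⟩
    apply List.count_pos_iff.mp
    rw [BinTree.count_tour, LabeledRootedTree.count_labels_root]
    norm_num

lemma nodup_cycle (N : ℕ) : (cycle F N).Nodup := by
  have h1 : ∀ b, (tourOf F b).Nodup := fun b =>
    (LabeledRootedTree.nodup_tour_root _).map fun a a' h => (arcId_inj h).2
  have h2 : ∀ b, ∀ x ∈ tourOf F b, x < 4 * n := fun b x hx => by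
    obtain ⟨a, rfl⟩ := (mem_tourOf F).mp hx
    exact arcId_lt b a
  rw [cycle, List.nodup_cons, List.nodup_append, List.nodup_cons, List.nodup_append]
  simp only [List.mem_append, List.mem_cons, List.mem_range'_1, not_or]
  refine ⟨⟨fun h => ?_, by omega, fun h => ?_, by omega⟩, h1 _, ⟨⟨fun h => ?_, by omega⟩, h1 _,
    List.nodup_range', ?_⟩, ?_⟩
  · exact absurd (h2 _ _ h) (by omega)
  · exact absurd (h2 _ _ h) (by omega)
  · exact absurd (h2 _ _ h) (by omega)
  · intro a ha c hc
    have := h2 _ _ ha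
    omega
  · intro a ha c hc
    have := h2 _ _ ha
    rcases hc with hc | hc | hc
    · omega
    · rintro rfl
      obtain ⟨x, hx⟩ := (mem_tourOf F).mp ha
      obtain ⟨y, hy⟩ := (mem_tourOf F).mp hc
      exact absurd (arcId_inj (hx.trans hy.symm)).1 (by simp)
    · omega

lemma mem_cycle {N x : ℕ} (hN : 4 * n + 2 ≤ N) : x ∈ cycle F N ↔ x < N := by
  simp only [cycle, List.mem_append, List.mem_cons, List.mem_range'_1, mem_tourOf]
  constructor
  · rintro (rfl | ⟨a, rfl⟩ | rfl | ⟨a, rfl⟩ | h)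
    · omega
    · have := arcId_lt false a; omega
    · omega
    · have := arcId_lt true a; omega
    · omega
  · intro hx
    rcases Nat.lt_or_ge x (4 * n) with h | h
    · obtain ⟨b, a, rfl⟩ := exists_arcId h
      cases b
      · exact Or.inr (Or.inl ⟨a, rfl⟩)
      · exact Or.inr (Or.inr (Or.inr (Or.inl ⟨a, rfl⟩)))
    · by_cases h1 : x = 4 * n
      · exact Or.inl h1
      · by_cases h2 : x = 4 * n + 1
        · exact Or.inr (Or.inr (Or.inl h2))
        · exact Or.inr (Or.inr (Or.inr (Or.inr (by omega))))

lemma isChain_tourOf (N : ℕ) (b : Bool) :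
    List.IsChain (fun x y => succId F N x = y) (tourOf F b) := by
  rw [tourOf, List.isChain_map]
  refine (F b).isChain_tour_root.imp fun a a' h => ?_
  rw [succId_arcId, succArc, h]
  rfl

lemma head?_tourOf (b : Bool) : (tourOf F b).head? = some (arcId b (false, (F b).root)) := by
  simp [tourOf, LabeledRootedTree.tour_root_eq]

lemma getLast?_tourOf (b : Bool) :
    (tourOf F b).getLast? = some (arcId b (true, (F b).root)) := by
  rw [tourOf, LabeledRootedTree.tour_root_eq, List.map_cons, List.map_append, ← List.cons_append,
    List.map_singleton, List.getLast?_concat]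

lemma succId_last (N : ℕ) (b : Bool) :
    succId F N (arcId b (true, (F b).root)) = 4 * n + 1 + b.toNat := by
  rw [succId_arcId, succArc, LabeledRootedTree.nextArc, if_pos rfl]
  rfl

lemma isChain_cycle {N : ℕ} (hN : 4 * n + 3 ≤ N) :
    List.IsChain (fun x y => succId F N x = y) (cycle F N) := by
  rw [cycle, List.isChain_cons, List.isChain_append, List.isChain_cons, List.isChain_append]
  refine ⟨?_, isChain_tourOf F N false, ⟨?_, isChain_tourOf F N true, ?_, ?_⟩, ?_⟩
  · intro y hy
    rw [List.head?_append, head?_tourOf] at hy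
    rw [succId_start]
    simpa using hy
  · intro y hy
    rw [List.head?_append, head?_tourOf] at hy
    rw [succId_middle]
    simpa using hy
  · rw [List.isChain_iff_getElem]
    intro i hi
    rw [List.length_range'] at hi
    simp only [List.getElem_range']
    rw [succId_pad F (by omega), if_pos (by omega)]
    ring
  · intro x hx y hy
    rw [getLast?_tourOf] at hx
    rw [List.head?_range', if_neg (by omega)] at hy
    simp only [Option.mem_some_iff] at hx hy
    rw [← hx, succId_last, ← hy]
    rfl
  · intro x hx y hy
    rw [getLast?_tourOf] at hx
    simp only [List.head?_cons, Option.mem_some_iff] at hx hy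
    rw [← hx, succId_last, ← hy]
    rfl

/-- The position of a number in the cycle. -/
def position (N x : ℕ) : ℕ := (cycle F N).idxOf x

variable {F} {N : ℕ}

lemma position_lt (hN : 4 * n + 2 ≤ N) {x : ℕ} (hx : x < N) : position F N x < N := by
  have := List.idxOf_lt_length_of_mem ((mem_cycle F hN).mpr hx)
  rwa [length_cycle F hN] at this

lemma position_eq_of_getElem? {x p : ℕ} (h : (cycle F N)[p]? = some x) : position F N x = p := by
  obtain ⟨h1, h2⟩ := List.getElem?_eq_some_iff.mp h
  rw [position, ← h2, (nodup_cycle F N).idxOf_getElem]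

lemma getElem?_position (hN : 4 * n + 2 ≤ N) {x : ℕ} (hx : x < N) :
    (cycle F N)[position F N x]? = some x := by
  rw [List.getElem?_eq_some_iff]
  exact ⟨by rw [length_cycle F hN]; exact position_lt hN hx,
    List.getElem_idxOf (List.idxOf_lt_length_of_mem ((mem_cycle F hN).mpr hx))⟩

lemma position_start : position F N (4 * n) = 0 := position_eq_of_getElem? rfl

lemma succId_getElem (hN : 4 * n + 3 ≤ N) {p x : ℕ} (h : (cycle F N)[p]? = some x) :
    (cycle F N)[(p + 1) % N]? = some (succId F N x) := by
  have hl := length_cycle F (N := N) (by omega)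
  obtain ⟨h1, h2⟩ := List.getElem?_eq_some_iff.mp h
  rw [hl] at h1
  rcases Nat.lt_or_ge (p + 1) N with h3 | h3
  · rw [Nat.mod_eq_of_lt h3, List.getElem?_eq_some_iff]
    refine ⟨by omega, ?_⟩
    rw [← h2]
    exact ((List.isChain_iff_getElem.mp (isChain_cycle F hN)) p (by omega)).symm
  · obtain rfl : N = p + 1 := by omega
    rw [Nat.mod_self]
    have hx : x = p := by
      rw [← h2]
      simp only [cycle]
      rw [List.getElem_cons]
      rw [dif_neg (by omega), List.getElem_append_right (by rw [length_tourOf]; omega)]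
      rw [List.getElem_cons, dif_neg (by rw [length_tourOf]; omega),
        List.getElem_append_right (by rw [length_tourOf, length_tourOf]; omega),
        List.getElem_range', length_tourOf, length_tourOf]
      omega
    rw [hx, succId_pad F (by omega), if_neg (by omega)]
    rfl

lemma succId_lt (hN : 4 * n + 3 ≤ N) {x : ℕ} (hx : x < N) : succId F N x < N := by
  have := succId_getElem hN (getElem?_position (F := F) (by omega) hx)
  exact (mem_cycle F (by omega)).mp (List.mem_of_getElem? this)

lemma position_succId (hN : 4 * n + 3 ≤ N) {x : ℕ} (hx : x < N) :
    position F N (succId F N x) = (position F N x + 1) % N :=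
  position_eq_of_getElem? (succId_getElem hN (getElem?_position (by omega) hx))

/-- From every point of the cycle one reaches every other one. -/
lemma exists_iterate_succId (hN : 4 * n + 3 ≤ N) {x y : ℕ} (hx : x < N) (hy : y < N) :
    ∃ k, (succId F N)^[k] x = y := by
  have key : ∀ k, (succId F N)^[k] x < N ∧
      position F N ((succId F N)^[k] x) = (position F N x + k) % N := by
    intro k
    induction k with
    | zero => exact ⟨hx, (Nat.mod_eq_of_lt (position_lt (by omega) hx)).symm⟩
    | succ k ih =>
      rw [Function.iterate_succ_apply']
      refine ⟨succId_lt hN ih.1, ?_⟩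
      rw [position_succId hN ih.1, ih.2, Nat.mod_add_mod, add_assoc]
  have hpx := position_lt (F := F) (by omega) hx
  have hpy := position_lt (F := F) (by omega) hy
  refine ⟨position F N y + N - position F N x, ?_⟩
  obtain ⟨h1, h2⟩ := key (position F N y + N - position F N x)
  rw [show position F N x + (position F N y + N - position F N x) = position F N y + N by omega,
    Nat.add_mod_right, Nat.mod_eq_of_lt hpy] at h2
  have h3 := getElem?_position (F := F) (by omega) h1
  rw [h2, getElem?_position (by omega) hy] at h3
  exact (Option.some_injective _ h3).symm

variable (F)

/-- The list of the subtrees at the positions of the cycle. -/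
def subList : List (BinTree (Fin n)) :=
  .nil :: (((F false).encode (some (F false).root)).subs ++ .nil ::
    (((F true).encode (some (F true).root)).subs ++ [.nil]))

/-- The subtree at a position of the cycle. -/
def sub (p : ℕ) : BinTree (Fin n) := BinTree.ofList (subList F) p

/-- The position of the root. -/
def rootPos (n : ℕ) (b : Bool) : ℕ := 1 + b.toNat * (2 * n + 1)

lemma occ_subList (b : Bool) :
    ((F b).encode (some (F b).root)).subs ++ [.nil] <+: (subList F).drop (rootPos n b) := by
  have h1 : ((F false).encode (some (F false).root)).subs ++ ([.nil] ++
      (((F true).encode (some (F true).root)).subs ++ [.nil])) <+: (subList F).drop 1 := by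
    simp [subList]
  cases b
  · exact List.occ_left (w := ((F true).encode (some (F true).root)).subs ++ [.nil])
      (by simpa [rootPos] using h1)
  · have h2 := List.occ_right (List.occ_right h1)
    rw [BinTree.length_subs, LabeledRootedTree.len_encode_root] at h2
    simpa [rootPos, add_assoc, add_comm, add_left_comm] using h2

lemma occ_cycle (N : ℕ) (b : Bool) : tourOf F b <+: (cycle F N).drop (rootPos n b) := by
  have h1 : tourOf F false ++ ([4 * n + 1] ++ (tourOf F true ++
      List.range' (4 * n + 2) (N - (4 * n + 2)))) <+: (cycle F N).drop 1 := by
    simp [cycle]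
  cases b
  · exact List.occ_left (by simpa [rootPos] using h1)
  · have h2 := List.occ_right (List.occ_right h1)
    rw [length_tourOf] at h2
    refine List.occ_left (w := List.range' (4 * n + 2) (N - (4 * n + 2))) ?_
    simpa [rootPos, add_assoc, add_comm, add_left_comm] using h2

lemma sub_rootPos (b : Bool) : sub F (rootPos n b) = (F b).encode (some (F b).root) :=
  BinTree.ofList_of_occ (occ_subList F b)

lemma sub_rootPos_len (b : Bool) : (sub F (rootPos n b)).len = 2 * n := by
  rw [sub_rootPos, LabeledRootedTree.len_encode_root]

lemma exists_of_sub_ne_nil {p : ℕ} (h : sub F p ≠ .nil) :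
    ∃ b, rootPos n b ≤ p ∧ p < rootPos n b + 2 * n := by
  by_contra! hc
  apply h
  have h0 := hc false
  have h1 := hc true
  simp only [rootPos, Bool.toNat_false, Bool.toNat_true] at h0 h1
  have hl : ∀ b, ((F b).encode (some (F b).root)).subs.length = 2 * n := fun b => by
    rw [BinTree.length_subs, LabeledRootedTree.len_encode_root]
  have hp : p = 0 ∨ p = 2 * n + 1 ∨ 4 * n + 2 ≤ p := by omega
  simp only [sub, BinTree.ofList, subList]
  rcases hp with rfl | rfl | hp
  · rfl
  · rw [List.getElem?_cons_succ, List.getElem?_append_right (by rw [hl]), hl, Nat.sub_self]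
    rfl
  · obtain ⟨q, rfl⟩ := Nat.exists_eq_add_of_le hp
    rw [show 4 * n + 2 + q = (4 * n + 1 + q) + 1 by ring, List.getElem?_cons_succ,
      List.getElem?_append_right (by rw [hl]; omega), hl,
      show 4 * n + 1 + q - 2 * n = (2 * n + q) + 1 by omega, List.getElem?_cons_succ,
      List.getElem?_append_right (by rw [hl]; omega), hl, show 2 * n + q - 2 * n = q by omega]
    cases q <;> simp

lemma isTourArray_sub : BinTree.IsTourArray (sub F) := by
  intro p a l r h
  obtain ⟨b, h1, h2⟩ := exists_of_sub_ne_nil F (p := p) (by rw [h]; simp)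
  refine BinTree.isTourArray_on (occ_subList F b) h1 ?_ h
  rw [LabeledRootedTree.len_encode_root]
  exact h2

variable {F}

/-- The subtree at a position in terms of the positions of arcs. -/
lemma sub_eq_node {p : ℕ} {v : Fin n} {l r : BinTree (Fin n)}
    (h : sub F p = .node v l r) : ∃ b, p = position F N (arcId b (false, v)) ∧
      position F N (arcId b (true, v)) = p + 1 + l.len ∧ (v = (F b).root → r.len = 0) ∧
      (v ≠ (F b).root →
        position F N (arcId b (true, (F b).parent v)) = p + 2 + l.len + r.len) := by
  obtain ⟨b, h1, h2⟩ := exists_of_sub_ne_nil F (p := p) (by rw [h]; simp)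
  obtain ⟨h3, h4, h5, h6⟩ := (F b).tour_positions_root (arcId b) (cycle F N) (subList F)
    (rootPos n b) (occ_cycle F N b) (occ_subList F b) h1 h2 h
  exact ⟨b, (position_eq_of_getElem? h3).symm, position_eq_of_getElem? h4, h5,
    fun hv => position_eq_of_getElem? (h6 hv)⟩

lemma exists_sub_eq_node (b : Bool) (v : Fin n) :
    ∃ l r, sub F (position F N (arcId b (false, v))) = .node v l r := by
  have h1 : arcId b (false, v) ∈ tourOf F b := (mem_tourOf F).mpr ⟨_, rfl⟩
  obtain ⟨k, hk, hk'⟩ := List.mem_iff_getElem.mp h1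
  obtain ⟨x, hx⟩ := occ_cycle F N b
  have h2 : (cycle F N)[rootPos n b + k]? = some (arcId b (false, v)) := by
    rw [← List.getElem?_drop, ← hx, List.getElem?_append_left hk, List.getElem?_eq_getElem hk, hk']
  rw [position_eq_of_getElem? h2]
  have h3 : ((F b).encode (some (F b).root)).tour[k]? = some (false, v) := by
    simp only [tourOf, List.length_map] at hk
    rw [List.getElem?_eq_getElem hk]
    simp only [tourOf, List.getElem_map] at hk'
    rw [(arcId_inj hk').2]
  obtain ⟨l, r, h4⟩ := (BinTree.tour_getElem?_iff _ _ _).mp h3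
  refine ⟨l, r, ?_⟩
  obtain ⟨y, hy⟩ := occ_subList F b
  obtain ⟨hk2, -⟩ := List.getElem?_eq_some_iff.mp h4
  have h5 : (subList F)[rootPos n b + k]? = some (.node v l r) := by
    rw [← List.getElem?_drop, ← hy, List.append_assoc, List.getElem?_append_left hk2, h4]
  simp [sub, BinTree.ofList, h5]

end TreePair

/-! ### Intervals of products -/

/-- The product of `w` over the interval from `a` to `b - 1`. -/
def intervalProd {G : Type*} [Monoid G] (w : ℕ → G) (a b : ℕ) : G :=
  ((List.range' a (b - a)).map w).prod

lemma intervalProd_self {G : Type*} [Monoid G] (w : ℕ → G) (a : ℕ) : intervalProd w a a = 1 := by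
  simp [intervalProd]

lemma intervalProd_mul {G : Type*} [Monoid G] (w : ℕ → G) {a b c : ℕ} (h1 : a ≤ b) (h2 : b ≤ c) :
    intervalProd w a b * intervalProd w b c = intervalProd w a c := by
  rw [intervalProd, intervalProd, intervalProd, ← List.prod_append, ← List.map_append,
    show b = a + (b - a) by omega, show c - a = (b - a) + (c - b) by omega,
    ← List.range'_append_1]
  congr 4 <;> omega

lemma intervalProd_succ {G : Type*} [Monoid G] (w : ℕ → G) {a b : ℕ} (h : a < b) :
    intervalProd w a b = w a * intervalProd w (a + 1) b := by
  rw [← intervalProd_mul w (Nat.le_succ a) h]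
  simp [intervalProd]

/-! ### Composition of affine maps along a chain -/

/-- The affine map `t ↦ a * t + b`, composed along a part of a sequence that may have an end. -/
@[ext] structure Seg (R E : Type) : Type where
  a : R
  b : R
  e : Option E

namespace Seg

variable {R E : Type} [CommRing R]

instance : Mul (Seg R E) where
  mul s t := if s.e.isSome then s else ⟨s.a * t.a, s.a * t.b + s.b, t.e⟩

instance : One (Seg R E) where
  one := ⟨1, 0, none⟩

lemma mul_def (s t : Seg R E) :
    s * t = if s.e.isSome then s else ⟨s.a * t.a, s.a * t.b + s.b, t.e⟩ := rfl

lemma one_def : (1 : Seg R E) = ⟨1, 0, none⟩ := rfl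

lemma mul_of_none {s : Seg R E} (h : s.e = none) (t : Seg R E) :
    s * t = ⟨s.a * t.a, s.a * t.b + s.b, t.e⟩ := by
  rw [mul_def, h]; rfl

lemma mul_of_some {s : Seg R E} {e : E} (h : s.e = some e) (t : Seg R E) : s * t = s := by
  rw [mul_def, h]; rfl

instance : Monoid (Seg R E) where
  mul_assoc s t u := by
    rcases hs : s.e with _ | e
    · rcases ht : t.e with _ | f
      · rw [mul_of_none hs, mul_of_none ht, mul_of_none (by exact ht), mul_of_none hs]
        ext <;> simp <;> ring
      · rw [mul_of_some ht, mul_of_none hs, mul_of_some (e := f) (by exact ht)]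
    · rw [mul_of_some hs, mul_of_some hs, mul_of_some hs]
  one_mul s := by rw [one_def, mul_of_none rfl]; ext <;> simp
  mul_one s := by
    rcases hs : s.e with _ | e
    · rw [mul_of_none hs, one_def]; ext <;> simp [hs]
    · rw [mul_of_some hs]

variable {N : ℕ}

/-- The parts of a sequence up to its successive ends. -/
def reduce (acc : Seg R (Fin N × Bool)) :
    List (Seg R (Fin N × Bool)) → List (R × R × Bool)
  | [] => []
  | w :: ws => match (acc * w).e with
    | none => reduce (acc * w) ws
    | some f => ((acc * w).a, (acc * w).b, f.2) :: reduce 1 ws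

lemma length_reduce_le (ws : List (Seg R (Fin N × Bool))) (acc : Seg R (Fin N × Bool)) :
    (reduce acc ws).length ≤ ws.length := by
  induction ws generalizing acc with
  | nil => simp [reduce]
  | cons w ws ih =>
    rw [reduce]
    rcases (acc * w).e with _ | f
    · exact (ih _).trans (by simp)
    · simpa using ih 1

lemma reduce_one_cons {acc : Seg R (Fin N × Bool)} (h : acc.e = none)
    (ws : List (Seg R (Fin N × Bool))) : reduce acc (1 :: ws) = reduce acc ws := by
  rw [reduce, mul_one, h]

lemma reduce_ones {acc : Seg R (Fin N × Bool)} (h : acc.e = none)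
    (us ws : List (Seg R (Fin N × Bool))) (hu : ∀ u ∈ us, u = 1) :
    reduce acc (us ++ ws) = reduce acc ws := by
  induction us with
  | nil => rfl
  | cons u us ih =>
    rw [hu u List.mem_cons_self, List.cons_append, reduce_one_cons h,
      ih fun u hu' => hu u (List.mem_cons_of_mem _ hu')]

variable [NeZero N]

/-- The same parts, read off from the products up to the end of the sequence. -/
def collect (Z : ℕ → Seg R (Fin N × Bool)) (halt : ℕ) : ℕ → ℕ → List (R × R × Bool)
  | 0, _ => []
  | f + 1, q =>
    if halt ≤ q then []
    else match (Z q).e with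
      | none => []
      | some e =>
        if (e.1 : ℕ) < halt then ((Z q).a, (Z q).b, e.2) :: collect Z halt f (e.1 + 1) else []

lemma le_end_intervalProd {w : ℕ → Seg R (Fin N × Bool)}
    (hw : ∀ p < N, ∀ e, (w p).e = some e → (e.1 : ℕ) = p) {q : ℕ} (hq : q ≤ N)
    {e : Fin N × Bool} (he : (intervalProd w q N).e = some e) : q ≤ e.1 := by
  induction hk : N - q generalizing q with
  | zero =>
    obtain rfl : q = N := by omega
    rw [intervalProd_self] at he
    cases he
  | succ k ih =>
    rw [intervalProd_succ w (by omega)] at he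
    rcases h : (w q).e with _ | f
    · rw [mul_of_none h] at he
      exact (Nat.le_succ q).trans (ih (by omega) he (by omega))
    · rw [mul_of_some h] at he
      exact (hw q (by omega) e he).ge

lemma reduce_eq_aux {w : ℕ → Seg R (Fin N × Bool)}
    (hw : ∀ p < N, ∀ e, (w p).e = some e → (e.1 : ℕ) = p) {halt : ℕ} (hs : halt ≤ N)
    {q : ℕ} (hq : q ≤ halt) {acc : Seg R (Fin N × Bool)} (hacc : acc.e = none) :
    reduce acc ((List.range' q (halt - q)).map w) =
      match (acc * intervalProd w q N).e with
      | none => []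
      | some e => if (e.1 : ℕ) < halt then
          ((acc * intervalProd w q N).a, (acc * intervalProd w q N).b, e.2) ::
            reduce 1 ((List.range' (e.1 + 1) (halt - (e.1 + 1))).map w) else [] := by
  induction hk : halt - q generalizing q acc with
  | zero =>
    obtain rfl : q = halt := by omega
    rcases h : (acc * intervalProd w q N).e with _ | e
    · simp [reduce]
    · rw [mul_of_none hacc] at h
      have := le_end_intervalProd hw hs h
      simp only
      rw [if_neg (by omega)]
      simp [reduce]
  | succ k ih =>
    have hqs : q < halt := by omega
    rw [List.range'_succ, List.map_cons, reduce, intervalProd_succ w (by omega), ← mul_assoc]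
    rcases h : (acc * w q).e with _ | f
    · exact ih hqs h (by omega)
    · have hf : (f.1 : ℕ) = q := by
        rw [mul_of_none hacc] at h
        exact hw q (by omega) f h
      rw [mul_of_some h]
      simp only [h]
      rw [hf, if_pos hqs, show halt - (q + 1) = k by omega]

lemma collect_eq_reduce {w : ℕ → Seg R (Fin N × Bool)}
    (hw : ∀ p < N, ∀ e, (w p).e = some e → (e.1 : ℕ) = p) {halt : ℕ} (hs : halt ≤ N)
    {Z : ℕ → Seg R (Fin N × Bool)} (hZ : ∀ q < N, Z q = intervalProd w q N)
    {f q : ℕ} (hf : halt ≤ q + f) :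
    collect Z halt f q = reduce 1 ((List.range' q (halt - q)).map w) := by
  induction f generalizing q with
  | zero => simp [collect, reduce, show halt - q = 0 by omega]
  | succ f ih =>
    rw [collect]
    split_ifs with h
    · simp [reduce, show halt - q = 0 by omega]
    · rw [reduce_eq_aux hw hs (by omega) rfl, one_mul, hZ q (by omega)]
      rcases he : (intervalProd w q N).e with _ | e
      · rfl
      · have := le_end_intervalProd hw (by omega) he
        simp only
        rw [ih (by omega)]

end Seg

/-! ### Evaluation of the hash in stages -/

namespace BinTree

variable {α R : Type} [CommRing R] (x y : R) (m i N : ℕ) [NeZero N]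

/-- The weight of a node of class `i` at position `p` whose left and right subtrees have the
lengths `sl` and `sr` and the hashes `el` and `er`. -/
def nodeWeight (sl sr p : ℕ) (el er : R) : Seg R (Fin N × Bool) :=
  if Nat.log m (2 + sl + sr) ≠ i then 1
  else if m ^ i ≤ sl then
    if m ^ i ≤ sr then ⟨1, 0, some (Fin.ofNat N p, true)⟩ else ⟨y * er, x * er, none⟩
  else if m ^ i ≤ sr then ⟨x + y * el, 0, none⟩
  else ⟨0, (x + y * el) * er, some (Fin.ofNat N p, false)⟩

/-- The weight of a position. -/
def weight (Y : ℕ → BinTree α) (p : ℕ) : Seg R (Fin N × Bool) :=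
  match Y p with
  | nil => 1
  | node _ l r => nodeWeight x y m i N l.len r.len p (l.ev x y) (r.ev x y)

/-- One step of the evaluation of a sequence of parts, with a stack of values. -/
def stackStep (s : R × R × Bool) (st : List R) : List R :=
  if s.2.2 then (s.1 * ((x + y * st.getD 0 0) * st.getD 1 0) + s.2.1) :: st.drop 2
  else s.2.1 :: st

/-- Evaluation of a sequence of parts. -/
def stackEval (l : List (R × R × Bool)) : R := (l.foldr (stackStep x y) []).getD 0 0

variable {x y m i N}

lemma weight_end {Y : ℕ → BinTree α} {p : ℕ} (hp : p < N) {e : Fin N × Bool}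
    (h : (weight x y m i N Y p).e = some e) : (e.1 : ℕ) = p := by
  unfold weight at h
  rcases hY : Y p with _ | ⟨a, l, r⟩
  · rw [hY] at h
    cases h
  · rw [hY] at h
    simp only [nodeWeight] at h
    split_ifs at h <;> cases h <;> exact Nat.mod_eq_of_lt hp

lemma weight_eq_one_of_len_lt {Y : ℕ → BinTree α} (hY : IsTourArray Y) {t : BinTree α} {q : ℕ}
    (hq : Y q = t) (ht : t.len < m ^ i) {p : ℕ} (h1 : q ≤ p) (h2 : p < q + t.len) :
    weight x y m i N Y p = 1 := by
  induction t generalizing q with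
  | nil => simp only [len] at h2; omega
  | node a l r hl hr =>
    obtain ⟨c1, c2, c3⟩ := hY q a l r hq
    have ht' := ht
    simp only [len] at h2 ht
    rcases Nat.lt_or_ge q p with h3 | h3
    · rcases Nat.lt_or_ge p (q + 1 + l.len) with h4 | h4
      · exact hl c1 (by omega) h3 h4
      · rcases Nat.lt_or_ge p (q + 2 + l.len) with h5 | h5
        · rw [weight, show p = q + 1 + l.len by omega, c2]
        · exact hr c3 (by omega) h5 (by omega)
    · obtain rfl : p = q := by omega
      rw [weight, hq]
      simp only [nodeWeight]
      rw [if_pos]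
      exact (Nat.log_lt_of_lt_pow (by omega) (by simpa only [len] using ht')).ne

lemma range'_len_node {G : Type*} (w : ℕ → G) (q : ℕ) (a : α) (l r : BinTree α) :
    (List.range' q (node a l r).len).map w =
      w q :: ((List.range' (q + 1) l.len).map w ++ w (q + 1 + l.len) ::
        (List.range' (q + 2 + l.len) r.len).map w) := by
  rw [len, show 2 + l.len + r.len = (l.len + (r.len + 1)) + 1 by ring, List.range'_succ,
    ← List.range'_append_1, List.range'_succ]
  simp only [List.map_cons, List.map_append]
  rw [show q + 1 + l.len + 1 = q + 2 + l.len by ring]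

/-- A subtree of class `i` reduces to a sequence of parts that evaluates to its hash. -/
lemma exists_reduce_eq {Y : ℕ → BinTree α} (hY : IsTourArray Y) (hm : 2 ≤ m) {t : BinTree α}
    {q : ℕ} (hq : Y q = t) (h1 : m ^ i ≤ t.len) (h2 : t.len < m ^ (i + 1))
    {acc : Seg R (Fin N × Bool)} (hacc : acc.e = none) (rest : List (Seg R (Fin N × Bool))) :
    ∃ its, Seg.reduce acc ((List.range' q t.len).map (weight x y m i N Y) ++ rest) =
        its ++ Seg.reduce 1 rest ∧
      (its.length + 1) * m ^ i ≤ 2 * t.len ∧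
      ∀ st, its.foldr (stackStep x y) st = (acc.a * t.ev x y + acc.b) :: st := by
  induction t generalizing q acc rest with
  | nil =>
    have : 0 < m ^ i := by positivity
    simp only [len] at h1
    omega
  | node a l r hl hr =>
    obtain ⟨c1, c2, c3⟩ := hY q a l r hq
    have hwl := weight_eq_one_of_len_lt (m := m) (x := x) (y := y) (N := N) (i := i) hY c1
    have hwr := weight_eq_one_of_len_lt (m := m) (x := x) (y := y) (N := N) (i := i) hY c3
    have hlog : Nat.log m (2 + l.len + r.len) = i := by
      rw [Nat.log_eq_iff (Or.inr ⟨by omega, by omega⟩)]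
      exact ⟨h1, h2⟩
    have hw1 : weight x y m i N Y (q + 1 + l.len) = 1 := by rw [weight, c2]
    have hwq : weight x y m i N Y q =
        nodeWeight x y m i N l.len r.len q (l.ev x y) (r.ev x y) := by rw [weight, hq]
    have ones : ∀ {s k : ℕ}, (∀ p, s ≤ p → p < s + k → weight x y m i N Y p = 1) →
        ∀ u ∈ (List.range' s k).map (weight x y m i N Y), u = 1 := by
      intro s k h u hu
      obtain ⟨p, hp, rfl⟩ := List.mem_map.mp hu
      rw [List.mem_range'_1] at hp
      exact h p hp.1 hp.2
    rw [range'_len_node, hw1, List.cons_append, List.append_assoc, List.cons_append, Seg.reduce,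
      hwq, nodeWeight, if_neg (by simp [hlog])]
    simp only [len] at h2
    by_cases hl1 : m ^ i ≤ l.len
    · rw [if_pos hl1]
      by_cases hr1 : m ^ i ≤ r.len
      · rw [if_pos hr1, Seg.mul_of_none hacc]
        simp only
        obtain ⟨i1, e1, n1, s1⟩ := hl c1 hl1 (by omega) (acc := 1) rfl
          (1 :: ((List.range' (q + 2 + l.len) r.len).map (weight x y m i N Y) ++ rest))
        obtain ⟨i2, e2, n2, s2⟩ := hr c3 hr1 (by omega) (acc := 1) rfl rest
        refine ⟨(acc.a * 1, acc.a * 0 + acc.b, true) :: (i1 ++ i2), ?_, ?_, ?_⟩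
        · rw [e1, Seg.reduce_one_cons rfl, e2]
          simp
        · simp only [List.length_cons, List.length_append, len]
          nlinarith
        · intro st
          rw [List.foldr_cons, List.foldr_append, s2, s1]
          simp [stackStep, ev, Seg.one_def]
      · rw [if_neg hr1, Seg.mul_of_none hacc]
        simp only
        obtain ⟨i1, e1, n1, s1⟩ := hl c1 hl1 (by omega)
          (acc := ⟨acc.a * (y * r.ev x y), acc.a * (x * r.ev x y) + acc.b, none⟩) rfl
          (1 :: ((List.range' (q + 2 + l.len) r.len).map (weight x y m i N Y) ++ rest))
        refine ⟨i1, ?_, ?_, ?_⟩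
        · rw [e1, Seg.reduce_one_cons rfl,
            Seg.reduce_ones rfl _ _ (ones fun p h3 h4 => hwr (by omega) h3 h4)]
        · simp only [len]; omega
        · intro st
          rw [s1]
          simp only [ev]
          congr 1
          ring
    · rw [if_neg hl1]
      by_cases hr1 : m ^ i ≤ r.len
      · rw [if_pos hr1, Seg.mul_of_none hacc]
        simp only
        obtain ⟨i1, e1, n1, s1⟩ := hr c3 hr1 (by omega)
          (acc := ⟨acc.a * (x + y * l.ev x y), acc.a * 0 + acc.b, none⟩) rfl rest
        refine ⟨i1, ?_, ?_, ?_⟩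
        · rw [Seg.reduce_ones rfl _ _ (ones fun p h3 h4 => hwl (by omega) h3 h4),
            Seg.reduce_one_cons rfl, e1]
        · simp only [len]; omega
        · intro st
          rw [s1]
          simp only [ev]
          congr 1
          ring
      · rw [if_neg hr1, Seg.mul_of_none hacc]
        simp only
        refine ⟨[(acc.a * 0, acc.a * ((x + y * l.ev x y) * r.ev x y) + acc.b, false)], ?_, ?_, ?_⟩
        · rw [Seg.reduce_ones rfl _ _ (ones fun p h3 h4 => hwl (by omega) h3 h4),
            Seg.reduce_one_cons rfl,
            Seg.reduce_ones rfl _ _ (ones fun p h3 h4 => hwr (by omega) h3 h4)]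
          rfl
        · simp only [List.length_cons, List.length_nil]
          omega
        · intro st
          simp [stackStep, ev]

/-- Evaluation of a subtree of class `i` from products up to the end of the sequence. -/
lemma stackEval_collect {Y : ℕ → BinTree α} (hY : IsTourArray Y) (hm : 2 ≤ m) {q : ℕ}
    (hq : Y q ≠ nil) (hi : Nat.log m (Y q).len = i) (hN : q + (Y q).len ≤ N)
    {Z : ℕ → Seg R (Fin N × Bool)}
    (hZ : ∀ q < N, Z q = intervalProd (weight x y m i N Y) q N) {f : ℕ} (hf : (Y q).len ≤ f) :
    stackEval x y (Seg.collect Z (q + (Y q).len) f q) = (Y q).ev x y ∧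
      ((Seg.collect Z (q + (Y q).len) f q).length + 1) * m ^ i ≤ 2 * (Y q).len ∧
      (Seg.collect Z (q + (Y q).len) f q).length ≤ (Y q).len := by
  have h0 : (Y q).len ≠ 0 := by
    rcases h : Y q with _ | ⟨a, l, r⟩
    · exact absurd h hq
    · simp only [len]; omega
  have hlog := (Nat.log_eq_iff (Or.inr ⟨by omega, h0⟩)).mp hi
  rw [Seg.collect_eq_reduce (fun p hp e he => weight_end hp he) hN hZ (by omega),
    Nat.add_sub_cancel_left]
  obtain ⟨its, e1, n1, s1⟩ := exists_reduce_eq (x := x) (y := y) (N := N) (i := i) hY hm rfl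
    hlog.1 hlog.2 (acc := 1) rfl []
  rw [List.append_nil] at e1
  have e2 : Seg.reduce 1 ((List.range' q (Y q).len).map (weight x y m i N Y)) = its := by
    rw [e1]; simp [Seg.reduce]
  refine ⟨?_, ?_, ?_⟩
  · rw [e2, stackEval, s1]
    simp [Seg.one_def]
  · rw [e2]; exact n1
  · refine (Seg.length_reduce_le _ _).trans ?_
    simp

/-! ### Nested subtrees -/

lemma len_pos {t : BinTree α} (h : t ≠ nil) : 2 ≤ t.len := by
  cases t with
  | nil => exact absurd rfl h
  | node a l r => simp only [len]; omega

lemma nested {Y : ℕ → BinTree α} (hY : IsTourArray Y) {t : BinTree α} {q p : ℕ} (hq : Y q = t)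
    (h1 : q < p) (h2 : p < q + t.len) (hp : Y p ≠ nil) :
    (Y p).len < t.len ∧ p + (Y p).len ≤ q + t.len := by
  induction t generalizing q with
  | nil => simp only [len] at h2; omega
  | node a l r hl hr =>
    obtain ⟨c1, c2, c3⟩ := hY q a l r hq
    simp only [len] at h2 ⊢
    rcases Nat.lt_or_ge p (q + 1 + l.len) with h4 | h4
    · rcases Nat.lt_or_ge (q + 1) p with h5 | h5
      · have := hl c1 h5 h4
        omega
      · obtain rfl : p = q + 1 := by omega
        rw [c1]
        omega
    · rcases Nat.lt_or_ge p (q + 2 + l.len) with h5 | h5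
      · rw [show p = q + 1 + l.len by omega, c2] at hp
        exact absurd rfl hp
      · rcases Nat.lt_or_ge (q + 2 + l.len) p with h6 | h6
        · have := hr c3 h6 (by omega)
          omega
        · obtain rfl : p = q + 2 + l.len := by omega
          rw [c3]
          omega

/-- A position that is not inside a subtree of the same class. -/
def IsTop (m : ℕ) (Y : ℕ → BinTree α) (p : ℕ) : Prop :=
  ∀ q < p, Y q ≠ nil → Nat.log m (Y q).len = Nat.log m (Y p).len → q + (Y q).len ≤ p

lemma isTop_left {Y : ℕ → BinTree α} (hY : IsTourArray Y) {p : ℕ} {a : α} {l r : BinTree α}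
    (hp : Y p = node a l r) (hc : Nat.log m l.len < Nat.log m (node a l r).len) :
    IsTop m Y (p + 1) := by
  intro q h1 h2 h3
  rw [(hY p a l r hp).1] at h3
  by_contra h4
  rcases Nat.lt_or_ge q p with h5 | h5
  · have := nested hY rfl h5 (by omega) (by rw [hp]; simp)
    rw [hp] at this
    have := Nat.log_mono_right (b := m) this.1.le
    omega
  · obtain rfl : q = p := by omega
    rw [hp] at h3
    omega

lemma isTop_right {Y : ℕ → BinTree α} (hY : IsTourArray Y) {p : ℕ} {a : α} {l r : BinTree α}
    (hp : Y p = node a l r) (hc : Nat.log m r.len < Nat.log m (node a l r).len) :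
    IsTop m Y (p + 2 + l.len) := by
  obtain ⟨c1, c2, c3⟩ := hY p a l r hp
  intro q h1 h2 h3
  rw [c3] at h3
  by_contra h4
  rcases Nat.lt_or_ge q p with h5 | h5
  · have := nested hY rfl h5 (by omega) (by rw [hp]; simp)
    rw [hp] at this
    have := Nat.log_mono_right (b := m) this.1.le
    omega
  · rcases Nat.lt_or_ge p q with h6 | h6
    · rcases Nat.lt_or_ge (p + 1) q with h7 | h7
      · rcases Nat.lt_or_ge q (p + 1 + l.len) with h8 | h8
        · have := nested hY c1 h7 h8 h2
          omega
        · rw [show q = p + 1 + l.len by omega, c2] at h2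
          exact h2 rfl
      · rw [show q = p + 1 by omega, c1] at h4
        omega
    · obtain rfl : q = p := by omega
      rw [hp] at h3
      omega

end BinTree

namespace TreePair

open BinTree

variable {n : ℕ} (F : Bool → LabeledRootedTree n)

lemma add_len_sub_le {p : ℕ} (h : sub F p ≠ .nil) {b : Bool} (h1 : rootPos n b ≤ p)
    (h2 : p < rootPos n b + 2 * n) : p + (sub F p).len ≤ rootPos n b + 2 * n := by
  rw [← sub_rootPos_len F b] at h2 ⊢
  rcases Nat.lt_or_ge (rootPos n b) p with h3 | h3
  · exact (nested (isTourArray_sub F) rfl h3 h2 h).2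
  · obtain rfl : p = rootPos n b := by omega
    rfl

lemma add_len_sub_lt {N p : ℕ} (hN : 4 * n + 3 ≤ N) (h : sub F p ≠ .nil) :
    p + (sub F p).len < N := by
  obtain ⟨b, h1, h2⟩ := exists_of_sub_ne_nil F h
  have := add_len_sub_le F h h1 h2
  cases b <;> simp [rootPos] at this <;> omega

lemma isTop_rootPos (m : ℕ) (b : Bool) : IsTop m (sub F) (rootPos n b) := by
  intro q h1 h2 _
  obtain ⟨b', h3, h4⟩ := exists_of_sub_ne_nil F h2
  have := add_len_sub_le F h2 h3 h4
  cases b <;> cases b' <;> simp [rootPos] at h1 h3 h4 this ⊢ <;> omega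

end TreePair

/-! ### Contraction of a cycle to sampled points -/

namespace CycleContraction

/-- `f` permutes the numbers below `n` in one cycle. -/
def Transitive (f : ℕ → ℕ) (n : ℕ) : Prop :=
  (∀ i < n, f i < n) ∧ ∀ i < n, ∀ j < n, ∃ k, f^[k] i = j

/-- In each group of `m` consecutive numbers one is sampled. -/
def Sampled (m : ℕ) (r : ℕ → ℕ) (i : ℕ) : Prop := i % m = r (i / m)

/-- The sampled number of a group. -/
def rep (m : ℕ) (r : ℕ → ℕ) (e : ℕ) : ℕ := e * m + r e

/-- The number of steps to the next sampled number. -/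
noncomputable def hitTime (m : ℕ) (f r : ℕ → ℕ) (x : ℕ) : ℕ :=
  sInf {k | 1 ≤ k ∧ Sampled m r (f^[k] x)}

/-- The map that `f` induces on the groups. -/
noncomputable def contract (m : ℕ) (f r : ℕ → ℕ) (e : ℕ) : ℕ :=
  f^[hitTime m f r (rep m r e)] (rep m r e) / m

/-- Every number reaches a sampled one in at most `L` steps. -/
def Good (m L n : ℕ) (f r : ℕ → ℕ) : Prop :=
  ∀ i < n, ∃ k, 1 ≤ k ∧ k ≤ L ∧ Sampled m r (f^[k] i)

variable {m L G : ℕ} {f r : ℕ → ℕ}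

lemma rep_lt (hr : ∀ e, r e < m) {e : ℕ} (he : e < G) : rep m r e < m * G := by
  have := hr e
  calc rep m r e < e * m + m := by rw [rep]; omega
    _ = (e + 1) * m := by ring
    _ ≤ G * m := Nat.mul_le_mul_right _ he
    _ = m * G := by ring

lemma rep_div (hr : ∀ e, r e < m) (e : ℕ) : rep m r e / m = e := by
  have := hr e
  rw [rep, Nat.div_eq_of_lt_le] <;> nlinarith

lemma sampled_rep (hr : ∀ e, r e < m) (e : ℕ) : Sampled m r (rep m r e) := by
  rw [Sampled, rep_div hr]
  rw [rep, Nat.mul_comm, Nat.mul_add_mod, Nat.mod_eq_of_lt (hr e)]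

lemma rep_div_of_sampled {i : ℕ} (h : Sampled m r i) : rep m r (i / m) = i := by
  rw [rep, ← h, Nat.mul_comm]
  exact Nat.div_add_mod i m

lemma hitTime_spec {n x : ℕ} (hg : Good m L n f r) (hx : x < n) :
    1 ≤ hitTime m f r x ∧ hitTime m f r x ≤ L ∧ Sampled m r (f^[hitTime m f r x] x) ∧
      ∀ k, 1 ≤ k → k < hitTime m f r x → ¬ Sampled m r (f^[k] x) := by
  obtain ⟨k, h1, h2, h3⟩ := hg x hx
  have hne : {k | 1 ≤ k ∧ Sampled m r (f^[k] x)}.Nonempty := ⟨k, h1, h3⟩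
  have h4 := Nat.sInf_mem hne
  refine ⟨h4.1, (Nat.sInf_le (s := {k | 1 ≤ k ∧ Sampled m r (f^[k] x)}) ⟨h1, h3⟩).trans h2, h4.2,
    fun j hj1 hj2 hj3 => ?_⟩
  exact absurd (Nat.sInf_le (s := {k | 1 ≤ k ∧ Sampled m r (f^[k] x)}) ⟨hj1, hj3⟩) (by
    rw [hitTime] at hj2; omega)

lemma hitTime_le {x k : ℕ} (h1 : 1 ≤ k) (h2 : Sampled m r (f^[k] x)) : hitTime m f r x ≤ k :=
  Nat.sInf_le (s := {k | 1 ≤ k ∧ Sampled m r (f^[k] x)}) ⟨h1, h2⟩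

lemma iterate_lt {n : ℕ} (hf : ∀ i < n, f i < n) {i : ℕ} (hi : i < n) (k : ℕ) : f^[k] i < n := by
  induction k with
  | zero => exact hi
  | succ k ih => rw [Function.iterate_succ_apply']; exact hf _ ih

lemma rep_contract (hr : ∀ e, r e < m) (hg : Good m L (m * G) f r) {e : ℕ} (he : e < G) :
    rep m r (contract m f r e) = f^[hitTime m f r (rep m r e)] (rep m r e) :=
  rep_div_of_sampled (hitTime_spec hg (rep_lt hr he)).2.2.1

lemma contract_lt (hf : ∀ i < m * G, f i < m * G) (hr : ∀ e, r e < m) {e : ℕ} (he : e < G) :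
    contract m f r e < G :=
  Nat.div_lt_of_lt_mul (iterate_lt hf (rep_lt hr he) _)

/-- Following `f` from a sampled number amounts to following the contraction first and then `f`
for less than one of its steps. -/
lemma exists_contract_iterate (hr : ∀ e, r e < m) (hf : ∀ i < m * G, f i < m * G)
    (hg : Good m L (m * G) f r) (k : ℕ) :
    ∀ e < G, ∃ e' < G, ∃ j k', (contract m f r)^[j] e = e' ∧
      k' < hitTime m f r (rep m r e') ∧ f^[k'] (rep m r e') = f^[k] (rep m r e) := by
  induction k using Nat.strong_induction_on with
  | _ k ih =>
    intro e he
    obtain ⟨h1, -, -, -⟩ := hitTime_spec hg (rep_lt hr he)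
    rcases Nat.lt_or_ge k (hitTime m f r (rep m r e)) with h | h
    · exact ⟨e, he, 0, k, rfl, h, rfl⟩
    · obtain ⟨e', he', j, k', h2, h3, h4⟩ :=
        ih (k - hitTime m f r (rep m r e)) (by omega) _ (contract_lt hf hr he)
      refine ⟨e', he', j + 1, k', h2, h3, ?_⟩
      rw [h4, rep_contract hr hg he, ← Function.iterate_add_apply, Nat.sub_add_cancel h]

lemma transitive_contract (hr : ∀ e, r e < m) (hf : Transitive f (m * G))
    (hg : Good m L (m * G) f r) : Transitive (contract m f r) G := by
  refine ⟨fun e he => contract_lt hf.1 hr he, fun e he e₁ he₁ => ?_⟩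
  obtain ⟨k, hk⟩ := hf.2 _ (rep_lt hr he) _ (rep_lt hr he₁)
  obtain ⟨e', he', j, k', h2, h3, h4⟩ := exists_contract_iterate hr hf.1 hg k e he
  rw [hk] at h4
  refine ⟨j, ?_⟩
  rw [h2]
  rcases Nat.eq_zero_or_pos k' with rfl | hk'
  · have := congrArg (· / m) h4
    simpa [rep_div hr] using this
  · refine absurd ?_ ((hitTime_spec hg (rep_lt hr he')).2.2.2 k' hk' h3)
    rw [h4]
    exact sampled_rep hr _

/-- Every number is reached from a sampled one before the next sampled one. -/
lemma exists_rep_iterate (hr : ∀ e, r e < m) (hf : Transitive f (m * G))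
    (hg : Good m L (m * G) f r) {i : ℕ} (hi : i < m * G) :
    ∃ e < G, ∃ k < hitTime m f r (rep m r e), f^[k] (rep m r e) = i := by
  have hG : 0 < G := Nat.pos_of_ne_zero fun h => by simp [h] at hi
  obtain ⟨k, hk⟩ := hf.2 _ (rep_lt hr hG) _ hi
  obtain ⟨e', he', j, k', h2, h3, h4⟩ := exists_contract_iterate hr hf.1 hg k 0 hG
  exact ⟨e', he', k', h3, h4.trans hk⟩

/-- The successive contractions. -/
noncomputable def level (m : ℕ) (f : ℕ → ℕ) (r : ℕ → ℕ → ℕ) : ℕ → ℕ → ℕ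
  | 0 => f
  | j + 1 => contract m (level m f r j) (r j)

/-- The original number that stands for a group. -/
def origin (m : ℕ) (r : ℕ → ℕ → ℕ) : ℕ → ℕ → ℕ
  | 0, e => e
  | j + 1, e => origin m r j (rep m (r j) e)

lemma level_congr {m : ℕ} {f : ℕ → ℕ} {r r' : ℕ → ℕ → ℕ} {j : ℕ} (h : ∀ j' < j, r j' = r' j') :
    level m f r j = level m f r' j := by
  induction j with
  | zero => rfl
  | succ j ih =>
    rw [level, level, ih fun j' hj' => h j' (by omega), h j (by omega)]

lemma transitive_level {f : ℕ → ℕ} {r : ℕ → ℕ → ℕ} {J : ℕ} (hr : ∀ j e, r j e < m)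
    (hf : Transitive f (m ^ J)) {j : ℕ} (hj : j ≤ J)
    (hg : ∀ j' < j, Good m L (m ^ (J - j')) (level m f r j') (r j')) :
    Transitive (level m f r j) (m ^ (J - j)) := by
  induction j with
  | zero => simpa [level] using hf
  | succ j ih =>
    have h1 := ih (by omega) fun j' hj' => hg j' (by omega)
    have h2 := hg j (by omega)
    have h3 : m ^ (J - j) = m * m ^ (J - (j + 1)) := by
      rw [← pow_succ']; congr 1; omega
    rw [h3] at h1 h2
    exact transitive_contract (hr j) h1 h2

/-! ### The probability that the samples are good -/

open Classical in
lemma card_avoid_le {M : ℕ} (hm : 0 < m) (X : Finset ℕ) (hX : ∀ x ∈ X, x < m * M) :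
    ((Finset.univ.filter fun η : Fin M → Fin m =>
      ∀ (e : Fin M) (d : Fin m), ((e : ℕ) * m + d) ∈ X → η e ≠ d).card : ℝ) ≤
      Real.exp (-(X.card / m)) * Fintype.card (Fin M → Fin m) := by
  set P : Fin M → Finset (Fin m) := fun e => Finset.univ.filter fun d => ((e : ℕ) * m + d) ∈ X
  have hset : (Finset.univ.filter fun η : Fin M → Fin m =>
      ∀ (e : Fin M) (d : Fin m), ((e : ℕ) * m + d) ∈ X → η e ≠ d) = Fintype.piFinset fun e => (P e)ᶜ := by
    ext η
    simp only [Finset.mem_filter, Finset.mem_univ, true_and, Fintype.mem_piFinset,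
      Finset.mem_compl, P]
    constructor
    · intro h e he
      exact h e _ he rfl
    · rintro h e d hd rfl
      exact h e hd
  have hsum : X.card = ∑ e, (P e).card := by
    rw [← Finset.card_sigma]
    refine (Finset.card_bij (fun z _ => (z.1 : ℕ) * m + z.2) ?_ ?_ ?_).symm
    · rintro ⟨e, d⟩ h
      simpa [P] using h
    · rintro ⟨e, d⟩ - ⟨e', d'⟩ - h
      simp only at h
      have h1 : (e : ℕ) = e' := by
        have := congrArg (· / m) h
        simpa [Nat.add_div_of_dvd_right, Nat.div_eq_of_lt d.2, Nat.div_eq_of_lt d'.2, hm.ne',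
          Nat.mul_div_cancel _ hm, Nat.add_div_of_dvd_right (Dvd.intro_left _ rfl)] using this
      have h2 : (d : ℕ) = d' := by rw [h1] at h; omega
      obtain rfl : e = e' := Fin.ext h1
      obtain rfl : d = d' := Fin.ext h2
      rfl
    · intro x hx
      refine ⟨⟨⟨x / m, Nat.div_lt_of_lt_mul (hX x hx)⟩, ⟨x % m, Nat.mod_lt _ hm⟩⟩, ?_, ?_⟩
      · simpa [P, Nat.div_add_mod'] using hx
      · exact Nat.div_add_mod' x m
  rw [hset, Fintype.card_piFinset, Fintype.card_fun, Fintype.card_fin, Fintype.card_fin, hsum]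
  push_cast
  have hm' : (0 : ℝ) < m := by exact_mod_cast hm
  calc ∏ e, (((P e)ᶜ.card : ℕ) : ℝ) ≤ ∏ e, (Real.exp (-((P e).card / m)) * m) := by
        refine Finset.prod_le_prod (fun _ _ => by positivity) fun e _ => ?_
        have h1 : (P e).card ≤ m := by simpa using Finset.card_le_univ (P e)
        rw [Finset.card_compl, Fintype.card_fin, Nat.cast_sub h1]
        have h2 := Real.one_sub_le_exp_neg (((P e).card : ℝ) / m)
        calc (m : ℝ) - (P e).card = (1 - (P e).card / m) * m := by field_simp
          _ ≤ _ := by gcongr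
    _ = _ := by
        rw [Finset.prod_mul_distrib, ← Real.exp_sum, Finset.prod_const, Finset.card_univ,
          Fintype.card_fin, Finset.sum_neg_distrib, Finset.sum_div]

/-- The samples given by the choices of the machines. -/
def ofChoices {M : ℕ} (hm : 0 < m) (η : Fin M → Fin m) (e : ℕ) : ℕ :=
  if h : e < M then η ⟨e, h⟩ else (⟨0, hm⟩ : Fin m)

lemma ofChoices_lt {M : ℕ} (hm : 0 < m) (η : Fin M → Fin m) (e : ℕ) : ofChoices hm η e < m := by
  unfold ofChoices
  split_ifs <;> exact Fin.is_lt _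

open Classical in
lemma card_not_hit_le {M : ℕ} (hm : 0 < m) (hf : Transitive f (m * G)) (hGM : G ≤ M) {i : ℕ}
    (hi : i < m * G) (L : ℕ) :
    ((Finset.univ.filter fun η : Fin M → Fin m =>
      ∀ k, 1 ≤ k → k ≤ L → ¬ Sampled m (ofChoices hm η) (f^[k] i)).card : ℝ) ≤
      Real.exp (-((L : ℝ) / m)) * Fintype.card (Fin M → Fin m) := by
  have hlt : ∀ k, f^[k] i < m * G := fun k => iterate_lt hf.1 hi k
  by_cases hinj : Set.InjOn (fun k => f^[k] i) (Finset.Icc 1 L : Set ℕ)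
  · set X := (Finset.Icc 1 L).image fun k => f^[k] i with hX
    have hcard : X.card = L := by
      rw [hX, Finset.card_image_of_injOn hinj, Nat.card_Icc]; omega
    have h1 := card_avoid_le (M := M) hm X (fun x hx => by
      obtain ⟨k, -, rfl⟩ := Finset.mem_image.mp hx
      exact (hlt k).trans_le (Nat.mul_le_mul_left _ hGM))
    rw [hcard] at h1
    refine le_trans ?_ h1
    norm_cast
    refine Finset.card_le_card fun η hη => ?_
    simp only [Finset.mem_filter, Finset.mem_univ, true_and] at hη ⊢
    rintro e d hed rfl
    obtain ⟨k, hk, hk'⟩ := Finset.mem_image.mp hed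
    rw [Finset.mem_Icc] at hk
    apply hη k hk.1 hk.2
    rw [hk']
    have := sampled_rep (ofChoices_lt hm η) e
    rw [rep, ofChoices, dif_pos e.2] at this
    exact this
  · suffices h : ∀ η : Fin M → Fin m,
        ¬ ∀ k, 1 ≤ k → k ≤ L → ¬ Sampled m (ofChoices hm η) (f^[k] i) by
      refine le_trans (le_of_eq (b := (0 : ℝ)) ?_) (by positivity)
      rw [Nat.cast_eq_zero, Finset.card_eq_zero, Finset.eq_empty_iff_forall_notMem]
      intro η hη
      simp only [Finset.mem_filter, Finset.mem_univ, true_and] at hη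
      exact h η hη
    · intro η hη
      have hG : 0 < G := Nat.pos_of_ne_zero fun h => by simp [h] at hi
      simp only [Set.InjOn, Finset.coe_Icc, Set.mem_Icc] at hinj
      push Not at hinj
      obtain ⟨a, ha, b, hb, hab, hne⟩ := hinj
      wlog hlt' : a < b generalizing a b
      · exact this b hb a ha hab.symm hne.symm (by omega)
      have hper : ∀ t, a ≤ t → ∃ k, 1 ≤ k ∧ k ≤ L ∧ f^[k] i = f^[t] i := by
        intro t
        induction t using Nat.strong_induction_on with
        | _ t ih =>
          intro hat
          rcases Nat.lt_or_ge L t with h | h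
          · obtain ⟨k, h1, h2, h3⟩ := ih (t - (b - a)) (by omega) (by omega)
            refine ⟨k, h1, h2, h3.trans ?_⟩
            rw [show t - (b - a) = (t - b) + a by omega, Function.iterate_add_apply, hab,
              ← Function.iterate_add_apply, Nat.sub_add_cancel (by omega)]
          · exact ⟨t, by omega, h, rfl⟩
      obtain ⟨s, hs⟩ := hf.2 _ (hlt a) _ (rep_lt (ofChoices_lt hm η) hG)
      rw [← Function.iterate_add_apply] at hs
      obtain ⟨k, h1, h2, h3⟩ := hper (s + a) (by omega)
      apply hη k h1 h2
      rw [h3, hs]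
      exact sampled_rep (ofChoices_lt hm η) 0

end CycleContraction

/-! ### Counting in products of finite sets -/

open Classical in
/-- A set that is small on all fibres is small. -/
lemma card_filter_le_of_fibers {ι κ : Type} {β : ι → Type} [Fintype ι] [Fintype κ]
    [∀ i, Fintype (β i)] (g : κ → ι) (hg : Function.Injective g) (E : (∀ i, β i) → Prop) (c : ℝ)
    (h : ∀ ω : ∀ i, β i, ((Finset.univ.filter fun η : ∀ k, β (g k) =>
      ∃ ω' : ∀ i, β i, E ω' ∧ (∀ k, ω' (g k) = η k) ∧ ∀ i, (∀ k, g k ≠ i) → ω' i = ω i).card : ℝ) ≤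
        c * Fintype.card (∀ k, β (g k))) :
    ((Finset.univ.filter E).card : ℝ) ≤ c * Fintype.card (∀ i, β i) := by
  rcases isEmpty_or_nonempty (∀ i, β i) with hemp | ⟨⟨ω₀⟩⟩
  · simp
  set e : (∀ i, β i) ≃ (∀ k, β (g k)) × (∀ i : {i // i ∉ Set.range g}, β i) :=
    (Equiv.piEquivPiSubtypeProd (fun i => i ∈ Set.range g) β).trans
      (Equiv.prodCongr (Equiv.piCongrLeft (fun i : Set.range g => β i)
        (Equiv.ofInjective g hg)).symm (Equiv.refl _)) with he
  have he1 : ∀ ω k, (e ω).1 k = ω (g k) := fun ω k => rfl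
  have he2 : ∀ ω i, (e ω).2 i = ω i := fun ω i => rfl
  have hE : (Finset.univ.filter E).card =
      ∑ ρ : ∀ i : {i // i ∉ Set.range g}, β i,
        (Finset.univ.filter fun η : ∀ k, β (g k) => E (e.symm (η, ρ))).card := by
    rw [← Finset.card_sigma]
    refine Finset.card_bij (fun ω _ => ⟨(e ω).2, (e ω).1⟩) ?_ ?_ ?_
    · intro ω hω
      simpa using hω
    · intro ω _ ω' _ hh
      apply e.injective
      simp only [Sigma.mk.injEq, heq_eq_eq] at hh
      exact Prod.ext hh.2 hh.1
    · rintro ⟨ρ, η⟩ hh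
      exact ⟨e.symm (η, ρ), by simpa using hh, by simp⟩
  have hcard : (Fintype.card (∀ i, β i) : ℝ) = Fintype.card (∀ k, β (g k)) *
      Fintype.card (∀ i : {i // i ∉ Set.range g}, β i) := by
    rw [Fintype.card_congr e, Fintype.card_prod]
    push_cast
    rfl
  rw [hE, hcard]
  push_cast
  calc (∑ ρ : ∀ i : {i // i ∉ Set.range g}, β i,
        ((Finset.univ.filter fun η : ∀ k, β (g k) => E (e.symm (η, ρ))).card : ℝ))
      ≤ ∑ ρ : ∀ i : {i // i ∉ Set.range g}, β i, c * Fintype.card (∀ k, β (g k)) := by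
        refine Finset.sum_le_sum fun ρ _ => ?_
        set ω := e.symm ((e ω₀).1, ρ) with hω
        refine le_trans ?_ (h ω)
        norm_cast
        refine Finset.card_le_card fun η hη => ?_
        simp only [Finset.mem_filter, Finset.mem_univ, true_and] at hη ⊢
        refine ⟨_, hη, fun k => ?_, fun i hi => ?_⟩
        · have h1 := he1 (e.symm (η, ρ)) k
          rw [Equiv.apply_symm_apply] at h1
          exact h1.symm
        · have hi' : i ∉ Set.range g := by rintro ⟨k, hk⟩; exact hi k hk
          have h1 := he2 (e.symm (η, ρ)) ⟨i, hi'⟩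
          have h2 := he2 ω ⟨i, hi'⟩
          rw [Equiv.apply_symm_apply] at h1
          rw [hω, Equiv.apply_symm_apply] at h2
          exact h1.symm.trans h2
    _ = _ := by
        rw [Finset.sum_const, nsmul_eq_mul, Finset.card_univ]
        ring

lemma List.foldl_finRange_induction {β : Type*} {S : ℕ} (f : β → Fin S → β) (P : ℕ → β → Prop)
    (b : β) (h0 : P 0 b) (hs : ∀ (s : Fin S) (b : β), P s b → P (s + 1) (f b s)) :
    P S ((List.finRange S).foldl f b) := by
  induction S generalizing P b with
  | zero => simpa using h0
  | succ S ih =>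
    rw [List.finRange_succ, List.foldl_cons, List.foldl_map]
    exact ih (fun b s => f b s.succ) (fun k => P (k + 1)) _ (hs 0 b h0) fun s b h => hs s.succ b h

namespace AMPC

/-- A procedure that a machine follows in a round, as a tree of instructions. Draws are from
`{0, …, b}` with `b < D`. -/
inductive Proc (Q A K V : Type) (D : ℕ) (α : Type) : Type
  | ret (a : α)
  | input (q : Q) (f : Option A → Proc Q A K V D α)
  | read (k : K) (f : Option V → Proc Q A K V D α)
  | write (k : K) (v : V) (p : Proc Q A K V D α)
  | draw (b : Fin D) (f : Fin D → Proc Q A K V D α)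

namespace Proc

variable {Q A K V : Type} {D : ℕ} {α β : Type}

/-- What a machine learns from an instruction. -/
abbrev Answer (A V : Type) (D : ℕ) : Type := Option A ⊕ Option V ⊕ Fin D

/-- What the answers depend on. -/
structure Env (Q A K V : Type) (D : ℕ) where
  inp : Q → Option A
  view : K → Option V
  coin : ℕ → Fin D → Fin D

/-- The answer to the first instruction, executed as step `s`. -/
def answer (e : Env Q A K V D) (s : ℕ) : Proc Q A K V D α → Answer A V D
  | ret _ => .inl none
  | input q _ => .inl (e.inp q)
  | read k _ => .inr (.inl (e.view k))
  | write _ _ _ => .inl none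
  | draw b _ => .inr (.inr (e.coin s b))

/-- The rest of the procedure after an answer to its first instruction. -/
def follow (a : Answer A V D) : Proc Q A K V D α → Proc Q A K V D α
  | ret x => ret x
  | input _ f => f (match a with | .inl o => o | _ => none)
  | read _ f => f (match a with | .inr (.inl o) => o | _ => none)
  | write _ _ p => p
  | draw b f => f (match a with | .inr (.inr c) => c | _ => b)

/-- What the first instruction writes. -/
def written : Proc Q A K V D α → List (K × V)
  | write k v _ => [(k, v)]
  | _ => []

/-- The rest of the procedure after some answers. -/
def advance (h : ℕ → Answer A V D) : ℕ → Proc Q A K V D α → Proc Q A K V D α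
  | 0, p => p
  | k + 1, p => follow (h k) (advance h k p)

/-- The rest of the procedure and what has been written after some steps. -/
def trace (e : Env Q A K V D) (p : Proc Q A K V D α) : ℕ → Proc Q A K V D α × List (K × V)
  | 0 => (p, [])
  | s + 1 => (follow (answer e s (trace e p s).1) (trace e p s).1,
      (trace e p s).2 ++ written (trace e p s).1)

/-- Result, written pairs and number of the final step of a procedure that begins with step `s`. -/
def exec (e : Env Q A K V D) : ℕ → Proc Q A K V D α → α × List (K × V) × ℕ
  | s, ret a => (a, [], s)
  | s, input q f => exec e (s + 1) (f (e.inp q))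
  | s, read k f => exec e (s + 1) (f (e.view k))
  | s, write k v p => ((exec e (s + 1) p).1, (k, v) :: (exec e (s + 1) p).2.1,
      (exec e (s + 1) p).2.2)
  | s, draw b f => exec e (s + 1) (f (e.coin s b))

lemma trace_eq_exec (e : Env Q A K V D) (p : Proc Q A K V D α) (q : Proc Q A K V D α) (s : ℕ)
    (hq : (trace e p s).1 = q) (t : ℕ) (ht : (exec e s q).2.2 ≤ t) :
    trace e p t = (ret (exec e s q).1, (trace e p s).2 ++ (exec e s q).2.1) := by
  induction q generalizing s with
  | ret a =>
    simp only [exec] at ht ⊢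
    induction t, ht using Nat.le_induction with
    | base => rw [← hq, List.append_nil]
    | succ t _ ih =>
      rw [trace, ih]
      simp [follow, written]
  | input q f ih =>
    rw [exec] at ht ⊢
    rw [ih _ (s + 1) (by rw [trace, hq]; rfl) ht, trace, hq]
    simp [written]
  | read k f ih =>
    rw [exec] at ht ⊢
    rw [ih _ (s + 1) (by rw [trace, hq]; rfl) ht, trace, hq]
    simp [written]
  | write k v q ih =>
    rw [exec] at ht ⊢
    rw [ih (s + 1) (by rw [trace, hq]; rfl) ht, trace, hq]
    simp [written]
  | draw b f ih =>
    rw [exec] at ht ⊢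
    rw [ih _ (s + 1) (by rw [trace, hq]; rfl) ht, trace, hq]
    simp [written]

lemma advance_congr {h h' : ℕ → Answer A V D} {s : ℕ} (hh : ∀ k < s, h k = h' k)
    (p : Proc Q A K V D α) : advance h s p = advance h' s p := by
  induction s with
  | zero => rfl
  | succ s ih => rw [advance, advance, ih fun k hk => hh k (by omega), hh s (by omega)]

/-- Sequential composition. -/
def bind : Proc Q A K V D α → (α → Proc Q A K V D β) → Proc Q A K V D β
  | ret a, g => g a
  | input q f, g => input q fun o => bind (f o) g
  | read k f, g => read k fun o => bind (f o) g
  | write k v p, g => write k v (bind p g)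
  | draw b f, g => draw b fun c => bind (f c) g

instance : Monad (Proc Q A K V D) where
  pure := ret
  bind := bind

lemma exec_bind (e : Env Q A K V D) (p : Proc Q A K V D α) (g : α → Proc Q A K V D β) (s : ℕ) :
    exec e s (p >>= g) =
      ((exec e (exec e s p).2.2 (g (exec e s p).1)).1,
        (exec e s p).2.1 ++ (exec e (exec e s p).2.2 (g (exec e s p).1)).2.1,
        (exec e (exec e s p).2.2 (g (exec e s p).1)).2.2) := by
  change exec e s (bind p g) = _
  induction p generalizing s with
  | ret a => rfl
  | input q f ih => exact ih _ _
  | read k f ih => exact ih _ _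
  | write k v p ih => simp only [bind, exec, ih, List.cons_append]
  | draw b f ih => exact ih _ _

/-- The procedure takes at most `c` steps, and its result and the pairs that it writes have the
property `post`. -/
def Ensures (e : Env Q A K V D) (p : Proc Q A K V D α) (c : ℕ)
    (post : α → List (K × V) → Prop) : Prop :=
  ∀ s, (exec e s p).2.2 ≤ s + c ∧ post (exec e s p).1 (exec e s p).2.1

variable {e : Env Q A K V D} {c c' : ℕ} {post : α → List (K × V) → Prop}

lemma Ensures.mono {p : Proc Q A K V D α} {post' : α → List (K × V) → Prop}
    (h : Ensures e p c post) (hc : c ≤ c') (hp : ∀ a w, post a w → post' a w) :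
    Ensures e p c' post' :=
  fun s => ⟨(h s).1.trans (by omega), hp _ _ (h s).2⟩

lemma ensures_pure {a : α} (h : post a []) : Ensures e (pure a) c post :=
  fun s => ⟨by simp [pure, exec], h⟩

lemma Ensures.bind {p : Proc Q A K V D α} {g : α → Proc Q A K V D β}
    {post' : β → List (K × V) → Prop} (h : Ensures e p c post)
    (hg : ∀ a w, post a w → Ensures e (g a) c' fun b w' => post' b (w ++ w')) :
    Ensures e (p >>= g) (c + c') post' := by
  intro s
  have h1 := h s
  have h2 := hg _ _ h1.2 (exec e s p).2.2
  rw [exec_bind]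
  exact ⟨by simp only; omega, h2.2⟩

/-- Read a value. -/
def get (k : K) : Proc Q A K V D (Option V) := read k ret

/-- Write a value. -/
def put (k : K) (v : V) : Proc Q A K V D Unit := write k v (ret ())

/-- Read a value of the input. -/
def ask (q : Q) : Proc Q A K V D (Option A) := input q ret

lemma ensures_get_bind {k : K} {g : Option V → Proc Q A K V D α}
    (h : Ensures e (g (e.view k)) c post) : Ensures e (get k >>= g) (c + 1) post := fun s => by
  have := h (s + 1)
  exact ⟨this.1.trans (by omega), this.2⟩

lemma ensures_ask_bind {q : Q} {g : Option A → Proc Q A K V D α}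
    (h : Ensures e (g (e.inp q)) c post) : Ensures e (ask q >>= g) (c + 1) post := fun s => by
  have := h (s + 1)
  exact ⟨this.1.trans (by omega), this.2⟩

lemma ensures_put {k : K} {v : V} {post : Unit → List (K × V) → Prop} (h : post () [(k, v)]) :
    Ensures e (put k v) (c + 1) post := fun s => ⟨by simp [put, exec], h⟩

lemma ensures_put_bind {k : K} {v : V} {g : Unit → Proc Q A K V D α}
    (h : Ensures e (g ()) c fun a w => post a ((k, v) :: w)) :
    Ensures e (put k v >>= g) (c + 1) post := fun s => by
  have := h (s + 1)
  exact ⟨this.1.trans (by omega), this.2⟩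

/-- A loop over a list. -/
def forEach {ι : Type} (l : List ι) (f : ι → Proc Q A K V D Unit) : Proc Q A K V D Unit :=
  match l with
  | [] => pure ()
  | i :: l => f i >>= fun _ => forEach l f

/-- The values under a list of keys. -/
def getAll (l : List K) : Proc Q A K V D (List (Option V)) :=
  match l with
  | [] => pure []
  | k :: l => get k >>= fun a => getAll l >>= fun as => pure (a :: as)

lemma ensures_getAll (l : List K) :
    Ensures e (getAll l) l.length fun a w => a = l.map e.view ∧ w = [] := by
  induction l with
  | nil => exact ensures_pure ⟨rfl, rfl⟩
  | cons k l ih =>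
    refine ensures_get_bind ((ih.bind (c' := 0) fun a w h => ensures_pure ?_))
    simp [h.1, h.2]

/-- The pairs agree with `G`, and those with keys in `O` are complete. -/
def Writes (G : K → Option V) (O : Set K) (w : List (K × V)) : Prop :=
  (∀ kv ∈ w, G kv.1 = some kv.2) ∧ ∀ k ∈ O, ∀ v, G k = some v → (k, v) ∈ w

variable {G : K → Option V} {O O' : Set K} {w w' : List (K × V)}

lemma writes_nil : Writes G ∅ [] := ⟨by simp, by simp⟩

lemma Writes.append (h : Writes G O w) (h' : Writes G O' w') : Writes G (O ∪ O') (w ++ w') := by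
  refine ⟨fun kv hkv => ?_, ?_⟩
  · rcases List.mem_append.mp hkv with h1 | h1
    · exact h.1 kv h1
    · exact h'.1 kv h1
  · rintro k (hk | hk) v hv
    · exact List.mem_append_left _ (h.2 k hk v hv)
    · exact List.mem_append_right _ (h'.2 k hk v hv)

lemma Writes.mono (h : Writes G O w) (hO : O' ⊆ O) : Writes G O' w :=
  ⟨h.1, fun k hk => h.2 k (hO hk)⟩

lemma writes_singleton {k : K} {v : V} (h : G k = some v) : Writes G {k} [(k, v)] := by
  refine ⟨by simpa using h, ?_⟩
  rintro _ rfl v' hv'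
  rw [h] at hv'
  cases hv'
  simp

lemma writes_cons {k : K} {v : V} (h : G k = some v) (hw : Writes G O w) :
    Writes G (insert k O) ((k, v) :: w) :=
  (writes_singleton h).append hw

lemma ensures_forEach {ι : Type} (l : List ι) (f : ι → Proc Q A K V D Unit) (O : ι → Set K)
    (h : ∀ i ∈ l, Ensures e (f i) c fun _ w => Writes G (O i) w) :
    Ensures e (forEach l f) (l.length * c) fun _ w => Writes G (⋃ i ∈ l, O i) w := by
  induction l with
  | nil => exact ensures_pure (by simpa using writes_nil)
  | cons i l ih =>
    have h1 := (h i List.mem_cons_self).bind (g := fun _ => forEach l f)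
      (c' := l.length * c) (post' := fun _ w => Writes G (⋃ j ∈ i :: l, O j) w)
      fun _ w hw => (ih fun j hj => h j (List.mem_cons_of_mem _ hj)).mono le_rfl
        fun _ w' hw' => (hw.append hw').mono (by
          intro k hk
          simpa using hk)
    exact h1.mono (by rw [List.length_cons]; ring_nf; omega) fun _ _ h => h

/-- Keep a key for the next round. -/
def keep (k : K) : Proc Q A K V D Unit :=
  get k >>= fun o => o.elim (pure ()) (put k)

lemma ensures_keep {C : Set K} (h1 : ∀ k v, e.view k = some v → G k = some v)
    (h2 : ∀ k ∈ C, e.view k = G k) (k : K) :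
    Ensures e (keep k) 2 fun _ w => Writes G ({k} ∩ C) w := by
  refine ensures_get_bind ?_
  rcases h : e.view k with _ | v
  · refine ensures_pure ⟨by simp, ?_⟩
    rintro _ ⟨rfl, hk⟩ v hv
    rw [h2 _ hk, hv] at h
    cases h
  · exact ensures_put ((writes_singleton (h1 k v h)).mono Set.inter_subset_left)

lemma ensures_forEach_keep {C : Set K} (h1 : ∀ k v, e.view k = some v → G k = some v)
    (h2 : ∀ k ∈ C, e.view k = G k) (l : List K) :
    Ensures e (forEach l keep) (l.length * 2) fun _ w => Writes G ({k | k ∈ l} ∩ C) w := by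
  refine (ensures_forEach l keep (fun k => {k} ∩ C) fun k _ => ensures_keep h1 h2 k).mono le_rfl
    fun _ w hw => hw.mono ?_
  rintro k ⟨hk, hC⟩
  simp only [Set.mem_iUnion]
  exact ⟨k, hk, rfl, hC⟩

end Proc

open Proc

/-- The data of a program in which every machine follows a procedure in every round. -/
structure ProcProgram (Q A K V : Type) where
  rounds : ℕ
  machines : ℕ
  memory : ℕ
  wordSize : ℕ
  drawSize : ℕ
  machines_pos : 0 < machines
  finite_input : Finite A
  finite_key : Finite K
  finite_val : Finite V
  card_answer : Nat.card (Answer A V drawSize) ≤ wordSize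
  card_key : Nat.card K ≤ wordSize
  card_val : Nat.card V ≤ wordSize
  proc : ℕ → Fin machines → Proc Q A K V drawSize Bool

namespace ProcProgram

variable {Q A K V : Type} (P : ProcProgram Q A K V)

/-- The answers in a round as a sequence. -/
def history (x : Fin P.memory → Answer A V P.drawSize) (k : ℕ) : Answer A V P.drawSize :=
  if h : k < P.memory then x ⟨k, h⟩ else .inl none

lemma drawSize_le : P.drawSize ≤ P.wordSize := by
  have := P.finite_input
  have := P.finite_val
  refine le_trans ?_ P.card_answer
  have h : Function.Injective fun c : Fin P.drawSize => (.inr (.inr c) : Answer A V P.drawSize) :=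
    Sum.inr_injective.comp Sum.inr_injective
  simpa using Nat.card_le_card_of_injective _ h

/-- The instruction of a machine whose state is the sequence of the answers in the round. -/
def instr (p : Proc Q A K V P.drawSize Bool) (s : Fin P.memory)
    (x : Fin P.memory → Answer A V P.drawSize) :
    Instr Q A K V (Fin P.memory → Answer A V P.drawSize) P.wordSize :=
  match advance (P.history x) s p with
  | .ret _ => .compute x
  | .input q _ => .input q fun o => Function.update x s (.inl o)
  | .read k _ => .read k 0 fun o => Function.update x s (.inr (.inl o))
  | .write k v _ => .write k v x
  | .draw b _ => .draw (b.castLE P.drawSize_le) fun c =>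
      Function.update x s (.inr (.inr (c.castLE b.2)))

/-- The program. -/
abbrev toProgram : Program Q A where
  rounds := P.rounds
  machines := P.machines
  memory := P.memory
  wordSize := P.wordSize
  machines_pos := P.machines_pos
  State := Fin P.memory → Answer A V P.drawSize
  Key := K
  Val := V
  finite_state := by
    have := P.finite_input
    have := P.finite_val
    infer_instance
  finite_key := P.finite_key
  finite_val := P.finite_val
  card_state := by
    have := P.finite_input
    have := P.finite_val
    rw [Nat.card_fun, Nat.card_eq_fintype_card (α := Fin P.memory), Fintype.card_fin]
    exact Nat.pow_le_pow_left P.card_answer _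
  card_key := P.card_key
  card_val := P.card_val
  init := fun _ _ => .inl none
  code := fun t i s x => P.instr (P.proc t i) s x
  output := fun x =>
    match advance (P.history x) P.memory (P.proc (P.rounds - 1) ⟨0, P.machines_pos⟩) with
    | .ret a => a
    | _ => false

/-- The environment of machine `i` in round `t`. -/
def env (inp : Q → Option A) (ω : P.toProgram.Seed) (t : Fin P.rounds) (i : Fin P.machines)
    (view : K → Option V) : Env Q A K V P.drawSize where
  inp := if (t : ℕ) = 0 then inp else fun _ => none
  view := view
  coin := fun s b => if h : s < P.memory then
    ((ω t i ⟨s, h⟩ (b.castLE P.drawSize_le) : Fin (b + 1))).castLE b.2 else b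

variable {P}

lemma history_update {x : Fin P.memory → Answer A V P.drawSize} {s : Fin P.memory}
    {a : Answer A V P.drawSize} {k : ℕ} (hk : k < s) :
    P.history (Function.update x s a) k = P.history x k := by
  have h : k < P.memory := hk.trans s.2
  rw [history, history, dif_pos h, dif_pos h, Function.update_of_ne]
  intro h'
  rw [← h'] at hk
  exact lt_irrefl _ hk

lemma history_update_self {x : Fin P.memory → Answer A V P.drawSize} {s : Fin P.memory}
    {a : Answer A V P.drawSize} : P.history (Function.update x s a) s = a := by
  rw [history, dif_pos s.2]
  simp

lemma instr_exec (p : Proc Q A K V P.drawSize Bool) (e : Env Q A K V P.drawSize)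
    (D : K → List V) (tab : ℕ → Option ℕ) (coin : (b : Fin P.wordSize) → Fin (b + 1))
    (s : Fin P.memory) (x : Fin P.memory → Answer A V P.drawSize)
    (hview : e.view = fun k => (D k)[0]?)
    (hcoin : ∀ b : Fin P.drawSize, e.coin s b = (coin (b.castLE P.drawSize_le)).castLE b.2) :
    advance (P.history (Instr.exec e.inp D tab coin (P.instr p s x)).1) (s + 1) p =
        follow (answer e s (advance (P.history x) s p)) (advance (P.history x) s p) ∧
      (Instr.exec e.inp D tab coin (P.instr p s x)).2 =
        written (advance (P.history x) s p) := by
  have hadv : ∀ a, advance (P.history (Function.update x s a)) (s + 1) p =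
      follow a (advance (P.history x) s p) := by
    intro a
    rw [advance, history_update_self, advance_congr fun k hk => history_update hk]
  rw [instr]
  rcases hp : advance (P.history x) s p with a | ⟨q, f⟩ | ⟨k, f⟩ | ⟨k, v, p'⟩ | ⟨b, f⟩
  · refine ⟨?_, rfl⟩
    simp only [Instr.exec, advance, hp, follow]
  · refine ⟨?_, rfl⟩
    simp only [Instr.exec, hadv, hp, answer]
  · refine ⟨?_, rfl⟩
    simp only [Instr.exec, hadv, hp, answer, hview]
  · refine ⟨?_, rfl⟩
    simp only [Instr.exec, advance, hp, follow]
  · refine ⟨?_, rfl⟩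
    simp only [Instr.exec, hadv, hp, answer, hcoin]

lemma localRun_spec (inp : Q → Option A) (tab : ℕ → Option ℕ) (ω : P.toProgram.Seed)
    (t : Fin P.rounds) (c : P.toProgram.Config) (i : Fin P.machines) :
    advance (P.history (P.toProgram.localRun (if (t : ℕ) = 0 then inp else fun _ => none)
        tab ω t c i).1) P.memory (P.proc t i) =
        (trace (P.env inp ω t i fun k => (c.store k)[0]?) (P.proc t i) P.memory).1 ∧
      (P.toProgram.localRun (if (t : ℕ) = 0 then inp else fun _ => none) tab ω t c i).2 =
        (trace (P.env inp ω t i fun k => (c.store k)[0]?) (P.proc t i) P.memory).2 := by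
  refine List.foldl_finRange_induction (S := P.memory)
    (fun (p : (Fin P.memory → Answer A V P.drawSize) × List (K × V)) s =>
      let r := Instr.exec (if (t : ℕ) = 0 then inp else fun _ => none) c.store tab (ω t i s)
        (P.instr (P.proc t i) s p.1)
      (r.1, p.2 ++ r.2))
    (fun s p => advance (P.history p.1) s (P.proc t i) =
        (trace (P.env inp ω t i fun k => (c.store k)[0]?) (P.proc t i) s).1 ∧
      p.2 = (trace (P.env inp ω t i fun k => (c.store k)[0]?) (P.proc t i) s).2) _ ⟨rfl, rfl⟩ ?_
  rintro s ⟨x, w⟩ ⟨h1, h2⟩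
  obtain ⟨h3, h4⟩ := instr_exec (P := P) (P.proc t i)
    (P.env inp ω t i fun k => (c.store k)[0]?) c.store tab (ω t i s) s x rfl fun b => by
      simp only [env, dif_pos s.2]
  rw [trace, ← h1, ← h2, ← h3, ← h4]
  exact ⟨rfl, rfl⟩

lemma output_eq {x : Fin P.memory → Answer A V P.drawSize} {a : Bool}
    (h : advance (P.history x) P.memory (P.proc (P.rounds - 1) ⟨0, P.machines_pos⟩) = .ret a) :
    P.toProgram.output x = a := by
  change (match advance (P.history x) P.memory (P.proc (P.rounds - 1) ⟨0, P.machines_pos⟩) with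
    | .ret a => a | _ => false) = a
  rw [h]

/-- What a store shows to the procedures. -/
def Shows (G : K → Option V) (C : Set K) (view : K → Option V) : Prop :=
  (∀ k v, view k = some v → G k = some v) ∧ ∀ k ∈ C, view k = G k

open Classical in
/-- If all procedures write pairs that agree with `G`, then the run of the program has the result
of the last procedure of machine `0`. -/
theorem run_eq (inp : Q → Option A) (tab : ℕ → Option ℕ) (σ : P.toProgram.Ordering)
    (ω : P.toProgram.Seed) (G : K → Option V) (C : ℕ → Set K) (hC : C 0 = ∅)
    (hT : 0 < P.rounds)
    (h : ∀ (t : Fin P.rounds) (view : K → Option V), Shows G (C t) view →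
      (∀ i, (exec (P.env inp ω t i view) 0 (P.proc t i)).2.2 ≤ P.memory ∧
        ∀ kv ∈ (exec (P.env inp ω t i view) 0 (P.proc t i)).2.1, G kv.1 = some kv.2) ∧
      ∀ k ∈ C (t + 1), ∀ v, G k = some v →
        ∃ i, (k, v) ∈ (exec (P.env inp ω t i view) 0 (P.proc t i)).2.1)
    (res : Bool)
    (hres : ∀ (t : Fin P.rounds) (view : K → Option V), (t : ℕ) = P.rounds - 1 →
      Shows G (C t) view →
      (exec (P.env inp ω t ⟨0, P.machines_pos⟩ view) 0
        (P.proc t ⟨0, P.machines_pos⟩)).1 = res) :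
    P.toProgram.run inp tab σ ω = res := by
  have key := List.foldl_finRange_induction (S := P.rounds) (P.toProgram.round inp tab σ ω)
    (fun (t : ℕ) (c : P.toProgram.Config) =>
      Shows G (C t) (fun k => (c.store k)[0]?) ∧ (t = P.rounds →
        P.toProgram.output (c.state ⟨0, P.machines_pos⟩) = res))
    ⟨P.toProgram.init, fun _ => []⟩ ?_ ?_
  · exact key.2 rfl
  · refine ⟨⟨fun k v hv => (by cases hv), by simp [hC]⟩, fun h0 => ?_⟩
    rw [← h0] at hT
    exact absurd hT (lt_irrefl 0)
  · rintro t c ⟨hc, -⟩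
    obtain ⟨h1, h2⟩ := h t _ hc
    have hloc := fun i => localRun_spec inp tab ω t c i
    have htr := fun i => trace_eq_exec (P.env inp ω t i fun k => (c.store k)[0]?) (P.proc t i)
      (P.proc t i) 0 rfl P.memory (h1 i).1
    have hw : ∀ i, (P.toProgram.localRun (if (t : ℕ) = 0 then inp else fun _ => none)
        tab ω t c i).2 =
        (exec (P.env inp ω t i fun k => (c.store k)[0]?) 0 (P.proc t i)).2.1 := fun i => by
      rw [(hloc i).2, htr i]
      rfl
    set W : Multiset (K × V) := ∑ i, ((P.toProgram.localRun (if (t : ℕ) = 0 then inp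
      else fun _ => none) tab ω t c i).2 : Multiset (K × V)) with hW
    have hmemW : ∀ kv, kv ∈ W ↔ ∃ i,
        kv ∈ (exec (P.env inp ω t i fun k => (c.store k)[0]?) 0 (P.proc t i)).2.1 := by
      intro kv
      rw [hW, Multiset.mem_sum]
      constructor
      · rintro ⟨i, -, hi⟩
        exact ⟨i, hw i ▸ Multiset.mem_coe.mp hi⟩
      · rintro ⟨i, hi⟩
        refine ⟨i, Finset.mem_univ _, Multiset.mem_coe.mpr ?_⟩
        rw [hw i]
        exact hi
    have hstore : ∀ k, ∀ v, v ∈ (P.toProgram.round inp tab σ ω c t).store k ↔ (k, v) ∈ W := by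
      intro k v
      have : ((P.toProgram.round inp tab σ ω c t).store k : Multiset V) =
        (W.filter (fun kv => kv.1 = k)).map Prod.snd := σ.arrange_eq _ _ _
      rw [← Multiset.mem_coe, this, Multiset.mem_map]
      constructor
      · rintro ⟨⟨k', v'⟩, h3, rfl⟩
        obtain ⟨h4, h5⟩ := Multiset.mem_filter.mp h3
        simp only at h5
        subst h5
        exact h4
      · intro h3
        exact ⟨(k, v), Multiset.mem_filter.mpr ⟨h3, rfl⟩, rfl⟩
    have hsound : ∀ k v, ((P.toProgram.round inp tab σ ω c t).store k)[0]? = some v →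
        G k = some v := by
      intro k v hv
      obtain ⟨i, hi⟩ := (hmemW _).mp ((hstore k v).mp (List.mem_of_getElem? hv))
      exact (h1 i).2 _ hi
    refine ⟨⟨hsound, fun k hk => ?_⟩, fun ht => ?_⟩
    · change ((P.toProgram.round inp tab σ ω c t).store k)[0]? = G k
      rcases hl : ((P.toProgram.round inp tab σ ω c t).store k)[0]? with _ | v
      · rcases hG : G k with _ | v
        · rfl
        · obtain ⟨i, hi⟩ := h2 k hk v hG
          have h3 := (hstore k v).mpr ((hmemW _).mpr ⟨i, hi⟩)
          rw [List.getElem?_eq_none_iff] at hl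
          rw [List.length_eq_zero_iff.mp (Nat.le_zero.mp hl)] at h3
          cases h3
      · exact (hsound k v hl).symm
    · have h3 := hres t _ (by omega) hc
      have h4 := (hloc ⟨0, P.machines_pos⟩).1
      rw [htr] at h4
      have ht' : P.rounds - 1 = t := by omega
      rw [← h3]
      apply output_eq
      rw [ht']
      exact h4

end ProcProgram

end AMPC

/-! ### The stores of the algorithm -/

namespace TreeIso

open AMPC AMPC.Proc TreePair CycleContraction

/-- The kinds of keys that are kept. -/
inductive Tag : Type
  | trie | root (b : Bool) | par (b : Bool) | rnd | nx | pos | lens | up | ex | val | hash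
  deriving Fintype

/-- The parameters of the algorithm: there are `m ^ J` ids and positions, the contractions follow
at most `L` steps, and the hashes are computed modulo `p`. -/
structure Params (n : ℕ) where
  m : ℕ
  J : ℕ
  L : ℕ
  p : ℕ
  H : ℕ
  two_le_m : 2 ≤ m
  one_le_J : 1 ≤ J
  le_pow : 4 * n + 4 ≤ m ^ J
  prime_p : p.Prime
  le_two_pow : n ≤ 2 ^ H
  H_lt : H < m ^ J

namespace Params

variable {n : ℕ} (P : Params n)

/-- The number of ids and of positions. -/
abbrev N : ℕ := P.m ^ P.J

/-- The number of machines. -/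
abbrev M : ℕ := P.m ^ (P.J - 1)

instance : NeZero P.N := ⟨by have := P.le_pow; simp only [N]; omega⟩

instance : Fact P.p.Prime := ⟨P.prime_p⟩

lemma N_eq : P.N = P.m * P.M := by
  rw [N, M, ← pow_succ', Nat.sub_add_cancel P.one_le_J]

lemma m_pos : 0 < P.m := by have := P.two_le_m; omega

lemma M_pos : 0 < P.M := pow_pos P.m_pos _

lemma N_pos : 0 < P.N := pow_pos P.m_pos _

/-- The size of the draws. -/
abbrev D : ℕ := max P.m P.p

/-- The keys of the stores. -/
abbrev Key : Type :=
  (Tag × Fin (P.J + 1) × Fin (P.J + 1) × Fin P.N) ⊕ (Bool × Fin P.N × Fin P.N × Fin P.N)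

/-- The values in the stores. -/
abbrev Val : Type := Fin P.N × ZMod P.N × ZMod P.p × ZMod P.p × Option (Fin P.N × Bool)

/-- The segments of the second part of the algorithm. -/
abbrev Part : Type := Seg (ZMod P.p) (Fin P.N × Bool)

/-- The procedures of the machines. -/
abbrev Prc (α : Type) : Type := Proc (Bool × Fin n) (Fin n) P.Key P.Val P.D α

/-- A key that is kept. -/
def key (t : Tag) (i j x : ℕ) : P.Key :=
  .inl (t, Fin.ofNat _ i, Fin.ofNat _ j, Fin.ofNat _ x)

/-- A key of the tries. -/
def trieKey (b : Bool) (h x v : ℕ) : P.Key :=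
  .inr (b, Fin.ofNat _ h, Fin.ofNat _ x, Fin.ofNat _ v)

variable {P}

/-- A pair of numbers as a value. -/
def ofPair (a : ℕ) (d : ZMod P.N) : P.Val := (Fin.ofNat _ a, d, 0, 0, none)

lemma ofPair_fst {a : ℕ} (h : a < P.N) (d : ZMod P.N) : ((ofPair a d : P.Val).1 : ℕ) = a :=
  Nat.mod_eq_of_lt h

/-- A segment as a value. -/
def ofPart (s : P.Part) : P.Val := (0, 0, s.a, s.b, s.e)

/-- A value as a segment. -/
def toPart (v : P.Val) : P.Part := ⟨v.2.2.1, v.2.2.2.1, v.2.2.2.2⟩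

@[simp] lemma toPart_ofPart (s : P.Part) : toPart (ofPart s) = s := rfl

/-- Read a value, with a default. -/
def fetch (k : P.Key) : P.Prc P.Val := get k >>= fun o => pure (o.getD (ofPair 0 0))

lemma ensures_fetch_bind {α : Type} {e : Env (Bool × Fin n) (Fin n) P.Key P.Val P.D} {k : P.Key}
    {v : P.Val} {g : P.Val → P.Prc α} {c : ℕ} {post : α → List (P.Key × P.Val) → Prop}
    (hv : e.view k = some v) (h : Ensures e (g v) c post) :
    Ensures e (fetch k >>= g) (c + 1) post := fun s => by
  have := h (s + 1)
  rw [← Option.getD_some (a := v) (b := ofPair 0 0), ← hv] at this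
  exact ⟨this.1.trans (by omega), this.2⟩

lemma ensures_fetch_bind' {α : Type} {e : Env (Bool × Fin n) (Fin n) P.Key P.Val P.D} {k : P.Key}
    {g : P.Val → P.Prc α} {c : ℕ} {post : α → List (P.Key × P.Val) → Prop}
    (h : ∀ v, Ensures e (g v) c post) : Ensures e (fetch k >>= g) (c + 1) post := fun s => by
  have := h ((e.view k).getD (ofPair 0 0)) (s + 1)
  exact ⟨this.1.trans (by omega), this.2⟩

end Params

open Params

/-- Which keys are available: a kind of keys and two indices. -/
abbrev Slot : Type := Tag × ℕ × ℕ

/-- The input and the random choices in a run of the algorithm in which the contractions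
succeed. -/
structure Run {n : ℕ} (P : Params n) where
  F : Bool → LabeledRootedTree n
  r : ℕ → ℕ → ℕ
  x : ZMod P.p
  y : ZMod P.p
  r_lt : ∀ j e, r j e < P.m
  good : ∀ j < P.J, Good P.m P.L (P.m ^ (P.J - j)) (level P.m (succId F P.N) r j) (r j)

namespace Run

variable {n : ℕ} {P : Params n} (R : Run P)

/-- The position in the cycle of a number at level `j`. -/
noncomputable def place (j i : ℕ) : ZMod P.N :=
  (position R.F P.N (origin P.m R.r j i) : ZMod P.N)

/-- The contraction at level `j`. -/
noncomputable abbrev lev (j : ℕ) : ℕ → ℕ := level P.m (succId R.F P.N) R.r j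

/-- The weights of stage `i`. -/
noncomputable abbrev wt (i : ℕ) : ℕ → P.Part := BinTree.weight R.x R.y P.m i P.N (sub R.F)

open Classical in
/-- The values that are stored under the keys that are kept. -/
noncomputable def truth : Tag → ℕ → ℕ → ℕ → Option P.Val
  | .trie, _, _, _ => none
  | .root b, _, _, x => if x = 0 then some (ofPair (R.F b).root 0) else none
  | .par b, _, _, x => if h : x < n then some (ofPair ((R.F b).parent ⟨x, h⟩) 0) else none
  | .rnd, j, _, e => if e < P.M then some (ofPair (R.r j e) 0) else none
  | .nx, j, _, i => if i < P.m ^ (P.J - j) then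
      some (ofPair (R.lev j i) (R.place j (R.lev j i) - R.place j i)) else none
  | .pos, j, _, i => if i < P.m ^ (P.J - j) then
      some (ofPair 0 (R.place j i - R.place P.J 0)) else none
  | .lens, _, _, q => match sub R.F q with
    | .nil => none
    | .node _ l r => some (ofPair l.len r.len)
  | .up, i, j, e => if e < P.m ^ (P.J - j) then
      some (ofPart (intervalProd (R.wt i) (e * P.m ^ j) ((e + 1) * P.m ^ j))) else none
  | .ex, i, j, e => if e < P.m ^ (P.J - j) then
      some (ofPart (intervalProd (R.wt i) ((e + 1) * P.m ^ j) P.N)) else none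
  | .val, i, _, q => if sub R.F q ≠ .nil ∧ Nat.log P.m (sub R.F q).len = i then
      some (ofPart ⟨(sub R.F q).ev R.x R.y, 0, none⟩) else none
  | .hash, _, _, x => if x = 0 then some (ofPart ⟨R.x, R.y, none⟩) else none

open Classical in
/-- The values that are stored under all keys. -/
noncomputable def store : P.Key → Option P.Val
  | .inl (t, i, j, x) => R.truth t i j x
  | .inr (b, h, x, v) =>
    if (h : ℕ) ≤ P.H ∧ ∃ u, u ≠ (R.F b).root ∧ ((R.F b).parent u : ℕ) = v ∧
      (u : ℕ) / 2 ^ (h : ℕ) = x then some (ofPair 0 0) else none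

/-- The keys in some slots. Values of subtrees are only needed at top positions. -/
def keys (A : Set Slot) : Set P.Key := fun k =>
  match k with
  | .inl (t, i, j, x) => (t, (i : ℕ), (j : ℕ)) ∈ A ∧ (t = .val → BinTree.IsTop P.m (sub R.F) x)
  | .inr _ => (.trie, 0, 0) ∈ A

variable {R}

lemma store_key {t : Tag} {i j x : ℕ} (hi : i ≤ P.J) (hj : j ≤ P.J) (hx : x < P.N) :
    R.store (P.key t i j x) = R.truth t i j x := by
  simp only [store, key, Fin.val_ofNat]
  rw [Nat.mod_eq_of_lt (by omega : i < P.J + 1), Nat.mod_eq_of_lt (by omega : j < P.J + 1),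
    Nat.mod_eq_of_lt hx]

open Classical in
lemma store_trieKey {b : Bool} {h x v : ℕ} (hh : h < P.N) (hx : x < P.N) (hv : v < P.N) :
    R.store (P.trieKey b h x v) =
      if h ≤ P.H ∧ ∃ u, u ≠ (R.F b).root ∧ ((R.F b).parent u : ℕ) = v ∧ (u : ℕ) / 2 ^ h = x then
        some (ofPair 0 0) else none := by
  simp only [store, trieKey, Fin.val_ofNat, Nat.mod_eq_of_lt hh, Nat.mod_eq_of_lt hx,
    Nat.mod_eq_of_lt hv]

lemma key_mem_keys {A : Set Slot} {t : Tag} {i j x : ℕ} (hi : i ≤ P.J) (hj : j ≤ P.J)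
    (hx : x < P.N) :
    P.key t i j x ∈ R.keys A ↔ (t, i, j) ∈ A ∧ (t = .val → BinTree.IsTop P.m (sub R.F) x) := by
  change ((t, (Fin.ofNat _ i : ℕ), (Fin.ofNat _ j : ℕ)) ∈ A ∧ _) ↔ _
  simp only [Fin.val_ofNat]
  rw [Nat.mod_eq_of_lt (by omega : i < P.J + 1), Nat.mod_eq_of_lt (by omega : j < P.J + 1),
    Nat.mod_eq_of_lt hx]

lemma keys_mono {A B : Set Slot} (h : A ⊆ B) : R.keys A ⊆ R.keys B := by
  rintro (⟨t, i, j, x⟩ | k) hk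
  · exact ⟨h hk.1, hk.2⟩
  · exact h hk

lemma keys_cases {A : Set Slot} {k : P.Key} (hk : k ∈ R.keys A) :
    (∃ t i j x, i ≤ P.J ∧ j ≤ P.J ∧ x < P.N ∧ k = P.key t i j x ∧ (t, i, j) ∈ A ∧
      (t = .val → BinTree.IsTop P.m (sub R.F) x)) ∨
      ((.trie, 0, 0) ∈ A ∧ ∃ b h x v, h < P.N ∧ x < P.N ∧ v < P.N ∧ k = P.trieKey b h x v) := by
  rcases k with ⟨t, i, j, x⟩ | ⟨b, h, x, v⟩
  · refine .inl ⟨t, i, j, x, by omega, by omega, x.2, ?_, hk⟩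
    simp [key]
  · refine .inr ⟨hk, b, h, x, v, h.2, x.2, v.2, ?_⟩
    simp [trieKey]

/-- A machine sees the contents of some slots. -/
abbrev Sees (R : Run P) (A : Set Slot) (e : Env (Bool × Fin n) (Fin n) P.Key P.Val P.D) : Prop :=
  AMPC.ProcProgram.Shows R.store (R.keys A) e.view

lemma Sees.view {A : Set Slot} {e : Env (Bool × Fin n) (Fin n) P.Key P.Val P.D}
    (h : R.Sees A e) {t : Tag} {i j x : ℕ} (hA : (t, i, j) ∈ A) (ht : t ≠ .val) (hi : i ≤ P.J)
    (hj : j ≤ P.J) (hx : x < P.N) : e.view (P.key t i j x) = R.truth t i j x := by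
  rw [h.2 _ ((key_mem_keys hi hj hx).mpr ⟨hA, fun h => absurd h ht⟩), store_key hi hj hx]

lemma Sees.view_val {A : Set Slot} {e : Env (Bool × Fin n) (Fin n) P.Key P.Val P.D}
    (h : R.Sees A e) {i x : ℕ} (hA : (.val, i, 0) ∈ A) (hi : i ≤ P.J)
    (hx : x < P.N) (ht : BinTree.IsTop P.m (sub R.F) x) :
    e.view (P.key .val i 0 x) = R.truth .val i 0 x := by
  rw [h.2 _ ((key_mem_keys hi (Nat.zero_le _) hx).mpr ⟨hA, fun _ => ht⟩),
    store_key hi (Nat.zero_le _) hx]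

end Run

/-! ### The phases of the algorithm -/

/-- What all machines do in a round, with the slots that they need and those that they fill. -/
structure Phase {n : ℕ} (P : Params n) where
  need : Set Slot
  give : Set Slot
  proc : ℕ → P.Prc Unit

variable {n : ℕ} {P : Params n}

/-- The slots that are available after a round. -/
def after (A : Set Slot) (φ : Phase P) : Set Slot := φ.give ∪ (A \ {(.trie, 0, 0)})

/-- In every phase, the slots are available that it needs. -/
def Valid (A : Set Slot) : List (Phase P) → Prop
  | [] => True
  | φ :: l => φ.need ⊆ A ∧ Valid (after A φ) l

lemma valid_append {A : Set Slot} {l l' : List (Phase P)} (h : Valid A l)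
    (h' : Valid (l.foldl after A) l') : Valid A (l ++ l') := by
  induction l generalizing A with
  | nil => exact h'
  | cons φ l ih => exact ⟨h.1, ih h.2 h'⟩

lemma Valid.getElem {A : Set Slot} {l : List (Phase P)} (h : Valid A l) {t : ℕ}
    (ht : t < l.length) : l[t].need ⊆ (l.take t).foldl after A := by
  induction l generalizing A t with
  | nil => simp at ht
  | cons φ l ih =>
    cases t with
    | zero => exact h.1
    | succ t => exact ih h.2 _

lemma foldl_after_take {A : Set Slot} {l : List (Phase P)} {t : ℕ} (ht : t < l.length) :
    (l.take (t + 1)).foldl after A = after ((l.take t).foldl after A) l[t] := by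
  rw [List.take_succ_eq_append_getElem ht, List.foldl_append]
  rfl

lemma mem_foldl_after {A : Set Slot} {l : List (Phase P)} {s : Slot} (hs : s ≠ (.trie, 0, 0))
    (h : s ∈ A ∨ ∃ φ ∈ l, s ∈ φ.give) : s ∈ l.foldl after A := by
  induction l generalizing A with
  | nil =>
    rcases h with h | ⟨φ, h, -⟩
    · exact h
    · cases h
  | cons φ l ih =>
    refine ih ?_
    rcases h with h | ⟨ψ, h, hs'⟩
    · exact .inl (.inr ⟨h, hs⟩)
    · rcases List.mem_cons.mp h with rfl | h
      · exact .inl (.inl hs')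
      · exact .inr ⟨ψ, h, hs'⟩

lemma valid_map_range {A : Set Slot} (φ : ℕ → Phase P) (k : ℕ)
    (h : ∀ j < k, ∀ s ∈ (φ j).need, s ≠ (.trie, 0, 0) ∧ (s ∈ A ∨ ∃ j' < j, s ∈ (φ j').give)) :
    Valid A ((List.range k).map φ) := by
  induction k with
  | zero => trivial
  | succ k ih =>
    rw [List.range_succ, List.map_append]
    refine valid_append (ih fun j hj => h j (by omega)) ⟨fun s hs => ?_, trivial⟩
    obtain ⟨h1, h2⟩ := h k (by omega) s hs
    refine mem_foldl_after h1 (h2.imp_right ?_)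
    rintro ⟨j', hj', hs'⟩
    exact ⟨φ j', List.mem_map.mpr ⟨j', List.mem_range.mpr hj', rfl⟩, hs'⟩

/-- The machines can follow the phase in `S` steps. -/
def Phase.Works (φ : Phase P) (R : Run P) (S : ℕ) : Prop :=
  ∃ O : ℕ → Set P.Key, (∀ e : Env (Bool × Fin n) (Fin n) P.Key P.Val P.D, R.Sees φ.need e →
      ∀ I < P.M, Ensures e (φ.proc I) S fun _ w => Writes R.store (O I) w) ∧
    ∀ k ∈ R.keys φ.give, R.store k ≠ none → ∃ I < P.M, k ∈ O I

/-- A criterion for phases that fill one slot. -/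
lemma Phase.works_of {φ : Phase P} {R : Run P} {S : ℕ} {t : Tag} {i j : ℕ}
    (hφ : φ.give = {(t, i, j)}) (hi : i ≤ P.J) (hj : j ≤ P.J) (ht : t ≠ .trie)
    (X : ℕ → Set ℕ)
    (h : ∀ e : Env (Bool × Fin n) (Fin n) P.Key P.Val P.D, R.Sees φ.need e → ∀ I < P.M,
      Ensures e (φ.proc I) S fun _ w => Writes R.store {k | ∃ x ∈ X I, k = P.key t i j x} w)
    (hX : ∀ x < P.N, R.truth t i j x ≠ none → (t = .val → BinTree.IsTop P.m (sub R.F) x) →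
      ∃ I < P.M, x ∈ X I) : φ.Works R S := by
  refine ⟨_, h, fun k hk h0 => ?_⟩
  rcases Run.keys_cases hk with ⟨t', i', j', x, hi', hj', hx, rfl, h1, h2⟩ | ⟨h1, -⟩
  · rw [hφ] at h1
    cases h1
    rw [Run.store_key hi hj hx] at h0
    obtain ⟨I, hI, hxI⟩ := hX x hx h0 h2
    exact ⟨I, hI, x, hxI, rfl⟩
  · rw [hφ] at h1
    cases h1
    exact absurd rfl ht

/-- The ids and positions that belong to a machine. -/
def block (P : Params n) (I : ℕ) : List ℕ := List.range' (I * P.m) P.m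

lemma mem_block {I x : ℕ} : x ∈ block P I ↔ x / P.m = I := by
  rw [block, List.mem_range'_1, Nat.div_eq_iff P.m_pos]
  have := P.m_pos
  constructor
  · rintro ⟨h1, h2⟩
    refine ⟨h1, ?_⟩
    omega
  · rintro ⟨h1, h2⟩
    exact ⟨h1, by omega⟩

lemma div_lt_M {x : ℕ} (hx : x < P.N) : x / P.m < P.M := by
  rw [P.N_eq] at hx
  exact Nat.div_lt_of_lt_mul hx

lemma lt_N_of_mem_block {I x : ℕ} (hI : I < P.M) (hx : x ∈ block P I) : x < P.N := by
  rw [mem_block] at hx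
  rw [P.N_eq]
  by_contra! h
  have := (Nat.le_div_iff_mul_le P.m_pos).mpr ((mul_comm _ _).trans_le h)
  omega

/-- The keys that a machine keeps. -/
noncomputable def kept (P : Params n) (I : ℕ) : List P.Key :=
  (Finset.univ : Finset Tag).toList.flatMap fun t =>
    (List.range (P.J + 1)).flatMap fun i => (List.range (P.J + 1)).flatMap fun j =>
      (block P I).map fun x => P.key t i j x

lemma length_kept (I : ℕ) : (kept P I).length = 13 * ((P.J + 1) * ((P.J + 1) * P.m)) := by
  simp [kept, block, List.length_flatMap]
  left
  rfl

lemma mem_kept {I : ℕ} {t : Tag} {i j x : ℕ} (hi : i ≤ P.J) (hj : j ≤ P.J) (hx : x ∈ block P I) :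
    P.key t i j x ∈ kept P I := by
  simp only [kept, List.mem_flatMap, List.mem_map, List.mem_range, Finset.mem_toList]
  exact ⟨t, Finset.mem_univ _, i, by omega, j, by omega, x, hx, rfl⟩

/-- The procedure of a machine in a round in which it follows a phase and keeps its keys. -/
noncomputable def Phase.keeping (φ : Phase P) (I : ℕ) : P.Prc Bool :=
  φ.proc I >>= fun _ => forEach (kept P I) keep >>= fun _ => pure false

lemma Phase.Works.keeping {φ : Phase P} {R : Run P} {S : ℕ} (h : φ.Works R S) {A : Set Slot}
    (hA : φ.need ⊆ A) :
    ∃ O : ℕ → Set P.Key,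
      (∀ e : Env (Bool × Fin n) (Fin n) P.Key P.Val P.D, R.Sees A e → ∀ I < P.M,
        Ensures e (φ.keeping I) (S + (kept P I).length * 2) fun _ w => Writes R.store (O I) w) ∧
      ∀ k ∈ R.keys (after A φ), R.store k ≠ none → ∃ I < P.M, k ∈ O I := by
  obtain ⟨O, h1, h2⟩ := h
  refine ⟨fun I => O I ∪ ({k | k ∈ kept P I} ∩ R.keys A), fun e he I hI => ?_, fun k hk h0 => ?_⟩
  · refine (h1 e ⟨he.1, fun k hk => he.2 k (Run.keys_mono hA hk)⟩ I hI).bind fun _ w hw => ?_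
    refine Ensures.mono ((ensures_forEach_keep he.1 he.2 (kept P I)).bind (c' := 0)
      fun _ w' hw' => ensures_pure ?_) (Nat.add_zero _).le fun _ _ h => h
    rw [List.append_nil]
    exact hw.append hw'
  · rcases Run.keys_cases hk with ⟨t, i, j, x, hi, hj, hx, rfl, h3, h4⟩ | ⟨h3, b, h, x, v, -, -, -, rfl⟩
    · rcases h3 with h3 | ⟨h3, -⟩
      · obtain ⟨I, hI, hO⟩ := h2 _ ((Run.key_mem_keys hi hj hx).mpr ⟨h3, h4⟩) h0
        exact ⟨I, hI, .inl hO⟩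
      · exact ⟨x / P.m, div_lt_M hx, .inr ⟨mem_kept hi hj (mem_block.mpr rfl),
          (Run.key_mem_keys hi hj hx).mpr ⟨h3, h4⟩⟩⟩
    · rcases h3 with h3 | ⟨-, h3⟩
      · obtain ⟨I, hI, hO⟩ := h2 (P.trieKey b h x v) h3 h0
        exact ⟨I, hI, .inl hO⟩
      · exact absurd rfl h3

end TreeIso

/-! ### List ranking -/

namespace TreeIso

open AMPC AMPC.Proc TreePair CycleContraction Params

variable {n : ℕ} {P : Params n}

lemma Params.le_N (P : Params n) : 4 * n + 4 ≤ P.N := P.le_pow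

lemma pow_sub_eq {j : ℕ} (hj : j < P.J) : P.m ^ (P.J - j) = P.m * P.m ^ (P.J - (j + 1)) := by
  rw [← pow_succ']
  congr 1
  omega

lemma pow_sub_le (j : ℕ) : P.m ^ (P.J - j) ≤ P.N :=
  Nat.pow_le_pow_right P.m_pos (Nat.sub_le _ _)

lemma pow_sub_succ_le (j : ℕ) : P.m ^ (P.J - (j + 1)) ≤ P.M :=
  Nat.pow_le_pow_right P.m_pos (by omega)

lemma m_le_N : P.m ≤ P.N := by
  rw [P.N_eq]
  exact Nat.le_mul_of_pos_right _ P.M_pos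

namespace Run

variable (R : Run P)

lemma transitive_lev {j : ℕ} (hj : j ≤ P.J) : Transitive (R.lev j) (P.m ^ (P.J - j)) :=
  transitive_level R.r_lt ⟨fun _ hi => succId_lt ((by omega : 4 * n + 3 ≤ 4 * n + 4).trans P.le_N) hi,
    fun _ hi _ hj => exists_iterate_succId ((by omega : 4 * n + 3 ≤ 4 * n + 4).trans P.le_N) hi hj⟩ hj
    fun j' hj' => R.good j' (by omega)

variable {R}

lemma truth_nx {j i : ℕ} (hi : i < P.m ^ (P.J - j)) :
    R.truth .nx j 0 i = some (ofPair (R.lev j i) (R.place j (R.lev j i) - R.place j i)) := if_pos hi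

lemma truth_pos {j i : ℕ} (hi : i < P.m ^ (P.J - j)) :
    R.truth .pos j 0 i = some (ofPair 0 (R.place j i - R.place P.J 0)) := if_pos hi

lemma truth_rnd {j e : ℕ} (he : e < P.M) :
    R.truth .rnd j 0 e = some (ofPair (R.r j e) 0) := if_pos he

lemma place_succ (j e : ℕ) : R.place (j + 1) e = R.place j (rep P.m (R.r j) e) := rfl

end Run

/-- The walk from a sampled number to the next one. -/
def climb (P : Params n) (j e : ℕ) : ℕ → ℕ → ZMod P.N → P.Prc Unit
  | 0, _, _ => pure ()
  | f + 1, z, d => fetch (P.key .nx j 0 z) >>= fun v => fetch (P.key .rnd j 0 (v.1 / P.m)) >>=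
      fun v' => if (v.1 : ℕ) % P.m = v'.1 then put (P.key .nx (j + 1) 0 e)
        (ofPair (v.1 / P.m) (d + v.2.1)) else climb P j e f v.1 (d + v.2.1)

/-- The contraction of level `j` is computed. -/
def lup (P : Params n) (j : ℕ) : Phase P where
  need := {(.nx, j, 0), (.rnd, j, 0)}
  give := {(.nx, j + 1, 0)}
  proc e := if e < P.m ^ (P.J - (j + 1)) then
    fetch (P.key .rnd j 0 e) >>= fun v => climb P j e P.L (e * P.m + v.1) 0 else pure ()

variable {R : Run P}

lemma ensures_climb {e : Env (Bool × Fin n) (Fin n) P.Key P.Val P.D} {j : ℕ} (hj : j < P.J)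
    (he : R.Sees (lup P j).need e) {I : ℕ} (hI : I < P.m ^ (P.J - (j + 1))) (f k : ℕ)
    (hk : k < hitTime P.m (R.lev j) (R.r j) (rep P.m (R.r j) I))
    (hf : hitTime P.m (R.lev j) (R.r j) (rep P.m (R.r j) I) ≤ k + f) :
    Ensures e (climb P j I f ((R.lev j)^[k] (rep P.m (R.r j) I))
      (R.place j ((R.lev j)^[k] (rep P.m (R.r j) I)) - R.place j (rep P.m (R.r j) I)))
      (2 * f + 1) fun _ w => Writes R.store {k | ∃ x ∈ ({I} : Set ℕ), k = P.key .nx (j + 1) 0 x} w := by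
  have hpow := pow_sub_eq hj
  have htr := R.transitive_lev hj.le
  have hg := R.good j hj
  rw [hpow] at hg
  induction f generalizing k with
  | zero => omega
  | succ f ih =>
    have hrep := rep_lt (m := P.m) (R.r_lt j) hI
    rw [← hpow] at hrep
    set z := (R.lev j)^[k] (rep P.m (R.r j) I) with hz
    have hzlt : z < P.m ^ (P.J - j) := iterate_lt htr.1 hrep k
    have hz' : R.lev j z = (R.lev j)^[k + 1] (rep P.m (R.r j) I) := by
      rw [hz, Function.iterate_succ_apply']
    have hflt := htr.1 z hzlt
    have hN := hflt.trans_le (pow_sub_le j)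
    rw [climb]
    refine Ensures.mono (ensures_fetch_bind ((he.view (by simp [lup]) (by simp) hj.le
      (Nat.zero_le _) (hzlt.trans_le (pow_sub_le j))).trans (Run.truth_nx hzlt)) (c := 2 * f + 2) ?_)
      (by omega) fun _ _ h => h
    rw [ofPair_fst hN]
    refine ensures_fetch_bind ((he.view (by simp [lup]) (by simp) hj.le
      (Nat.zero_le _) ((Nat.div_le_self _ _).trans_lt hN)).trans (Run.truth_rnd (div_lt_M hN))) ?_
    rw [ofPair_fst ((R.r_lt _ _).trans_le m_le_N)]
    have hd : R.place j z - R.place j (rep P.m (R.r j) I) + (R.place j (R.lev j z) - R.place j z) =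
        R.place j (R.lev j z) - R.place j (rep P.m (R.r j) I) := by ring
    simp only [ofPair] at hd ⊢
    rw [hd]
    split_ifs with hs
    · refine Ensures.mono (ensures_put (c := 0) ?_) (by omega) fun _ _ h => h
      simp only [Set.mem_singleton_iff, exists_eq_left, Set.ofPred_eq_eq_singleton]
      refine writes_singleton ?_
      have hh : hitTime P.m (R.lev j) (R.r j) (rep P.m (R.r j) I) = k + 1 :=
        le_antisymm (hitTime_le (by omega) (by rw [← hz']; exact hs)) hk
      have hc : R.lev (j + 1) I = R.lev j z / P.m := by
        change contract P.m (R.lev j) (R.r j) I = _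
        rw [contract, hh, ← hz']
      rw [Run.store_key (by omega) (Nat.zero_le _) (hI.trans_le (pow_sub_le _)), Run.truth_nx hI,
        hc, Run.place_succ, Run.place_succ, rep_div_of_sampled hs]
      rfl
    · have hh : k + 1 < hitTime P.m (R.lev j) (R.r j) (rep P.m (R.r j) I) := by
        refine lt_of_le_of_ne hk fun h => hs ?_
        have := (hitTime_spec (x := rep P.m (R.r j) I) hg (hpow ▸ hrep)).2.2.1
        rw [← h] at this
        rw [hz']
        exact this
      refine Ensures.mono ?_ le_rfl fun _ _ h => h
      have := ih (k + 1) hh (by omega)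
      rw [← hz'] at this
      exact this

lemma works_lup {j : ℕ} (hj : j < P.J) : (lup P j).Works R (2 * P.L + 2) := by
  refine Phase.works_of rfl (by omega) (Nat.zero_le _) (by simp)
    (fun I => if I < P.m ^ (P.J - (j + 1)) then {I} else ∅) (fun e he I hI => ?_) fun x hx h0 _ => ?_
  · simp only [lup]
    split_ifs with h
    · refine ensures_fetch_bind ((he.view (by simp [lup]) (by simp) hj.le
        (Nat.zero_le _) (h.trans_le (pow_sub_le _))).trans (Run.truth_rnd hI)) ?_
      rw [ofPair_fst ((R.r_lt _ _).trans_le m_le_N)]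
      have hrep := rep_lt (m := P.m) (R.r_lt j) h
      have hg := R.good j hj
      rw [pow_sub_eq hj] at hg
      have hs := hitTime_spec hg hrep
      have := ensures_climb hj he h P.L 0 hs.1 (by rw [zero_add]; exact hs.2.1)
      simp only [Function.iterate_zero_apply, sub_self] at this
      exact this
    · exact ensures_pure (by simpa using writes_nil)
  · have h : x < P.m ^ (P.J - (j + 1)) := by
      by_contra h
      exact h0 (if_neg h)
    exact ⟨x, h.trans_le (pow_sub_succ_le j), by rw [if_pos h]; rfl⟩

/-- The walk from a sampled number to the next one, where the positions are written. -/
def descend (P : Params n) (j : ℕ) : ℕ → ℕ → ZMod P.N → P.Prc Unit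
  | 0, _, _ => pure ()
  | f + 1, z, d => put (P.key .pos j 0 z) (ofPair 0 d) >>= fun _ =>
      fetch (P.key .nx j 0 z) >>= fun v => fetch (P.key .rnd j 0 (v.1 / P.m)) >>=
      fun v' => if (v.1 : ℕ) % P.m = v'.1 then pure () else descend P j f v.1 (d + v.2.1)

/-- The positions at level `j` are computed. -/
def ldown (P : Params n) (j : ℕ) : Phase P where
  need := {(.nx, j, 0), (.rnd, j, 0), (.pos, j + 1, 0)}
  give := {(.pos, j, 0)}
  proc e := if e < P.m ^ (P.J - (j + 1)) then
    fetch (P.key .rnd j 0 e) >>= fun v => fetch (P.key .pos (j + 1) 0 e) >>= fun v' =>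
      descend P j P.L (e * P.m + v.1) v'.2.1 else pure ()

lemma ensures_descend {e : Env (Bool × Fin n) (Fin n) P.Key P.Val P.D} {j : ℕ} (hj : j < P.J)
    (he : R.Sees (ldown P j).need e) {I : ℕ} (hI : I < P.m ^ (P.J - (j + 1))) (f k : ℕ)
    (hk : k < hitTime P.m (R.lev j) (R.r j) (rep P.m (R.r j) I))
    (hf : hitTime P.m (R.lev j) (R.r j) (rep P.m (R.r j) I) ≤ k + f) :
    Ensures e (descend P j f ((R.lev j)^[k] (rep P.m (R.r j) I))
      (R.place j ((R.lev j)^[k] (rep P.m (R.r j) I)) - R.place P.J 0))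
      (3 * f) fun _ w => Writes R.store {K | ∃ k' < hitTime P.m (R.lev j) (R.r j)
        (rep P.m (R.r j) I), k ≤ k' ∧ K = P.key .pos j 0 ((R.lev j)^[k'] (rep P.m (R.r j) I))} w := by
  have hpow := pow_sub_eq hj
  have htr := R.transitive_lev hj.le
  have hg := R.good j hj
  rw [hpow] at hg
  induction f generalizing k with
  | zero => omega
  | succ f ih =>
    have hrep := rep_lt (m := P.m) (R.r_lt j) hI
    rw [← hpow] at hrep
    set z := (R.lev j)^[k] (rep P.m (R.r j) I) with hz
    have hzlt : z < P.m ^ (P.J - j) := iterate_lt htr.1 hrep k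
    have hz' : R.lev j z = (R.lev j)^[k + 1] (rep P.m (R.r j) I) := by
      rw [hz, Function.iterate_succ_apply']
    have hflt := htr.1 z hzlt
    have hN := hflt.trans_le (pow_sub_le j)
    rw [descend]
    refine Ensures.mono (ensures_put_bind (c := 3 * f + 2) ?_) (by omega) fun _ _ h => h
    refine ensures_fetch_bind ((he.view (by simp [ldown]) (by simp) hj.le
      (Nat.zero_le _) (hzlt.trans_le (pow_sub_le j))).trans (Run.truth_nx hzlt)) (c := 3 * f + 1) ?_
    rw [ofPair_fst hN]
    refine ensures_fetch_bind ((he.view (by simp [ldown]) (by simp) hj.le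
      (Nat.zero_le _) ((Nat.div_le_self _ _).trans_lt hN)).trans (Run.truth_rnd (div_lt_M hN))) ?_
    rw [ofPair_fst ((R.r_lt _ _).trans_le m_le_N)]
    have hd : R.place j z - R.place P.J 0 + (R.place j (R.lev j z) - R.place j z) =
        R.place j (R.lev j z) - R.place P.J 0 := by ring
    have hput : R.store (P.key .pos j 0 z) = some (ofPair 0 (R.place j z - R.place P.J 0)) := by
      rw [Run.store_key hj.le (Nat.zero_le _) (hzlt.trans_le (pow_sub_le j)), Run.truth_pos hzlt]
    simp only [ofPair] at hd hput ⊢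
    rw [hd]
    split_ifs with hs
    · have hh : hitTime P.m (R.lev j) (R.r j) (rep P.m (R.r j) I) = k + 1 :=
        le_antisymm (hitTime_le (by omega) (by rw [← hz']; exact hs)) hk
      refine ensures_pure ((writes_singleton hput).mono ?_)
      rintro K ⟨k', h1, h2, rfl⟩
      obtain rfl : k' = k := by omega
      rfl
    · have hh : k + 1 < hitTime P.m (R.lev j) (R.r j) (rep P.m (R.r j) I) := by
        refine lt_of_le_of_ne hk fun h => hs ?_
        have := (hitTime_spec (x := rep P.m (R.r j) I) hg (hpow ▸ hrep)).2.2.1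
        rw [← h] at this
        rw [hz']
        exact this
      have := ih (k + 1) hh (by omega)
      rw [← hz'] at this
      refine this.mono le_rfl fun _ w hw => (writes_cons hput hw).mono ?_
      rintro K ⟨k', h1, h2, rfl⟩
      rcases eq_or_lt_of_le h2 with rfl | h2
      · exact .inl rfl
      · exact .inr ⟨k', h1, h2, rfl⟩

lemma works_ldown {j : ℕ} (hj : j < P.J) : (ldown P j).Works R (3 * P.L + 2) := by
  refine Phase.works_of rfl hj.le (Nat.zero_le _) (by simp)
    (fun I => if I < P.m ^ (P.J - (j + 1)) then {x | ∃ k < hitTime P.m (R.lev j) (R.r j)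
        (rep P.m (R.r j) I), x = (R.lev j)^[k] (rep P.m (R.r j) I)} else ∅)
    (fun e he I hI => ?_) fun x hx h0 _ => ?_
  · simp only [ldown]
    split_ifs with h
    · refine ensures_fetch_bind ((he.view (by simp [ldown]) (by simp) hj.le
        (Nat.zero_le _) (h.trans_le (pow_sub_le _))).trans (Run.truth_rnd hI)) ?_
      rw [ofPair_fst ((R.r_lt _ _).trans_le m_le_N)]
      refine ensures_fetch_bind ((he.view (by simp [ldown]) (by simp) hj
        (Nat.zero_le _) (h.trans_le (pow_sub_le _))).trans (Run.truth_pos h)) ?_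
      have hrep := rep_lt (m := P.m) (R.r_lt j) h
      have hg := R.good j hj
      rw [pow_sub_eq hj] at hg
      have hs := hitTime_spec hg hrep
      have := ensures_descend hj he h P.L 0 hs.1 (by rw [zero_add]; exact hs.2.1)
      rw [Function.iterate_zero_apply, ← Run.place_succ] at this
      refine this.mono le_rfl fun _ w hw => hw.mono ?_
      rintro K ⟨x, ⟨k, hk, rfl⟩, rfl⟩
      exact ⟨k, hk, Nat.zero_le _, rfl⟩
    · exact ensures_pure (by simpa using writes_nil)
  · have h : x < P.m ^ (P.J - j) := by
      by_contra h
      exact h0 (if_neg h)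
    have hg := R.good j hj
    have htr := R.transitive_lev hj.le
    rw [pow_sub_eq hj] at h hg htr
    obtain ⟨I, hI, k, hk, hx⟩ := exists_rep_iterate (R.r_lt j) htr hg h
    refine ⟨I, hI.trans_le (pow_sub_succ_le j), ?_⟩
    simp only [if_pos hI]
    exact ⟨k, hk, hx.symm⟩

end TreeIso

/-! ### The Euler tours -/

namespace TreeIso

open AMPC AMPC.Proc TreePair CycleContraction Params

variable {n : ℕ} {P : Params n}

/-- The least child of `v` in a block that contains one. -/
def findChild (P : Params n) (b : Bool) (v : ℕ) : ℕ → ℕ → P.Prc ℕ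
  | 0, q => pure q
  | h + 1, q => get (P.trieKey b h (2 * q) v) >>= fun o =>
      if o.isSome then findChild P b v h (2 * q) else findChild P b v h (2 * q + 1)

/-- The least child of `v` that is not in a block before block `q` of height `h`. -/
def seekChild (P : Params n) (b : Bool) (v : ℕ) : ℕ → ℕ → ℕ → P.Prc (Option ℕ)
  | 0, _, _ => pure none
  | f + 1, h, q => get (P.trieKey b h q v) >>= fun o =>
      if o.isSome then findChild P b v h q >>= fun u => pure (some u)
      else seekChild P b v f (h + 1) ((q + 1) / 2)

variable {R : Run P} {e : Env (Bool × Fin n) (Fin n) P.Key P.Val P.D}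

lemma Run.Sees.view_trie {A : Set Slot} (he : R.Sees A e) (hA : (.trie, 0, 0) ∈ A) {b : Bool}
    {h q : ℕ} (hh : h ≤ P.H) (hq : q ≤ n) (v : Fin n) :
    (e.view (P.trieKey b h q v)).isSome ↔
      ∃ u, u ≠ (R.F b).root ∧ (R.F b).parent u = v ∧ (u : ℕ) / 2 ^ h = q := by
  have hN := P.le_N
  have hH : P.H < P.N := P.H_lt
  rw [he.2 (P.trieKey b h q v) hA, Run.store_trieKey (by omega) (by omega) (by omega)]
  simp [hh, Fin.ext_iff]

lemma ensures_findChild {A : Set Slot} (he : R.Sees A e) (hA : (.trie, 0, 0) ∈ A) (b : Bool)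
    (v : Fin n) (h q : ℕ) (hh : h ≤ P.H)
    (hq : ∃ u, u ≠ (R.F b).root ∧ (R.F b).parent u = v ∧ (u : ℕ) / 2 ^ h = q) :
    Ensures e (findChild P b v h q) h fun a w => w = [] ∧ ∃ u : Fin n, a = u ∧
      u ≠ (R.F b).root ∧ (R.F b).parent u = v ∧ (u : ℕ) / 2 ^ h = q ∧
      ∀ u', u' ≠ (R.F b).root → (R.F b).parent u' = v → (u' : ℕ) / 2 ^ h = q → u ≤ u' := by
  induction h generalizing q with
  | zero =>
    obtain ⟨u, h1, h2, h3⟩ := hq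
    rw [pow_zero, Nat.div_one] at h3
    exact ensures_pure ⟨rfl, u, h3.symm, h1, h2, by simpa using h3, fun u' _ _ h => by
      rw [pow_zero, Nat.div_one] at h
      rw [Fin.le_def, h3, h]⟩
  | succ h ih =>
    obtain ⟨u, h1, h2, h3⟩ := hq
    have hdiv : ∀ u : ℕ, u / 2 ^ (h + 1) = u / 2 ^ h / 2 := fun u => by
      rw [pow_succ, Nat.div_div_eq_div_mul]
    rw [hdiv] at h3
    have hu : (u : ℕ) / 2 ^ h ≤ u := Nat.div_le_self _ _
    refine ensures_get_bind ?_
    have hv := he.view_trie hA (b := b) (h := h) (q := 2 * q) (by omega) (by omega) v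
    split_ifs with hs
    · refine (ih (2 * q) (by omega) (hv.mp hs)).mono le_rfl ?_
      rintro a w ⟨hw, u, ha, h4, h5, h6, h7⟩
      refine ⟨hw, u, ha, h4, h5, by rw [hdiv]; omega, fun u' h8 h9 h10 => ?_⟩
      rw [hdiv] at h10
      by_cases h11 : (u' : ℕ) / 2 ^ h = 2 * q
      · exact h7 u' h8 h9 h11
      · by_contra! h12
        have := Nat.div_le_div_right (c := 2 ^ h) (Fin.le_def.mp h12.le)
        omega
    · have hne : ∀ u, u ≠ (R.F b).root → (R.F b).parent u = v → (u : ℕ) / 2 ^ h / 2 = q →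
          (u : ℕ) / 2 ^ h = 2 * q + 1 := fun u h4 h5 h6 => by
        by_contra h7
        exact hs (hv.mpr ⟨u, h4, h5, by omega⟩)
      refine (ih (2 * q + 1) (by omega) ⟨u, h1, h2, hne u h1 h2 h3⟩).mono le_rfl ?_
      rintro a w ⟨hw, u, ha, h4, h5, h6, h7⟩
      refine ⟨hw, u, ha, h4, h5, by rw [hdiv]; omega, fun u' h8 h9 h10 => ?_⟩
      rw [hdiv] at h10
      exact h7 u' h8 h9 (hne u' h8 h9 h10)

lemma ensures_seekChild {A : Set Slot} (he : R.Sees A e) (hA : (.trie, 0, 0) ∈ A) (b : Bool)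
    (v : Fin n) (lo f h q : ℕ) (hf : h + f = P.H + 1) (hq : q ≤ n) (hlo : lo ≤ q * 2 ^ h)
    (hc : ∀ u, u ≠ (R.F b).root → (R.F b).parent u = v → lo ≤ u → q ≤ u / 2 ^ h ∧ h ≤ P.H) :
    Ensures e (seekChild P b v f h q) (f + P.H) fun a w => w = [] ∧
      a = ((R.F b).nextFrom v lo).map fun u => (u : ℕ) := by
  induction f generalizing h q with
  | zero =>
    refine ensures_pure ⟨rfl, ?_⟩
    have : (R.F b).nextFrom v lo = none := by
      rw [LabeledRootedTree.nextFrom_eq_none, Finset.eq_empty_iff_forall_notMem]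
      intro u hu
      rw [LabeledRootedTree.mem_childrenFrom] at hu
      have := (hc u hu.1 hu.2.1 hu.2.2).2
      omega
    rw [this]
    rfl
  | succ f ih =>
    refine Ensures.mono (ensures_get_bind (c := f + P.H) ?_) (by omega) fun _ _ h => h
    have hv := he.view_trie hA (b := b) (h := h) (q := q) (by omega) hq v
    split_ifs with hs
    · refine ((ensures_findChild he hA b v h q (by omega) (hv.mp hs)).bind (c' := 0) ?_).mono
        (by omega) fun _ _ h => h
      rintro a w ⟨rfl, u, rfl, h4, h5, h6, h7⟩
      refine ensures_pure ⟨rfl, ?_⟩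
      have : (R.F b).nextFrom v lo = some u := by
        rw [LabeledRootedTree.nextFrom_eq_some]
        refine ⟨(LabeledRootedTree.mem_childrenFrom _).mpr ⟨h4, h5, ?_⟩, fun u' hu' => ?_⟩
        · exact hlo.trans (h6 ▸ Nat.div_mul_le_self _ _)
        · rw [LabeledRootedTree.mem_childrenFrom] at hu'
          obtain ⟨h8, h9, h10⟩ := hu'
          by_cases h11 : (u' : ℕ) / 2 ^ h = q
          · exact h7 u' h8 h9 h11
          · by_contra! h12
            have := Nat.div_le_div_right (c := 2 ^ h) (Fin.le_def.mp h12.le)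
            have := (hc u' h8 h9 h10).1
            omega
      rw [this]
      rfl
    · refine ih (h + 1) ((q + 1) / 2) (by omega) (by omega) (hlo.trans ?_) fun u h1 h2 h3 => ?_
      · rw [pow_succ']
        calc q * 2 ^ h ≤ ((q + 1) / 2 * 2) * 2 ^ h := Nat.mul_le_mul_right _ (by omega)
          _ = _ := by ring
      · obtain ⟨h4, h5⟩ := hc u h1 h2 h3
        have h6 : q ≠ u / 2 ^ h := fun h6 => hs (hv.mpr ⟨u, h1, h2, h6.symm⟩)
        refine ⟨?_, ?_⟩
        · rw [pow_succ, ← Nat.div_div_eq_div_mul]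
          omega
        · by_contra h7
          obtain rfl : h = P.H := by omega
          have := P.le_two_pow
          rw [Nat.div_eq_of_lt (by omega)] at h4 h6
          omega

/-- The number of an arc. -/
def arcNum (n : ℕ) (b d : Bool) (v : ℕ) : ℕ := (2 * b.toNat + d.toNat) * n + v

/-- The number of the next arc. -/
def nextNum (P : Params n) (b : Bool) : Bool × Fin n → P.Prc ℕ
  | (false, v) => seekChild P b v (P.H + 1) 0 0 >>= fun o =>
      pure (o.elim (arcNum n b true v) (arcNum n b false))
  | (true, v) => fetch (P.key (.root b) 0 0 0) >>= fun w =>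
      if (v : ℕ) = w.1 then pure (4 * n + 1 + b.toNat)
      else fetch (P.key (.par b) 0 0 v) >>= fun w =>
        seekChild P b w.1 (P.H + 1) 0 (v + 1) >>= fun o =>
          pure (o.elim (arcNum n b true w.1) (arcNum n b false))

/-- The successor in the cycle. -/
noncomputable def nextId (P : Params n) (x : ℕ) : P.Prc ℕ :=
  if h : x < 4 * n then nextNum P (exists_arcId h).choose (exists_arcId h).choose_spec.choose
  else if x = 4 * n then
    fetch (P.key (.root false) 0 0 0) >>= fun w => pure (arcNum n false false w.1)
  else if x = 4 * n + 1 then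
    fetch (P.key (.root true) 0 0 0) >>= fun w => pure (arcNum n true false w.1)
  else pure (if x + 1 < P.N then x + 1 else 4 * n)

/-- The cycle is computed. -/
noncomputable def tourPhase (P : Params n) : Phase P where
  need := {s | s = (.trie, 0, 0) ∨ ∃ b, s = (.root b, 0, 0) ∨ s = (.par b, 0, 0)}
  give := {(.nx, 0, 0)}
  proc I := forEach (block P I) fun x => nextId P x >>= fun y => put (P.key .nx 0 0 x) (ofPair y 1)

namespace Run

lemma truth_root (b : Bool) : R.truth (.root b) 0 0 0 = some (ofPair (R.F b).root 0) := by
  rw [truth, if_pos rfl]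

lemma truth_par (b : Bool) (v : Fin n) :
    R.truth (.par b) 0 0 v = some (ofPair ((R.F b).parent v) 0) := dif_pos v.2

lemma fin_lt (P : Params n) (v : Fin n) : (v : ℕ) < P.N := by
  have := P.le_N
  omega

end Run

open Run (fin_lt)

lemma ensures_nextNum (he : R.Sees (tourPhase P).need e) (b : Bool) (a : Bool × Fin n) :
    Ensures e (nextNum P b a) (2 * P.H + 3) fun y w => w = [] ∧ y = succArc R.F b a := by
  have hseek : ∀ (v : Fin n) lo, lo ≤ n → Ensures e (seekChild P b v (P.H + 1) 0 lo) (P.H + 1 + P.H)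
      fun a w => w = [] ∧ a = ((R.F b).nextFrom v lo).map fun u => (u : ℕ) := fun v lo hlo =>
    ensures_seekChild he (.inl rfl) b v lo (P.H + 1) 0 lo (by omega) hlo (by simp)
      fun u _ _ h => ⟨by simpa using h, Nat.zero_le _⟩
  obtain ⟨_ | _, v⟩ := a
  · refine ((hseek v 0 (Nat.zero_le _)).bind (c' := 0) ?_).mono (by omega) fun _ _ h => h
    rintro _ _ ⟨rfl, rfl⟩
    refine ensures_pure ⟨rfl, ?_⟩
    rw [succArc, LabeledRootedTree.nextArc, LabeledRootedTree.firstChild]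
    rcases (R.F b).nextFrom v 0 with _ | u <;> rfl
  · refine Ensures.mono (ensures_fetch_bind ((he.view (.inr ⟨b, .inl rfl⟩) (by simp)
      (Nat.zero_le _) (Nat.zero_le _) P.N_pos).trans (Run.truth_root b)) (c := 2 * P.H + 2) ?_)
      (by omega) fun _ _ h => h
    rw [ofPair_fst (fin_lt P _)]
    have hroot : (v : ℕ) = (R.F b).root ↔ v = (R.F b).root := Fin.ext_iff.symm
    split_ifs with hs
    · refine ensures_pure ⟨rfl, ?_⟩
      rw [succArc, LabeledRootedTree.nextArc, if_pos (hroot.mp hs)]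
      rfl
    · rw [hroot] at hs
      refine Ensures.mono (ensures_fetch_bind ((he.view (.inr ⟨b, .inr rfl⟩) (by simp)
        (Nat.zero_le _) (Nat.zero_le _) (fin_lt P v)).trans (Run.truth_par b v))
        (c := 2 * P.H + 1) ?_) (by omega) fun _ _ h => h
      rw [ofPair_fst (fin_lt P _)]
      refine ((hseek ((R.F b).parent v) (v + 1) v.2).bind (c' := 0) ?_).mono (by omega)
        fun _ _ h => h
      rintro _ _ ⟨rfl, rfl⟩
      refine ensures_pure ⟨rfl, ?_⟩
      rw [succArc, LabeledRootedTree.nextArc, if_neg hs, LabeledRootedTree.nextSibling, if_neg hs]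
      rcases (R.F b).nextFrom _ _ with _ | u <;> rfl

lemma ensures_nextId (he : R.Sees (tourPhase P).need e) (x : ℕ) :
    Ensures e (nextId P x) (2 * P.H + 3) fun y w => w = [] ∧ y = succId R.F P.N x := by
  unfold nextId succId
  split_ifs
  · exact ensures_nextNum he _ _
  · refine Ensures.mono (ensures_fetch_bind ((he.view (.inr ⟨false, .inl rfl⟩) (by simp)
      (Nat.zero_le _) (Nat.zero_le _) P.N_pos).trans (Run.truth_root false)) (c := 0) ?_)
      (by omega) fun _ _ h => h
    rw [ofPair_fst (fin_lt P _)]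
    exact ensures_pure ⟨rfl, rfl⟩
  · refine Ensures.mono (ensures_fetch_bind ((he.view (.inr ⟨true, .inl rfl⟩) (by simp)
      (Nat.zero_le _) (Nat.zero_le _) P.N_pos).trans (Run.truth_root true)) (c := 0) ?_)
      (by omega) fun _ _ h => h
    rw [ofPair_fst (fin_lt P _)]
    exact ensures_pure ⟨rfl, rfl⟩
  · exact ensures_pure ⟨rfl, rfl⟩
  · exact ensures_pure ⟨rfl, rfl⟩

lemma length_block (I : ℕ) : (block P I).length = P.m := List.length_range' 

lemma works_tourPhase : (tourPhase P).Works R (P.m * (2 * P.H + 4)) := by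
  refine Phase.works_of rfl (Nat.zero_le _) (Nat.zero_le _) (by simp)
    (fun I => {x | x ∈ block P I}) (fun e he I hI => ?_) fun x hx _ _ =>
      ⟨x / P.m, div_lt_M hx, mem_block.mpr rfl⟩
  rw [← length_block I]
  refine (ensures_forEach (block P I) _ (fun x => {P.key .nx 0 0 x}) fun x hx => ?_).mono le_rfl
    fun _ w hw => hw.mono ?_
  · refine ((ensures_nextId he x).bind (c' := 1) ?_)
    rintro _ _ ⟨rfl, rfl⟩
    have hx := lt_N_of_mem_block hI hx
    refine ensures_put (c := 0) (writes_singleton ?_)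
    rw [Run.store_key (Nat.zero_le _) (Nat.zero_le _) hx, Run.truth_nx (by simpa using hx)]
    congr 2
    have h := position_succId (F := R.F) ((by omega : 4 * n + 3 ≤ 4 * n + 4).trans P.le_N) hx
    change (position R.F P.N (succId R.F P.N x) : ZMod P.N) - (position R.F P.N x : ZMod P.N) = 1
    rw [h, ZMod.natCast_mod]
    push_cast
    ring
  · rintro _ ⟨x, hx, rfl⟩
    simp only [Set.mem_iUnion]
    exact ⟨x, hx, rfl⟩

end TreeIso

/-! ### Positions and lengths -/

namespace TreeIso

open AMPC AMPC.Proc TreePair CycleContraction Params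
open Run (fin_lt)

variable {n : ℕ} {P : Params n}

/-- The position of an id, relative to the start of the cycle. -/
def fetchPos (P : Params n) (x : ℕ) : P.Prc ℕ :=
  fetch (P.key .pos 0 0 (4 * n)) >>= fun u => fetch (P.key .pos 0 0 x) >>= fun v =>
    pure (v.2.1 - u.2.1).val

/-- The lengths of the subtrees of a node are computed. -/
def putLens (P : Params n) (b : Bool) (v : ℕ) : P.Prc Unit :=
  fetchPos P (arcNum n b false v) >>= fun q => fetchPos P (arcNum n b true v) >>= fun u =>
    fetch (P.key (.root b) 0 0 0) >>= fun w =>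
      if v = w.1 then put (P.key .lens 0 0 q) (ofPair (u - (q + 1)) 0)
      else fetch (P.key (.par b) 0 0 v) >>= fun w => fetchPos P (arcNum n b true w.1) >>= fun z =>
        put (P.key .lens 0 0 q) (ofPair (u - (q + 1)) (z - (u + 1) : ℕ))

/-- The lengths of the subtrees of all nodes are computed. -/
noncomputable def lensPhase (P : Params n) : Phase P where
  need := {s | s = (.pos, 0, 0) ∨ ∃ b, s = (.root b, 0, 0) ∨ s = (.par b, 0, 0)}
  give := {(.lens, 0, 0)}
  proc I := forEach (block P I) fun x =>
    if h : x < 4 * n then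
      if (exists_arcId h).choose_spec.choose.1 = false then
        putLens P (exists_arcId h).choose (exists_arcId h).choose_spec.choose.2
      else pure ()
    else pure ()

variable {R : Run P} {e : Env (Bool × Fin n) (Fin n) P.Key P.Val P.D}

lemma arcId_lt_N (b : Bool) (a : Bool × Fin n) : arcId b a < P.N :=
  (arcId_lt b a).trans_le ((Nat.le_add_right _ _).trans P.le_N)

lemma arcNum_lt (b d : Bool) (v : Fin n) : arcNum n b d v < P.N :=
  arcId_lt_N b (d, v)

lemma ensures_fetchPos_bind {α : Type} {c : ℕ} {post : α → List (P.Key × P.Val) → Prop}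
    (he : R.Sees (lensPhase P).need e) {x : ℕ} (hx : x < P.N) {g : ℕ → P.Prc α}
    (h : Ensures e (g (position R.F P.N x)) c post) :
    Ensures e (fetchPos P x >>= g) (c + 2) post := by
  have h4 : 4 * n < P.N := lt_of_lt_of_le (by omega) P.le_N
  have h1 := he.view (t := .pos) (.inl rfl) (by simp) (Nat.zero_le _) (Nat.zero_le _) h4
  have h2 := he.view (t := .pos) (.inl rfl) (by simp) (Nat.zero_le _) (Nat.zero_le _) hx
  rw [Run.truth_pos (by simpa using h4)] at h1
  rw [Run.truth_pos (by simpa using hx)] at h2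
  have h3 : Ensures e (fetchPos P x) 2 fun a w => a = position R.F P.N x ∧ w = [] := by
    refine ensures_fetch_bind h1 (c := 1) (ensures_fetch_bind h2 (c := 0) (ensures_pure ⟨?_, rfl⟩))
    simp only [ofPair, sub_sub_sub_cancel_right]
    change ((position R.F P.N x : ZMod P.N) - (position R.F P.N (4 * n) : ZMod P.N)).val = _
    rw [position_start, Nat.cast_zero, sub_zero,
      ZMod.val_natCast_of_lt (position_lt ((by omega : 4 * n + 2 ≤ 4 * n + 4).trans P.le_N) hx)]
  refine (h3.bind (c' := c) ?_).mono (by omega) fun _ _ h => h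
  rintro _ _ ⟨rfl, rfl⟩
  exact h

namespace Run

lemma truth_lens {q : ℕ} {v : Fin n} {l r : BinTree (Fin n)} (h : sub R.F q = .node v l r) :
    R.truth .lens 0 0 q = some (ofPair l.len r.len) := by
  simp only [truth, h]

lemma truth_lens_none {q : ℕ} (h : sub R.F q = .nil) : R.truth .lens 0 0 q = none := by
  simp only [truth, h]

end Run

lemma ensures_putLens (he : R.Sees (lensPhase P).need e) (b : Bool) (v : Fin n) :
    Ensures e (putLens P b v) 9 fun _ w => Writes R.store
      {P.key .lens 0 0 (position R.F P.N (arcId b (false, v)))} w := by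
  obtain ⟨l, r, hlr⟩ := exists_sub_eq_node (F := R.F) (N := P.N) b v
  obtain ⟨b', h1, h2, h3, h4⟩ := sub_eq_node (N := P.N) hlr
  have hq := position_lt (F := R.F) ((by omega : 4 * n + 2 ≤ 4 * n + 4).trans P.le_N)
    (arcId_lt_N (P := P) b (false, v))
  obtain rfl : b = b' := by
    have := getElem?_position (F := R.F) ((by omega : 4 * n + 2 ≤ 4 * n + 4).trans P.le_N)
      (arcId_lt_N (P := P) b (false, v))
    rw [h1, getElem?_position ((by omega : 4 * n + 2 ≤ 4 * n + 4).trans P.le_N)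
      (arcId_lt_N (P := P) b' (false, v))] at this
    exact (arcId_inj (Option.some.inj this)).1.symm
  have hstore : R.store (P.key .lens 0 0 (position R.F P.N (arcId b (false, v)))) =
      some (ofPair l.len r.len) := by
    rw [Run.store_key (Nat.zero_le _) (Nat.zero_le _) hq, Run.truth_lens hlr]
  unfold putLens
  refine ensures_fetchPos_bind he (arcNum_lt b false v) (c := 7)
    (ensures_fetchPos_bind he (arcNum_lt b true v) (c := 5) (ensures_fetch_bind
      ((he.view (.inr ⟨b, .inl rfl⟩) (by simp) (Nat.zero_le _) (Nat.zero_le _) P.N_pos).trans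
        (Run.truth_root b)) (c := 4) ?_))
  rw [ofPair_fst (fin_lt P _)]
  have hroot : (v : ℕ) = (R.F b).root ↔ v = (R.F b).root := Fin.ext_iff.symm
  have h5 : position R.F P.N (arcNum n b true v) -
      (position R.F P.N (arcNum n b false v) + 1) = l.len := by
    change position R.F P.N (arcId b (true, v)) - (position R.F P.N (arcId b (false, v)) + 1) = _
    omega
  rw [h5]
  split_ifs with hs
  · refine Ensures.mono (ensures_put (c := 0) (writes_singleton ?_)) (by omega) fun _ _ h => h
    refine hstore.trans ?_
    rw [h3 (hroot.mp hs), Nat.cast_zero]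
  · rw [hroot] at hs
    refine ensures_fetch_bind ((he.view (.inr ⟨b, .inr rfl⟩) (by simp)
      (Nat.zero_le _) (Nat.zero_le _) (fin_lt P v)).trans (Run.truth_par b v)) (c := 3) ?_
    rw [ofPair_fst (fin_lt P _)]
    refine ensures_fetchPos_bind he (arcNum_lt b true _) (c := 1) (ensures_put (c := 0)
      (writes_singleton (hstore.trans ?_)))
    congr 3
    change r.len = position R.F P.N (arcId b (true, (R.F b).parent v)) -
      (position R.F P.N (arcId b (true, v)) + 1)
    rw [h4 hs, h2]
    omega

lemma works_lensPhase : (lensPhase P).Works R (P.m * 9) := by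
  refine Phase.works_of rfl (Nat.zero_le _) (Nat.zero_le _) (by simp)
    (fun I => {q | ∃ x ∈ block P I, ∃ (b : Bool) (v : Fin n), x = arcId b (false, v) ∧ q = position R.F P.N x})
    (fun e he I hI => ?_) fun x hx h0 _ => ?_
  · rw [← length_block I]
    refine (ensures_forEach (block P I) _ (fun x => {K | ∃ (b : Bool) (v : Fin n), x = arcId b (false, v) ∧
      K = P.key .lens 0 0 (position R.F P.N x)}) fun x hx => ?_).mono le_rfl
      fun _ w hw => hw.mono ?_
    · split_ifs with h h'
      · have hx' := (exists_arcId h).choose_spec.choose_spec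
        refine (ensures_putLens he (exists_arcId h).choose
          (exists_arcId h).choose_spec.choose.2).mono le_rfl fun _ w hw => hw.mono ?_
        rintro K ⟨b, v, -, rfl⟩
        have h2 : (exists_arcId h).choose_spec.choose =
            (false, (exists_arcId h).choose_spec.choose.2) := Prod.ext h' rfl
        rw [← h2, hx']
        rfl
      · refine ensures_pure ⟨by simp, ?_⟩
        rintro K ⟨b, v, hb, -⟩
        have hx' := (exists_arcId h).choose_spec.choose_spec
        have := (arcId_inj (hx'.trans hb)).2
        rw [this] at h'
        exact absurd rfl h'
      · refine ensures_pure ⟨by simp, ?_⟩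
        rintro K ⟨b, v, rfl, -⟩
        exact absurd (arcId_lt _ _) h
    · rintro _ ⟨_, ⟨x, hx, b, v, h1, rfl⟩, rfl⟩
      simp only [Set.mem_iUnion]
      exact ⟨x, hx, b, v, h1, rfl⟩
  · rcases h : sub R.F x with _ | ⟨v, l, r⟩
    · exact absurd (Run.truth_lens_none h) h0
    · obtain ⟨b, h1, -⟩ := sub_eq_node (N := P.N) h
      exact ⟨arcId b (false, v) / P.m, div_lt_M (arcNum_lt b false v), _, mem_block.mpr rfl, b, v,
        rfl, h1⟩

/-! ### The first round -/

/-- Some random draws. -/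
def drawAll (P : Params n) : List (Fin P.D) → P.Prc (List (Fin P.D))
  | [] => pure []
  | b :: l => .draw b fun c => drawAll P l >>= fun cs => pure (c :: cs)

lemma exec_drawAll (e : Env (Bool × Fin n) (Fin n) P.Key P.Val P.D) (l : List (Fin P.D)) (s : ℕ) :
    exec e s (drawAll P l) = (l.mapIdx fun i b => e.coin (s + i) b, [], s + l.length) := by
  induction l generalizing s with
  | nil => rfl
  | cons b l ih =>
    rw [drawAll, exec, exec_bind, ih]
    simp [pure, exec, Nat.add_assoc, Nat.add_comm 1]

/-- The bound of the draws of samples. -/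
def sampleBound (P : Params n) : Fin P.D :=
  ⟨P.m - 1, lt_of_lt_of_le (by have := P.m_pos; omega) (le_max_left _ _)⟩

/-- The bound of the draws of the point of evaluation. -/
def pointBound (P : Params n) : Fin P.D :=
  ⟨P.p - 1, lt_of_lt_of_le (by have := P.prime_p.pos; omega) (le_max_right _ _)⟩

/-- The keys that depend on the input at a node are written. -/
def putNode (P : Params n) (b : Bool) (v : Fin n) : P.Prc Unit :=
  ask (b, v) >>= fun o => match o with
    | none => put (P.key (.root b) 0 0 0) (ofPair v 0) >>= fun _ =>
        put (P.key (.par b) 0 0 v) (ofPair v 0)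
    | some w => put (P.key (.par b) 0 0 v) (ofPair w 0) >>= fun _ =>
        forEach (List.range (P.H + 1)) fun h => put (P.trieKey b h (v / 2 ^ h) w) (ofPair 0 0)

/-- The keys that depend on the input are written. -/
def putNodes (P : Params n) (I : ℕ) : P.Prc Unit :=
  forEach (block P I) fun u => if h : u < 2 * n then
    putNode P (decide (n ≤ u)) ⟨u % n, Nat.mod_lt _ (by omega)⟩ else pure ()

/-- The random choices are written. -/
def putDraws (P : Params n) (I : ℕ) (l : List (Fin P.D)) : P.Prc Unit :=
  forEach (List.range P.J) (fun j => put (P.key .rnd j 0 I)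
    (ofPair (l.getD j (sampleBound P) : ℕ) 0)) >>= fun _ =>
  if I = 0 then put (P.key .pos P.J 0 0) (ofPair 0 0) >>= fun _ => put (P.key .hash 0 0 0)
    (ofPart ⟨(l.getD P.J (sampleBound P) : ℕ), (l.getD (P.J + 1) (sampleBound P) : ℕ), none⟩)
  else pure ()

/-- The procedure of a machine in the first round. -/
def firstRound (P : Params n) (I : ℕ) : P.Prc Bool :=
  drawAll P (List.replicate P.J (sampleBound P) ++ List.replicate 2 (pointBound P)) >>= fun l =>
    putDraws P I l >>= fun _ => putNodes P I >>= fun _ => pure false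

/-- The slots that are filled in the first round. -/
def firstSlots (P : Params n) : Set Slot :=
  {s | s = (.trie, 0, 0) ∨ (∃ b, s = (.root b, 0, 0) ∨ s = (.par b, 0, 0)) ∨
    (∃ j < P.J, s = (.rnd, j, 0)) ∨ s = (.pos, P.J, 0) ∨ s = (.hash, 0, 0)}

/-- The keys that depend on the input at a node. -/
def nodeKeys (R : Run P) (b : Bool) (v : Fin n) : Set P.Key :=
  {K | K = P.key (.par b) 0 0 v ∨ (v = (R.F b).root ∧ K = P.key (.root b) 0 0 0) ∨
    (v ≠ (R.F b).root ∧ ∃ h ≤ P.H, K = P.trieKey b h (v / 2 ^ h) ((R.F b).parent v))}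

lemma ensures_putNode {b : Bool} {v : Fin n}
    (hv : e.inp (b, v) = if v = (R.F b).root then none else some ((R.F b).parent v)) :
    Ensures e (putNode P b v) (P.H + 4) fun _ w => Writes R.store (nodeKeys R b v) w := by
  refine Ensures.mono (ensures_ask_bind (c := P.H + 3) ?_) (by omega) fun _ _ h => h
  rw [hv]
  have hpar : R.store (P.key (.par b) 0 0 v) = some (ofPair ((R.F b).parent v) 0) := by
    rw [Run.store_key (Nat.zero_le _) (Nat.zero_le _) (fin_lt P v), Run.truth_par]
  split_ifs with hr
  · rw [hr, (R.F b).parent_root] at hpar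
    refine Ensures.mono (ensures_put_bind (c := 1) (ensures_put (c := 0) ?_)) (by omega)
      fun _ _ h => h
    rw [hr]
    refine (writes_cons (Run.store_key (Nat.zero_le _) (Nat.zero_le _) P.N_pos |>.trans
      (Run.truth_root b)) (writes_singleton hpar)).mono ?_
    rintro K (rfl | ⟨-, rfl⟩ | ⟨h1, -⟩)
    · exact .inr rfl
    · exact .inl rfl
    · exact absurd rfl h1
  · refine Ensures.mono (ensures_put_bind (c := P.H + 1) ?_) (by omega) fun _ _ h => h
    refine Ensures.mono (ensures_forEach (List.range (P.H + 1)) _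
      (fun h => {P.trieKey b h (v / 2 ^ h) ((R.F b).parent v)}) (c := 1) (G := R.store)
      fun h hh => ensures_put (c := 0) (writes_singleton ?_)) (by simp) fun _ w hw =>
        (writes_cons hpar hw).mono ?_
    · rw [List.mem_range] at hh
      have h1 : P.H < P.N := P.H_lt
      have h2 := fin_lt P v
      have h3 : (v : ℕ) / 2 ^ h ≤ v := Nat.div_le_self _ _
      rw [Run.store_trieKey (by omega) (by omega) (fin_lt P _), if_pos]
      exact ⟨by omega, v, hr, rfl, rfl⟩
    · rintro K (rfl | ⟨h1, -⟩ | ⟨-, h, hh, rfl⟩)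
      · exact .inl rfl
      · exact absurd h1 hr
      · refine .inr ?_
        simp only [Set.mem_iUnion]
        exact ⟨h, List.mem_range.mpr (by omega), rfl⟩

/-- The keys that depend on the input and are written by a machine. -/
def inputKeys (R : Run P) (I : ℕ) : Set P.Key :=
  {K | ∃ (b : Bool) (v : Fin n), b.toNat * n + (v : ℕ) ∈ block P I ∧ K ∈ nodeKeys R b v}

lemma ensures_putNodes (I : ℕ)
    (hv : ∀ b v, e.inp (b, v) = if v = (R.F b).root then none else some ((R.F b).parent v)) :
    Ensures e (putNodes P I) (P.m * (P.H + 4)) fun _ w => Writes R.store (inputKeys R I) w := by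
  rw [← length_block I]
  refine (ensures_forEach (block P I) _ (fun x => {K | ∃ (b : Bool) (v : Fin n), b.toNat * n + (v : ℕ) = x ∧
    K ∈ nodeKeys R b v}) fun x hx => ?_).mono le_rfl fun _ w hw => hw.mono ?_
  · split_ifs with h
    · refine (ensures_putNode (R := R) (hv _ _)).mono le_rfl fun _ w hw => hw.mono ?_
      rintro K ⟨b, v, h1, h2⟩
      obtain rfl : b = decide (n ≤ x) := by
        cases b
        · have := v.2
          simp only [Bool.toNat_false, zero_mul, zero_add] at h1
          simp; omega
        · simp only [Bool.toNat_true, one_mul] at h1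
          simp; omega
      have hv' : v = ⟨x % n, Nat.mod_lt _ (by omega)⟩ := by
        rw [Fin.ext_iff]
        conv_rhs => rw [← h1]
        simp [Nat.mod_eq_of_lt v.2]
      rwa [← hv']
    · refine ensures_pure ⟨by simp, ?_⟩
      rintro K ⟨b, v, h1, -⟩
      have := v.2
      cases b <;> simp at h1 <;> omega
  · rintro K ⟨b, v, h1, h2⟩
    simp only [Set.mem_iUnion]
    exact ⟨_, h1, b, v, rfl, h2⟩

/-- The keys of the random choices of a machine. -/
def drawKeys (P : Params n) (I : ℕ) : Set P.Key :=
  {K | (∃ j < P.J, K = P.key .rnd j 0 I) ∨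
    (I = 0 ∧ (K = P.key .pos P.J 0 0 ∨ K = P.key .hash 0 0 0))}

lemma ensures_putDraws {I : ℕ} (hI : I < P.M) {l : List (Fin P.D)}
    (hr : ∀ j < P.J, R.r j I = (l.getD j (sampleBound P) : ℕ))
    (hx : I = 0 → R.x = (l.getD P.J (sampleBound P) : ℕ))
    (hy : I = 0 → R.y = (l.getD (P.J + 1) (sampleBound P) : ℕ)) :
    Ensures e (putDraws P I l) (P.J + 2) fun _ w => Writes R.store (drawKeys P I) w := by
  have hIN : I < P.N := hI.trans_le (Nat.pow_le_pow_right P.m_pos (Nat.sub_le _ _))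
  refine Ensures.bind (c := P.J) (c' := 2) (Ensures.mono (ensures_forEach (List.range P.J) _
    (fun j => {P.key .rnd j 0 I}) (c := 1) (G := R.store)
    fun j hj => ensures_put (c := 0) (writes_singleton ?_)) (by simp) fun _ _ h => h) ?_
  · rw [List.mem_range] at hj
    rw [Run.store_key hj.le (Nat.zero_le _) hIN, Run.truth_rnd hI, hr j hj]
  · intro _ w hw
    split_ifs with h0
    · subst h0
      refine ensures_put_bind (c := 1) (ensures_put (c := 0) ?_)
      refine (hw.append (writes_cons ?_ (writes_singleton ?_))).mono (O := _ ∪ insert _ {_}) ?_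
      · rw [Run.store_key le_rfl (Nat.zero_le _) P.N_pos,
          Run.truth_pos (pow_pos P.m_pos _), sub_self]
      · rw [Run.store_key (Nat.zero_le _) (Nat.zero_le _) P.N_pos, Run.truth, if_pos rfl, hx rfl,
          hy rfl]
      · rintro K (⟨j, hj, rfl⟩ | ⟨-, rfl | rfl⟩)
        · refine .inl ?_
          simp only [Set.mem_iUnion]
          exact ⟨j, List.mem_range.mpr hj, rfl⟩
        · exact .inr (.inl rfl)
        · exact .inr (.inr rfl)
    · refine ensures_pure ?_
      rw [List.append_nil]
      refine hw.mono ?_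
      rintro K (⟨j, hj, rfl⟩ | ⟨h1, -⟩)
      · simp only [Set.mem_iUnion]
        exact ⟨j, List.mem_range.mpr hj, rfl⟩
      · exact absurd h1 h0

lemma firstRound_spec {I : ℕ} (hI : I < P.M)
    (hv : ∀ b v, e.inp (b, v) = if v = (R.F b).root then none else some ((R.F b).parent v))
    (hr : ∀ j < P.J, R.r j I = (e.coin j (sampleBound P) : ℕ))
    (hx : I = 0 → R.x = (e.coin P.J (pointBound P) : ℕ))
    (hy : I = 0 → R.y = (e.coin (P.J + 1) (pointBound P) : ℕ)) :
    (exec e 0 (firstRound P I)).2.2 ≤ P.J + 2 + (P.J + 2 + P.m * (P.H + 4)) ∧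
      Writes R.store (drawKeys P I ∪ inputKeys R I) (exec e 0 (firstRound P I)).2.1 := by
  rw [firstRound, exec_bind, exec_drawAll]
  simp only [List.nil_append, zero_add]
  set l := List.mapIdx (fun i b => e.coin i b)
    (List.replicate P.J (sampleBound P) ++ List.replicate 2 (pointBound P)) with hl
  have hlen : P.J + 1 < l.length := by simp [hl]
  have h1 : Ensures e (putDraws P I l >>= fun _ => putNodes P I >>= fun _ => (pure false : P.Prc Bool))
      (P.J + 2 + P.m * (P.H + 4)) fun _ w => Writes R.store (drawKeys P I ∪
        inputKeys R I) w := by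
    refine (ensures_putDraws (R := R) hI (fun j hj => ?_) (fun h => ?_) fun h => ?_).bind
      fun _ w hw => ?_
    · rw [hr j hj, List.getD_eq_getElem _ _ (by omega)]
      simp only [hl, List.getElem_mapIdx]
      rw [List.getElem_append_left (by simpa using hj), List.getElem_replicate]
    · rw [hx h, List.getD_eq_getElem _ _ (by omega)]
      simp only [hl, List.getElem_mapIdx]
      rw [List.getElem_append_right (by simp), List.getElem_replicate]
    · rw [hy h, List.getD_eq_getElem _ _ (by omega)]
      simp only [hl, List.getElem_mapIdx]
      rw [List.getElem_append_right (by simp), List.getElem_replicate]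
    · refine Ensures.mono ((ensures_putNodes I hv).bind (c' := 0) fun _ w' hw' =>
        ensures_pure ?_) (Nat.add_zero _).le fun _ _ h => h
      rw [List.append_nil]
      exact hw.append hw'
  have h2 := h1 (P.J + 2)
  simp only [List.length_append, List.length_replicate]
  exact h2

lemma firstRound_cover {K : P.Key} (hK : K ∈ R.keys (firstSlots P)) (h0 : R.store K ≠ none) :
    ∃ I < P.M, K ∈ drawKeys P I ∪ inputKeys R I := by
  have hnode : ∀ b (v : Fin n), K ∈ nodeKeys R b v →
      ∃ I < P.M, K ∈ drawKeys P I ∪ inputKeys R I := fun b v h => by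
    have hN := P.le_N
    have : b.toNat * n + (v : ℕ) < P.N := by cases b <;> simp <;> omega
    exact ⟨_, div_lt_M this, .inr ⟨b, v, mem_block.mpr rfl, h⟩⟩
  rcases Run.keys_cases hK with ⟨t, i, j, x, hi, hj, hx, rfl, h1, -⟩ | ⟨-, b, h, x, v, hh, hx, hv, rfl⟩
  · rw [Run.store_key hi hj hx] at h0
    rcases h1 with h1 | ⟨b, h1 | h1⟩ | ⟨j', hj', h1⟩ | h1 | h1 <;> cases h1
    · exact absurd rfl h0
    · have hx0 : x = 0 := by
        by_contra h
        exact h0 (if_neg h)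
      subst hx0
      exact hnode b (R.F b).root (.inr (.inl ⟨rfl, rfl⟩))
    · have hxn : x < n := by
        by_contra h
        exact h0 (dif_neg h)
      exact hnode b ⟨x, hxn⟩ (.inl rfl)
    · have hxM : x < P.M := by
        by_contra h
        exact h0 (if_neg h)
      exact ⟨x, hxM, .inl (.inl ⟨i, hj', rfl⟩)⟩
    · have hx0 : x = 0 := by
        by_contra h
        refine h0 (if_neg ?_)
        rw [Nat.sub_self, pow_zero]
        omega
      subst hx0
      exact ⟨0, P.M_pos, .inl (.inr ⟨rfl, .inl rfl⟩)⟩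
    · have hx0 : x = 0 := by
        by_contra h
        exact h0 (if_neg h)
      subst hx0
      exact ⟨0, P.M_pos, .inl (.inr ⟨rfl, .inr rfl⟩)⟩
  · rw [Run.store_trieKey hh hx hv] at h0
    split_ifs at h0 with h1
    · obtain ⟨h2, u, h3, h4, h5⟩ := h1
      refine hnode b u (.inr (.inr ⟨h3, h, h2, ?_⟩))
      rw [h4, h5]
    · exact absurd rfl h0

end TreeIso

/-! ### Evaluation of the hashes -/

lemma intervalProd_map_range' {G : Type*} [Monoid G] (w : ℕ → G) (a b t c : ℕ) :
    ((List.range' t c).map fun s => intervalProd w ((a + s) * b) ((a + s + 1) * b)).prod =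
      intervalProd w ((a + t) * b) ((a + t + c) * b) := by
  induction c generalizing t with
  | zero => simp [intervalProd_self]
  | succ c ih =>
    rw [List.range'_succ, List.map_cons, List.prod_cons, ih, ← Nat.add_assoc a t 1,
      intervalProd_mul _ (Nat.mul_le_mul_right _ (by omega)) (Nat.mul_le_mul_right _ (by omega))]
    congr 2
    ring

lemma BinTree.nodeWeight_congr {R : Type} [CommRing R] {x y : R} {m i N : ℕ} [NeZero N]
    {sl sr p : ℕ} {el el' er er' : R} (hl : sl < m ^ i → el = el') (hr : sr < m ^ i → er = er') :
    nodeWeight x y m i N sl sr p el er = nodeWeight x y m i N sl sr p el' er' := by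
  unfold nodeWeight
  split_ifs with h1 h2 h3 h3
  · rfl
  · rfl
  · rw [hr (by omega)]
  · rw [hl (by omega)]
  · rw [hl (by omega), hr (by omega)]

namespace TreeIso

open AMPC AMPC.Proc TreePair CycleContraction Params
open Run (fin_lt)

variable {n : ℕ} {P : Params n}

/-- The hash of a subtree of known length, where an empty subtree has the hash `1`. -/
def fetchVal (P : Params n) (s q : ℕ) : P.Prc (ZMod P.p) :=
  if s = 0 then pure 1 else fetch (P.key .val (Nat.log P.m s) 0 q) >>= fun v => pure v.2.2.1

/-- The weight of a position in stage `i` is computed. -/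
def putWeight (P : Params n) (i : ℕ) (z : P.Val) (q : ℕ) : P.Prc Unit :=
  get (P.key .lens 0 0 q) >>= fun o => match o with
    | none => put (P.key .up i 0 q) (ofPart 1)
    | some v => if Nat.log P.m (2 + v.1 + v.2.1.val) = i then
        fetchVal P v.1 (q + 1) >>= fun el => fetchVal P v.2.1.val (q + 2 + v.1) >>= fun er =>
          put (P.key .up i 0 q)
            (ofPart (BinTree.nodeWeight z.2.2.1 z.2.2.2.1 P.m i P.N v.1 v.2.1.val q el er))
      else put (P.key .up i 0 q) (ofPart 1)

/-- The weights of stage `i` are computed. -/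
def weightPhase (P : Params n) (i : ℕ) : Phase P where
  need := {s | s = (.lens, 0, 0) ∨ s = (.hash, 0, 0) ∨ ∃ i' < i, s = (.val, i', 0)}
  give := {(.up, i, 0)}
  proc I := fetch (P.key .hash 0 0 0) >>= fun z => forEach (block P I) (putWeight P i z)

variable {R : Run P} {e : Env (Bool × Fin n) (Fin n) P.Key P.Val P.D}

namespace Run

lemma truth_hash : R.truth .hash 0 0 0 = some (ofPart ⟨R.x, R.y, none⟩) := by
  rw [truth, if_pos rfl]

lemma truth_val {i q : ℕ} (h : sub R.F q ≠ .nil) (hi : Nat.log P.m (sub R.F q).len = i) :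
    R.truth .val i 0 q = some (ofPart ⟨(sub R.F q).ev R.x R.y, 0, none⟩) := by
  rw [truth, if_pos ⟨h, hi⟩]

lemma truth_up {i j e : ℕ} (he : e < P.m ^ (P.J - j)) : R.truth .up i j e =
    some (ofPart (intervalProd (R.wt i) (e * P.m ^ j) ((e + 1) * P.m ^ j))) := if_pos he

lemma truth_ex {i j e : ℕ} (he : e < P.m ^ (P.J - j)) : R.truth .ex i j e =
    some (ofPart (intervalProd (R.wt i) ((e + 1) * P.m ^ j) P.N)) := if_pos he

lemma add_len_lt {q : ℕ} (h : sub R.F q ≠ .nil) : q + (sub R.F q).len < P.N :=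
  add_len_sub_lt R.F ((by omega : 4 * n + 3 ≤ 4 * n + 4).trans P.le_N) h

lemma log_lt {s : ℕ} (hs : s < P.N) : Nat.log P.m s < P.J :=
  Nat.log_lt_of_lt_pow' (by have := P.one_le_J; omega) hs

end Run

lemma ensures_fetchVal {i : ℕ} (he : R.Sees (weightPhase P i).need e) {q s : ℕ} (hq : q < P.N)
    (hs : s < P.N) : Ensures e (fetchVal P s q) 1 fun a w => w = [] ∧ ((sub R.F q).len = s →
      s < P.m ^ i → (s ≠ 0 → BinTree.IsTop P.m (sub R.F) q) → a = (sub R.F q).ev R.x R.y) := by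
  unfold fetchVal
  split_ifs with h0
  · refine ensures_pure ⟨rfl, fun h _ _ => ?_⟩
    have : sub R.F q = .nil := by
      by_contra h'
      have := BinTree.len_pos h'
      omega
    rw [this]
    rfl
  · by_cases h : (sub R.F q).len = s ∧ s < P.m ^ i ∧ (s ≠ 0 → BinTree.IsTop P.m (sub R.F) q)
    · obtain ⟨h1, h2, h3⟩ := h
      have hne : sub R.F q ≠ .nil := by
        intro h
        rw [h] at h1
        exact h0 h1.symm
      have hlog : Nat.log P.m s < i := Nat.log_lt_of_lt_pow h0 h2
      refine ensures_fetch_bind (c := 0) ((he.view_val (.inr (.inr ⟨_, hlog, rfl⟩))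
        (Run.log_lt hs).le hq (h3 h0)).trans (Run.truth_val hne (by rw [h1]))) ?_
      exact ensures_pure ⟨rfl, fun _ _ _ => rfl⟩
    · refine ensures_fetch_bind' (c := 0) fun v => ensures_pure ⟨rfl, fun h1 h2 h3 => ?_⟩
      exact absurd ⟨h1, h2, h3⟩ h

lemma ensures_putWeight {i : ℕ} (hi : i ≤ P.J) (he : R.Sees (weightPhase P i).need e) {q : ℕ}
    (hq : q < P.N) : Ensures e (putWeight P i (ofPart ⟨R.x, R.y, none⟩) q) 4 fun _ w =>
      Writes R.store {P.key .up i 0 q} w := by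
  have hstore : R.store (P.key .up i 0 q) = some (ofPart (R.wt i q)) := by
    rw [Run.store_key hi (Nat.zero_le _) hq, Run.truth_up (by simpa using hq), pow_zero, mul_one,
      mul_one, intervalProd_succ _ (Nat.lt_succ_self q), intervalProd_self, mul_one]
  refine ensures_get_bind (c := 3) ?_
  rw [he.view (.inl rfl) (by simp) (Nat.zero_le _) (Nat.zero_le _) hq]
  rcases h : sub R.F q with _ | ⟨v, l, r⟩
  · rw [Run.truth_lens_none h]
    refine Ensures.mono (ensures_put (c := 0) (writes_singleton (hstore.trans ?_))) (by omega)
      fun _ _ h => h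
    rw [Run.wt, BinTree.weight, h]
  · have hlen := R.add_len_lt (q := q) (by rw [h]; simp)
    have hlen' : (BinTree.node v l r).len = 2 + l.len + r.len := rfl
    rw [h, hlen'] at hlen
    rw [Run.truth_lens h]
    have e1 : ((ofPair l.len r.len : P.Val).1 : ℕ) = l.len := ofPair_fst (by omega) _
    have e2 : (ofPair l.len r.len : P.Val).2.1.val = r.len := ZMod.val_natCast_of_lt (by omega)
    simp only [e1, e2]
    obtain ⟨hl, -, hr⟩ := isTourArray_sub R.F q v l r h
    have hw : R.wt i q = BinTree.nodeWeight R.x R.y P.m i P.N l.len r.len q (l.ev R.x R.y)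
        (r.ev R.x R.y) := by rw [Run.wt, BinTree.weight, h]
    split_ifs with hlog
    · refine (ensures_fetchVal he (q := q + 1) (s := l.len) (by omega) (by omega)).bind (c' := 2) ?_
      rintro el _ ⟨rfl, hel⟩
      refine (ensures_fetchVal he (q := q + 2 + l.len) (s := r.len) (by omega)
        (by omega)).bind (c' := 1) ?_
      rintro er _ ⟨rfl, her⟩
      refine ensures_put (c := 0) (writes_singleton (hstore.trans ?_))
      have htr : q + 1 + 1 + l.len = q + 2 + l.len := by ring
      rw [hw, BinTree.nodeWeight_congr (el' := el) (er' := er) (fun hlt => ?_) fun hlt => ?_]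
      · rfl
      · rw [hl] at hel
        refine (hel rfl hlt fun h0 => BinTree.isTop_left (isTourArray_sub R.F) h ?_).symm
        rw [hlen', hlog]
        exact Nat.log_lt_of_lt_pow h0 hlt
      · rw [hr] at her
        refine (her rfl hlt fun h0 => BinTree.isTop_right (isTourArray_sub R.F) h ?_).symm
        rw [hlen', hlog]
        exact Nat.log_lt_of_lt_pow h0 hlt
    · refine Ensures.mono (ensures_put (c := 0) (writes_singleton (hstore.trans ?_))) (by omega)
        fun _ _ h => h
      rw [hw, BinTree.nodeWeight, if_pos hlog]

lemma works_weightPhase {i : ℕ} (hi : i ≤ P.J) :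
    (weightPhase P i).Works R (P.m * 4 + 1) := by
  refine Phase.works_of rfl hi (Nat.zero_le _) (by simp) (fun I => {x | x ∈ block P I})
    (fun e he I hI => ?_) fun x hx _ _ => ⟨x / P.m, div_lt_M hx, mem_block.mpr rfl⟩
  refine ensures_fetch_bind ((he.view (.inr (.inl rfl)) (by simp) (Nat.zero_le _) (Nat.zero_le _)
    P.N_pos).trans Run.truth_hash) ?_
  rw [← length_block I]
  refine (ensures_forEach (block P I) _ (fun x => {P.key .up i 0 x}) fun x hx =>
    ensures_putWeight hi he (lt_N_of_mem_block hI hx)).mono le_rfl fun _ w hw => hw.mono ?_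
  rintro _ ⟨x, hx, rfl⟩
  simp only [Set.mem_iUnion]
  exact ⟨x, hx, rfl⟩

/-- The products in a group of intervals. -/
def fetchUps (P : Params n) (i j e : ℕ) : P.Prc (List P.Part) :=
  getAll ((List.range' 0 P.m).map fun t => P.key .up i j (e * P.m + t)) >>= fun l =>
    pure (l.map fun o => toPart (o.getD (ofPart 1)))

/-- The products over longer intervals are computed. -/
def upPhase (P : Params n) (i j : ℕ) : Phase P where
  need := {(.up, i, j)}
  give := {(.up, i, j + 1)}
  proc e := if e < P.m ^ (P.J - (j + 1)) then
    fetchUps P i j e >>= fun l => put (P.key .up i (j + 1) e) (ofPart l.prod) else pure ()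

/-- The products up to the end are computed. -/
def downPhase (P : Params n) (i j : ℕ) : Phase P where
  need := {s | s = (.up, i, j) ∨ j + 1 < P.J ∧ s = (.ex, i, j + 1)}
  give := {(.ex, i, j)}
  proc e := if e < P.m ^ (P.J - (j + 1)) then
    fetchUps P i j e >>= fun l => fetch (P.key .ex i (j + 1) e) >>= fun v =>
      forEach (List.range P.m) fun t => put (P.key .ex i j (e * P.m + t))
        (ofPart ((l.drop (t + 1)).prod * if j + 1 < P.J then toPart v else 1))
    else pure ()

lemma mul_add_lt {j I t : ℕ} (hj : j < P.J) (hI : I < P.m ^ (P.J - (j + 1))) (ht : t < P.m) :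
    I * P.m + t < P.m ^ (P.J - j) := by
  rw [pow_sub_eq hj]
  calc I * P.m + t < (I + 1) * P.m := by rw [add_mul]; omega
    _ ≤ P.m ^ (P.J - (j + 1)) * P.m := Nat.mul_le_mul_right _ hI
    _ = _ := mul_comm _ _

lemma ensures_fetchUps {A : Set Slot} (he : R.Sees A e) {i j I : ℕ} (hA : (.up, i, j) ∈ A)
    (hi : i ≤ P.J) (hj : j < P.J) (hI : I < P.m ^ (P.J - (j + 1))) :
    Ensures e (fetchUps P i j I) P.m fun l w => w = [] ∧
      l = (List.range' 0 P.m).map fun s => intervalProd (R.wt i) ((I * P.m + s) * P.m ^ j)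
        ((I * P.m + s + 1) * P.m ^ j) := by
  have h := ensures_getAll (e := e)
    ((List.range' 0 P.m).map fun t => P.key .up i j (I * P.m + t))
  rw [List.length_map, List.length_range'] at h
  refine (h.bind (c' := 0) ?_).mono (by omega) fun _ _ h => h
  rintro _ _ ⟨rfl, rfl⟩
  refine ensures_pure ⟨rfl, ?_⟩
  rw [List.map_map, List.map_map, List.map_inj_left]
  intro t ht
  rw [List.mem_range'_1] at ht
  have hlt := mul_add_lt hj hI (t := t) (by omega)
  simp only [Function.comp_apply]
  rw [he.view hA (by simp) hi hj.le (hlt.trans_le (pow_sub_le _)), Run.truth_up hlt]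
  rfl

lemma works_upPhase {i j : ℕ} (hi : i ≤ P.J) (hj : j < P.J) :
    (upPhase P i j).Works R (P.m + 1) := by
  refine Phase.works_of rfl hi (by omega) (by simp)
    (fun I => if I < P.m ^ (P.J - (j + 1)) then {I} else ∅) (fun e he I hI => ?_) fun x hx h0 _ => ?_
  · simp only [upPhase]
    split_ifs with h
    · refine (ensures_fetchUps he rfl hi hj h).bind ?_
      rintro _ _ ⟨rfl, rfl⟩
      refine ensures_put (c := 0) ?_
      simp only [Set.mem_singleton_iff, exists_eq_left, Set.ofPred_eq_eq_singleton, List.nil_append]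
      refine writes_singleton ?_
      rw [Run.store_key hi hj (h.trans_le (pow_sub_le _)), Run.truth_up h, intervalProd_map_range']
      congr 3 <;> ring
    · exact ensures_pure (by simpa using writes_nil)
  · have h : x < P.m ^ (P.J - (j + 1)) := by
      by_contra h
      exact h0 (if_neg h)
    exact ⟨x, h.trans_le (pow_sub_succ_le j), by rw [if_pos h]; rfl⟩

lemma works_downPhase {i j : ℕ} (hi : i ≤ P.J) (hj : j < P.J) :
    (downPhase P i j).Works R (2 * P.m + 1) := by
  refine Phase.works_of rfl hi hj.le (by simp)
    (fun I => if I < P.m ^ (P.J - (j + 1)) then {x | ∃ t < P.m, x = I * P.m + t} else ∅)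
    (fun e he I hI => ?_) fun x hx h0 _ => ?_
  · simp only [downPhase]
    by_cases h : I < P.m ^ (P.J - (j + 1))
    · rw [if_pos h, if_pos h]
      refine ((ensures_fetchUps he (.inl rfl) hi hj h).bind (c' := P.m + 1) ?_).mono (by omega)
        fun _ _ h => h
      rintro _ _ ⟨rfl, rfl⟩
      have hv : ∀ v : P.Val, (j + 1 < P.J → e.view (P.key .ex i (j + 1) I) = some v) →
          (if j + 1 < P.J then toPart v else 1) =
            intervalProd (R.wt i) ((I + 1) * P.m ^ (j + 1)) P.N := fun v hv => by
        split_ifs with hj'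
        · have := hv hj'
          rw [he.view (.inr ⟨hj', rfl⟩) (by simp) hi hj (h.trans_le (pow_sub_le _)),
            Run.truth_ex h] at this
          rw [← Option.some.inj this]
          rfl
        · obtain hj : j + 1 = P.J := by omega
          rw [hj, Nat.sub_self, pow_zero] at h
          obtain rfl : I = 0 := by omega
          rw [hj, zero_add, one_mul, intervalProd_self]
      have key : ∀ v : P.Val, (if j + 1 < P.J then toPart v else 1) =
            intervalProd (R.wt i) ((I + 1) * P.m ^ (j + 1)) P.N →
          Ensures e (forEach (List.range P.m) fun t => put (P.key .ex i j (I * P.m + t))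
            (ofPart (((List.map (fun s => intervalProd (R.wt i) ((I * P.m + s) * P.m ^ j)
              ((I * P.m + s + 1) * P.m ^ j)) (List.range' 0 P.m)).drop (t + 1)).prod *
                if j + 1 < P.J then toPart v else 1))) P.m fun _ w => Writes R.store
            {k | ∃ x ∈ {x | ∃ t < P.m, x = I * P.m + t}, k = P.key .ex i j x} w := fun v hv => by
        rw [hv]
        refine Ensures.mono (ensures_forEach (List.range P.m) _
          (fun t => {P.key .ex i j (I * P.m + t)}) (c := 1) (G := R.store)
          fun t ht => ensures_put (c := 0) (writes_singleton ?_)) (by simp) fun _ _ hw => hw.mono ?_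
        · rw [List.mem_range] at ht
          have hlt := mul_add_lt hj h ht
          rw [Run.store_key hi hj.le (hlt.trans_le (pow_sub_le _)), Run.truth_ex hlt,
            ← List.map_drop, List.drop_range', intervalProd_map_range']
          have h1 : I * P.m + (0 + (t + 1) * 1) + (P.m - (t + 1)) = (I + 1) * P.m := by
            have := Nat.add_mul I 1 P.m
            omega
          have h2 : (I + 1) * P.m * P.m ^ j = (I + 1) * P.m ^ (j + 1) := by ring
          rw [h1, h2, intervalProd_mul]
          · congr 3; ring
          · rw [← h2]
            refine Nat.mul_le_mul_right _ ?_
            rw [← h1]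
            omega
          · calc (I + 1) * P.m ^ (j + 1) ≤ P.m ^ (P.J - (j + 1)) * P.m ^ (j + 1) :=
                Nat.mul_le_mul_right _ h
              _ = P.N := by rw [← pow_add]; congr 1; omega
        · rintro _ ⟨x, ⟨t, ht, rfl⟩, rfl⟩
          simp only [Set.mem_iUnion]
          exact ⟨t, List.mem_range.mpr ht, rfl⟩
      rcases hv' : e.view (P.key .ex i (j + 1) I) with _ | v
      · refine ensures_fetch_bind' fun v => key v (hv v fun hj' => ?_)
        rw [he.view (.inr ⟨hj', rfl⟩) (by simp) hi hj (h.trans_le (pow_sub_le _)),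
            Run.truth_ex h] at hv'
        cases hv'
      · exact ensures_fetch_bind hv' (key v (hv v fun _ => hv'))
    · rw [if_neg h, if_neg h]
      exact ensures_pure (by simpa using writes_nil)
  · have h : x < P.m ^ (P.J - j) := by
      by_contra h
      exact h0 (if_neg h)
    rw [pow_sub_eq hj] at h
    have hlt := Nat.div_lt_of_lt_mul h
    refine ⟨x / P.m, hlt.trans_le (pow_sub_succ_le j), ?_⟩
    rw [if_pos hlt]
    exact ⟨x % P.m, Nat.mod_lt _ P.m_pos, (Nat.div_add_mod' x P.m).symm⟩

/-- The sequence of parts of a subtree. -/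
def fetchParts (P : Params n) (i halt : ℕ) : ℕ → ℕ → P.Prc (List (ZMod P.p × ZMod P.p × Bool))
  | 0, _ => pure []
  | f + 1, q => if halt ≤ q then pure [] else
      fetch (P.key .up i 0 q) >>= fun u => fetch (P.key .ex i 0 q) >>= fun v =>
        match (toPart u * toPart v).e with
        | none => pure []
        | some e => if (e.1 : ℕ) < halt then fetchParts P i halt f (e.1 + 1) >>= fun l =>
            pure (((toPart u * toPart v).a, (toPart u * toPart v).b, e.2) :: l) else pure []

/-- The hashes of subtrees of class `i` at positions from `q` to `halt` are computed. -/
def putVals (P : Params n) (i halt : ℕ) (z : P.Val) : ℕ → ℕ → P.Prc Unit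
  | 0, _ => pure ()
  | f + 1, q => if halt ≤ q then pure () else
      get (P.key .lens 0 0 q) >>= fun o => match o with
        | none => putVals P i halt z f (q + 1)
        | some v => if Nat.log P.m (2 + v.1 + v.2.1.val) = i then
            fetchParts P i (q + (2 + v.1 + v.2.1.val)) (2 + v.1 + v.2.1.val) q >>= fun l =>
              put (P.key .val i 0 q) (ofPart ⟨BinTree.stackEval z.2.2.1 z.2.2.2.1 l, 0, none⟩) >>=
                fun _ => putVals P i halt z f (q + (2 + v.1 + v.2.1.val))
          else putVals P i halt z f (q + 1)

/-- The hashes of the subtrees of class `i` are computed. -/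
def valPhase (P : Params n) (i : ℕ) : Phase P where
  need := {(.lens, 0, 0), (.hash, 0, 0), (.up, i, 0), (.ex, i, 0)}
  give := {(.val, i, 0)}
  proc I := fetch (P.key .hash 0 0 0) >>= fun z => putVals P i ((I + 1) * P.m) z P.m (I * P.m)

lemma ensures_fetchParts {i : ℕ} (hi : i ≤ P.J) (he : R.Sees (valPhase P i).need e) {halt : ℕ}
    (hhalt : halt ≤ P.N) (f q : ℕ) : Ensures e (fetchParts P i halt f q)
      (2 * ((Seg.collect (fun q => intervalProd (R.wt i) q P.N) halt f q).length + 1))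
      fun l w => w = [] ∧ l = Seg.collect (fun q => intervalProd (R.wt i) q P.N) halt f q := by
  induction f generalizing q with
  | zero => exact ensures_pure ⟨rfl, rfl⟩
  | succ f ih =>
    by_cases h : halt ≤ q
    · rw [fetchParts, Seg.collect, if_pos h, if_pos h]
      exact ensures_pure ⟨rfl, rfl⟩
    · have hq : q < P.N := by omega
      have hq' : q < P.m ^ (P.J - 0) := hq
      have hu := (he.view (.inr (.inr (.inl rfl))) (by simp) hi (Nat.zero_le _) hq).trans
        (Run.truth_up hq')
      have hv := (he.view (.inr (.inr (.inr rfl))) (by simp) hi (Nat.zero_le _) hq).trans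
        (Run.truth_ex hq')
      have hmul : toPart (ofPart (intervalProd (R.wt i) (q * P.m ^ 0) ((q + 1) * P.m ^ 0))) *
          toPart (ofPart (intervalProd (R.wt i) ((q + 1) * P.m ^ 0) P.N)) =
          intervalProd (R.wt i) q P.N := by
        rw [toPart_ofPart, toPart_ofPart, pow_zero, mul_one, mul_one,
          intervalProd_mul _ (Nat.le_succ q) hq]
      rw [fetchParts, Seg.collect, if_neg h, if_neg h]
      rcases hz : (intervalProd (R.wt i) q P.N).e with _ | e'
      · refine Ensures.mono (ensures_fetch_bind hu (ensures_fetch_bind hv (c := 0) ?_)) (by simp)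
          fun _ _ h => h
        rw [hmul, hz]
        exact ensures_pure ⟨rfl, rfl⟩
      · simp only
        by_cases h' : (e'.1 : ℕ) < halt
        · rw [if_pos h']
          refine Ensures.mono (ensures_fetch_bind hu (ensures_fetch_bind hv ?_))
            (Nat.add_assoc _ 1 1).le fun _ _ h => h
          rw [hmul, hz]
          simp only
          rw [if_pos h']
          refine (ih (e'.1 + 1)).bind (c' := 0) ?_
          rintro _ _ ⟨rfl, rfl⟩
          exact ensures_pure ⟨rfl, rfl⟩
        · rw [if_neg h']
          refine Ensures.mono (ensures_fetch_bind hu (ensures_fetch_bind hv (c := 0) ?_)) (by simp)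
            fun _ _ h => h
          rw [hmul, hz]
          simp only
          rw [if_neg h']
          exact ensures_pure ⟨rfl, rfl⟩

lemma ensures_putVals_of_le {i halt f q : ℕ} {z : P.Val} (hq : halt ≤ q) :
    Ensures e (putVals P i halt z f q) 0 fun _ w => Writes R.store ∅ w := by
  cases f with
  | zero => exact ensures_pure writes_nil
  | succ f =>
    rw [putVals, if_pos hq]
    exact ensures_pure writes_nil

lemma ensures_putVals {i : ℕ} (hi : i ≤ P.J) (he : R.Sees (valPhase P i).need e) {halt : ℕ}
    (hhalt : halt ≤ P.N) (f q : ℕ) (hf : halt ≤ q + f) :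
    Ensures e (putVals P i halt (ofPart ⟨R.x, R.y, none⟩) f q) (5 * (halt - q) + (4 * P.m + 2))
      fun _ w => Writes R.store {K | ∃ q', q ≤ q' ∧ q' < halt ∧ R.truth .val i 0 q' ≠ none ∧
        BinTree.IsTop P.m (sub R.F) q' ∧ K = P.key .val i 0 q'} w := by
  have hempty : ∀ q, halt ≤ q → {K | ∃ q', q ≤ q' ∧ q' < halt ∧ R.truth .val i 0 q' ≠ none ∧
        BinTree.IsTop P.m (sub R.F) q' ∧ K = P.key .val i 0 q'} = ∅ := fun q hq => by
    rw [Set.eq_empty_iff_forall_notMem]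
    rintro K ⟨q', h1, h2, -⟩
    omega
  induction f generalizing q with
  | zero => exact ensures_pure (by rw [hempty q (by omega)]; exact writes_nil)
  | succ f ih =>
    rw [putVals]
    split_ifs with h
    · exact ensures_pure (by rw [hempty q h]; exact writes_nil)
    · have hq : q < P.N := by omega
      have hskip : R.truth .val i 0 q = none → Ensures e
          (putVals P i halt (ofPart ⟨R.x, R.y, none⟩) f (q + 1)) (5 * (halt - q) + (4 * P.m + 1))
          fun _ w => Writes R.store {K | ∃ q', q ≤ q' ∧ q' < halt ∧ R.truth .val i 0 q' ≠ none ∧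
            BinTree.IsTop P.m (sub R.F) q' ∧ K = P.key .val i 0 q'} w := fun h0 => by
        refine (ih (q + 1) (by omega)).mono (by omega) fun _ w hw => hw.mono ?_
        rintro K ⟨q', h1, h2, h3, h4⟩
        rcases eq_or_lt_of_le h1 with rfl | h1
        · exact absurd h0 h3
        · exact ⟨q', h1, h2, h3, h4⟩
      refine Ensures.mono (ensures_get_bind (c := 5 * (halt - q) + (4 * P.m + 1)) ?_) (by omega)
        fun _ _ h => h
      rw [he.view (.inl rfl) (by simp) (Nat.zero_le _) (Nat.zero_le _) hq]
      rcases hsub : sub R.F q with _ | ⟨v, l, r⟩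
      · rw [Run.truth_lens_none hsub]
        exact hskip (if_neg (by rw [hsub]; simp))
      · have hne : sub R.F q ≠ .nil := by rw [hsub]; simp
        have hlen := R.add_len_lt hne
        have hlen' : (sub R.F q).len = 2 + l.len + r.len := by rw [hsub]; rfl
        rw [Run.truth_lens hsub]
        have e1 : ((ofPair l.len r.len : P.Val).1 : ℕ) = l.len := ofPair_fst (by omega) _
        have e2 : (ofPair l.len r.len : P.Val).2.1.val = r.len := ZMod.val_natCast_of_lt (by omega)
        simp only [e1, e2, ← hlen']
        split_ifs with hlog
        · obtain ⟨h1, h2, h3⟩ := BinTree.stackEval_collect (x := R.x) (y := R.y)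
            (isTourArray_sub R.F) P.two_le_m hne hlog hlen.le (Z := fun q => intervalProd (R.wt i) q P.N)
            (fun _ _ => rfl) le_rfl
          have h4 : (Seg.collect (fun q => intervalProd (R.wt i) q P.N) (q + (sub R.F q).len)
              (sub R.F q).len q).length + 1 ≤ 2 * P.m := by
            have h5 : (sub R.F q).len < P.m ^ (i + 1) := by
              rw [← hlog]
              exact Nat.lt_pow_succ_log_self P.two_le_m _
            have h6 : 0 < P.m ^ i := pow_pos P.m_pos _
            refine Nat.le_of_mul_le_mul_right (c := P.m ^ i) ?_ h6
            calc _ ≤ 2 * (sub R.F q).len := h2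
              _ ≤ 2 * P.m ^ (i + 1) := by omega
              _ = _ := by ring
          have h5 := BinTree.len_pos hne
          set items := Seg.collect (fun q => intervalProd (R.wt i) q P.N) (q + (sub R.F q).len)
            (sub R.F q).len q with hitems
          have hput : R.store (P.key .val i 0 q) =
              some (ofPart ⟨(sub R.F q).ev R.x R.y, 0, none⟩) := by
            rw [Run.store_key hi (Nat.zero_le _) hq, Run.truth_val hne hlog]
          have hsplit : ∀ {w : List (P.Key × P.Val)}, Writes R.store {K | ∃ q',
              q + (sub R.F q).len ≤ q' ∧ q' < halt ∧ R.truth .val i 0 q' ≠ none ∧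
              BinTree.IsTop P.m (sub R.F) q' ∧ K = P.key .val i 0 q'} w → Writes R.store {K | ∃ q',
              q ≤ q' ∧ q' < halt ∧ R.truth .val i 0 q' ≠ none ∧
              BinTree.IsTop P.m (sub R.F) q' ∧ K = P.key .val i 0 q'} ((P.key .val i 0 q,
              ofPart ⟨(sub R.F q).ev R.x R.y, 0, none⟩) :: w) := fun hw => by
            refine (writes_cons hput hw).mono ?_
            rintro K ⟨q', g1, g2, g3, g4, rfl⟩
            rcases eq_or_lt_of_le g1 with rfl | g1
            · exact .inl rfl
            · refine .inr ⟨q', g4 q g1 hne ?_, g2, g3, g4, rfl⟩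
              have : sub R.F q' ≠ .nil ∧ Nat.log P.m (sub R.F q').len = i := by
                by_contra h
                exact g3 (if_neg h)
              rw [hlog, this.2]
          by_cases hle : halt ≤ q + (sub R.F q).len
          · refine ((ensures_fetchParts hi he hlen.le (sub R.F q).len q).bind (c' := 1) ?_).mono
              (by rw [← hitems]; omega) fun _ _ h => h
            rintro _ _ ⟨rfl, rfl⟩
            refine ensures_put_bind (c := 0) ?_
            rw [← hitems]
            refine Ensures.mono (ensures_putVals_of_le (R := R) hle) le_rfl fun _ w hw => ?_
            rw [← hempty _ hle] at hw
            have := hsplit hw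
            rw [← h1] at this
            exact this
          · refine ((ensures_fetchParts hi he hlen.le (sub R.F q).len q).bind
              (c' := 5 * (halt - (q + (sub R.F q).len)) + (4 * P.m + 2) + 1) ?_).mono
              (by rw [← hitems]; omega) fun _ _ h => h
            rintro _ _ ⟨rfl, rfl⟩
            refine ensures_put_bind ?_
            rw [← hitems]
            refine (ih _ (by omega)).mono le_rfl fun _ w hw => ?_
            have := hsplit hw
            rw [← h1] at this
            exact this
        · exact hskip (if_neg fun h => hlog h.2)

lemma works_valPhase {i : ℕ} (hi : i ≤ P.J) : (valPhase P i).Works R (9 * P.m + 3) := by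
  refine Phase.works_of rfl hi (Nat.zero_le _) (by simp)
    (fun I => {q | I * P.m ≤ q ∧ q < (I + 1) * P.m ∧ R.truth .val i 0 q ≠ none ∧
      BinTree.IsTop P.m (sub R.F) q}) (fun e he I hI => ?_) fun x hx h0 ht => ?_
  · refine Ensures.mono (ensures_fetch_bind ((he.view (.inr (.inl rfl)) (by simp) (Nat.zero_le _)
      (Nat.zero_le _) P.N_pos).trans Run.truth_hash) (ensures_putVals hi he ?_ P.m (I * P.m) ?_))
      ?_ fun _ w hw => hw.mono ?_
    · rw [P.N_eq, mul_comm P.m]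
      exact Nat.mul_le_mul_right _ hI
    · rw [add_mul, one_mul]
    · rw [add_mul, one_mul]
      omega
    · rintro _ ⟨q, ⟨h1, h2, h3, h4⟩, rfl⟩
      exact ⟨q, h1, h2, h3, h4, rfl⟩
  · have h := mem_block (P := P) (I := x / P.m) (x := x) |>.mpr rfl
    rw [block, List.mem_range'_1] at h
    exact ⟨x / P.m, div_lt_M hx, h.1, by rw [add_mul, one_mul]; exact h.2, h0, ht rfl⟩

/-- The slot of the hash of the roots. -/
def rootSlot (P : Params n) : Slot := (.val, Nat.log P.m (2 * n), 0)

/-- The procedure of the first machine in the last round. -/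
def lastRound (P : Params n) : P.Prc Bool :=
  fetch (P.key .val (Nat.log P.m (2 * n)) 0 (rootPos n false)) >>= fun u =>
    fetch (P.key .val (Nat.log P.m (2 * n)) 0 (rootPos n true)) >>= fun v =>
      pure (decide (u.2.2.1 ≠ v.2.2.1))

lemma ensures_lastRound {A : Set Slot} (he : R.Sees A e) (hA : rootSlot P ∈ A) :
    Ensures e (lastRound P) 2 fun a w => w = [] ∧
      a = decide ((R.F false).hash R.x R.y (R.F false).root ≠
        (R.F true).hash R.x R.y (R.F true).root) := by
  have hN := P.le_N
  have h : ∀ b, e.view (P.key .val (Nat.log P.m (2 * n)) 0 (rootPos n b)) =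
      some (ofPart ⟨(R.F b).hash R.x R.y (R.F b).root, 0, none⟩) := fun b => by
    have hne : sub R.F (rootPos n b) ≠ .nil := by
      intro h
      have := sub_rootPos_len R.F b
      rw [h] at this
      have h2 := (R.F b).root.2
      change 0 = 2 * n at this
      omega
    have hlt : rootPos n b < P.N := by
      have := R.add_len_lt hne
      omega
    rw [he.view_val hA (Run.log_lt (by omega)).le hlt (isTop_rootPos R.F P.m b),
      Run.truth_val hne (by rw [sub_rootPos_len]), sub_rootPos, LabeledRootedTree.ev_encode_root]
  exact ensures_fetch_bind (h false) (ensures_fetch_bind (h true) (c := 0)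
    (ensures_pure ⟨rfl, rfl⟩))

end TreeIso

/-! ### The program -/

namespace TreeIso

open AMPC AMPC.Proc TreePair CycleContraction Params

variable {n : ℕ} {P : Params n}

/-- The phases in which the hashes of the subtrees of class `i` are computed. -/
def stage (P : Params n) (i : ℕ) : List (Phase P) :=
  [weightPhase P i] ++ ((List.range P.J).map (upPhase P i) ++
    ((List.range P.J).map (fun j => downPhase P i (P.J - 1 - j)) ++ [valPhase P i]))

/-- The phases between the first and the last round. -/
noncomputable def phases (P : Params n) : List (Phase P) :=
  [tourPhase P] ++ ((List.range P.J).map (lup P) ++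
    ((List.range P.J).map (fun j => ldown P (P.J - 1 - j)) ++ ([lensPhase P] ++
      (List.range P.J).flatMap (stage P))))

lemma length_phases : (phases P).length = 2 + 2 * P.J + P.J * (2 * P.J + 2) := by
  simp [phases, stage, List.length_flatMap]
  ring

lemma valid_stage {A : Set Slot} {i : ℕ} (h1 : (.lens, 0, 0) ∈ A) (h2 : (.hash, 0, 0) ∈ A)
    (h3 : ∀ i' < i, (.val, i', 0) ∈ A) : Valid A (stage P i) := by
  have hJ := P.one_le_J
  refine valid_append ⟨?_, trivial⟩ (valid_append (valid_map_range _ _ ?_)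
    (valid_append (valid_map_range _ _ ?_) ⟨?_, trivial⟩))
  · rintro s (rfl | rfl | ⟨i', hi', rfl⟩)
    · exact h1
    · exact h2
    · exact h3 i' hi'
  · rintro j hj s rfl
    refine ⟨by simp, ?_⟩
    rcases j with _ | j
    · exact .inl (mem_foldl_after (by simp) (.inr ⟨_, List.mem_cons_self, rfl⟩))
    · exact .inr ⟨j, by omega, rfl⟩
  · rintro j hj s (rfl | ⟨h4, rfl⟩)
    · refine ⟨by simp, .inl (mem_foldl_after (by simp) ?_)⟩
      rcases hj' : P.J - 1 - j with _ | k
      · exact .inl (mem_foldl_after (by simp) (.inr ⟨_, List.mem_cons_self, rfl⟩))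
      · exact .inr ⟨_, List.mem_map.mpr ⟨k, List.mem_range.mpr (by omega), rfl⟩, rfl⟩
    · refine ⟨by simp, .inr ⟨j - 1, by omega, ?_⟩⟩
      have : P.J - 1 - (j - 1) = P.J - 1 - j + 1 := by omega
      rw [this]
      rfl
  · rintro s (rfl | rfl | rfl | rfl)
    · exact mem_foldl_after (by simp) (.inl (mem_foldl_after (by simp) (.inl
        (mem_foldl_after (by simp) (.inl h1)))))
    · exact mem_foldl_after (by simp) (.inl (mem_foldl_after (by simp) (.inl
        (mem_foldl_after (by simp) (.inl h2)))))
    · exact mem_foldl_after (by simp) (.inl (mem_foldl_after (by simp) (.inl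
        (mem_foldl_after (by simp) (.inr ⟨_, List.mem_cons_self, rfl⟩)))))
    · refine mem_foldl_after (by simp) (.inr ⟨_, List.mem_map.mpr ⟨P.J - 1,
        List.mem_range.mpr (by omega), rfl⟩, ?_⟩)
      rw [Nat.sub_self]
      rfl

lemma mem_stage_val (i : ℕ) : ∃ φ ∈ stage P i, ((.val, i, 0) : Slot) ∈ φ.give :=
  ⟨valPhase P i, by simp [stage], rfl⟩

lemma valid_stages {A : Set Slot} (h1 : (.lens, 0, 0) ∈ A) (h2 : (.hash, 0, 0) ∈ A) (k : ℕ) :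
    Valid A ((List.range k).flatMap (stage P)) := by
  induction k with
  | zero => trivial
  | succ k ih =>
    rw [List.range_succ, List.flatMap_append, List.flatMap_singleton]
    refine valid_append ih (valid_stage (mem_foldl_after (by simp) (.inl h1))
      (mem_foldl_after (by simp) (.inl h2)) fun i hi => mem_foldl_after (by simp) (.inr ?_))
    obtain ⟨φ, h3, h4⟩ := mem_stage_val (P := P) i
    exact ⟨φ, List.mem_flatMap.mpr ⟨i, List.mem_range.mpr hi, h3⟩, h4⟩

lemma valid_phases : Valid (firstSlots P) (phases P) := by
  have hJ := P.one_le_J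
  refine valid_append ⟨?_, trivial⟩ (valid_append (valid_map_range _ _ ?_)
    (valid_append (valid_map_range _ _ ?_) (valid_append ⟨?_, trivial⟩ (valid_stages ?_ ?_ _))))
  · rintro s (rfl | ⟨b, hb⟩)
    · exact .inl rfl
    · exact .inr (.inl ⟨b, hb⟩)
  · rintro j hj s (rfl | rfl)
    · refine ⟨by simp, ?_⟩
      rcases j with _ | j
      · exact .inl (mem_foldl_after (by simp) (.inr ⟨_, List.mem_cons_self, rfl⟩))
      · exact .inr ⟨j, by omega, rfl⟩
    · exact ⟨by simp, .inl (mem_foldl_after (by simp)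
        (.inl (.inr (.inr (.inl ⟨j, hj, rfl⟩)))))⟩
  · rintro j hj s (rfl | rfl | rfl)
    · refine ⟨by simp, .inl (mem_foldl_after (by simp) ?_)⟩
      rcases hj' : P.J - 1 - j with _ | k
      · exact .inl (mem_foldl_after (by simp) (.inr ⟨_, List.mem_cons_self, rfl⟩))
      · exact .inr ⟨_, List.mem_map.mpr ⟨k, List.mem_range.mpr (by omega), rfl⟩, rfl⟩
    · exact ⟨by simp, .inl (mem_foldl_after (by simp) (.inl (mem_foldl_after (by simp)
        (.inl (.inr (.inr (.inl ⟨P.J - 1 - j, by omega, rfl⟩)))))))⟩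
    · refine ⟨by simp, ?_⟩
      rcases j with _ | j
      · have : P.J - 1 - 0 + 1 = P.J := by omega
        rw [this]
        exact .inl (mem_foldl_after (by simp) (.inl (mem_foldl_after (by simp)
          (.inl (.inr (.inr (.inr (.inl rfl))))))))
      · refine .inr ⟨j, by omega, ?_⟩
        have : P.J - 1 - j = P.J - 1 - (j + 1) + 1 := by omega
        rw [this]
        rfl
  · rintro s (rfl | ⟨b, hb⟩)
    · refine mem_foldl_after (by simp) (.inr ⟨_, List.mem_map.mpr ⟨P.J - 1,
        List.mem_range.mpr (by omega), rfl⟩, ?_⟩)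
      rw [Nat.sub_self]
      rfl
    · have hs : s ≠ (.trie, 0, 0) := by
        rcases hb with rfl | rfl <;> simp
      exact mem_foldl_after hs (.inl (mem_foldl_after hs (.inl (mem_foldl_after hs
        (.inl (.inr (.inl ⟨b, hb⟩)))))))
  · exact mem_foldl_after (by simp) (.inr ⟨_, List.mem_cons_self, rfl⟩)
  · exact mem_foldl_after (by simp) (.inl (mem_foldl_after (by simp) (.inl (mem_foldl_after
      (by simp) (.inl (mem_foldl_after (by simp)
        (.inl (.inr (.inr (.inr (.inr rfl)))))))))))

lemma rootSlot_mem : rootSlot P ∈ (phases P).foldl after (firstSlots P) := by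
  have hN := P.le_N
  obtain ⟨φ, h1, h2⟩ := mem_stage_val (P := P) (Nat.log P.m (2 * n))
  refine mem_foldl_after (by simp [rootSlot]) (.inr ⟨φ, ?_, h2⟩)
  simp only [phases, List.mem_append, List.mem_flatMap]
  exact .inr (.inr (.inr (.inr ⟨_, List.mem_range.mpr (Run.log_lt (by omega)), h1⟩)))

/-- The number of steps in which a machine can follow a phase. -/
def phaseSteps (P : Params n) : ℕ := 3 * P.L + P.m * (2 * P.H + 12) + 2 * P.J + 4

lemma Phase.Works.mono {φ : Phase P} {R : Run P} {S S' : ℕ} (h : φ.Works R S) (hS : S ≤ S') :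
    φ.Works R S' := by
  obtain ⟨O, h1, h2⟩ := h
  exact ⟨O, fun e he I hI => (h1 e he I hI).mono hS fun _ _ h => h, h2⟩

lemma works_stage (R : Run P) {i : ℕ} (hi : i ≤ P.J) {φ : Phase P} (hφ : φ ∈ stage P i) :
    φ.Works R (phaseSteps P) := by
  have hJ := P.one_le_J
  have hm := P.m_pos
  have h1 : P.m * (2 * P.H + 12) = 2 * (P.m * P.H) + 12 * P.m := by ring
  simp only [stage, List.mem_append, List.mem_singleton, List.mem_map, List.mem_range] at hφ
  rcases hφ with rfl | ⟨j, hj, rfl⟩ | ⟨j, hj, rfl⟩ | rfl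
  · exact (works_weightPhase hi).mono (by rw [phaseSteps]; omega)
  · exact (works_upPhase hi hj).mono (by rw [phaseSteps]; omega)
  · exact (works_downPhase hi (by omega)).mono (by rw [phaseSteps]; omega)
  · exact (works_valPhase hi).mono (by rw [phaseSteps]; omega)

lemma works_phases (R : Run P) {φ : Phase P} (hφ : φ ∈ phases P) :
    φ.Works R (phaseSteps P) := by
  have hJ := P.one_le_J
  have hm := P.m_pos
  have h1 : P.m * (2 * P.H + 12) = 2 * (P.m * P.H) + 12 * P.m := by ring
  have h2 : P.m * (2 * P.H + 4) = 2 * (P.m * P.H) + 4 * P.m := by ring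
  simp only [phases, List.mem_append, List.mem_singleton, List.mem_map, List.mem_range,
    List.mem_flatMap] at hφ
  rcases hφ with rfl | ⟨j, hj, rfl⟩ | ⟨j, hj, rfl⟩ | rfl | ⟨i, hi, hφ⟩
  · exact works_tourPhase.mono (by rw [phaseSteps]; omega)
  · exact (works_lup hj).mono (by rw [phaseSteps]; omega)
  · exact (works_ldown (by omega)).mono (by rw [phaseSteps]; omega)
  · exact works_lensPhase.mono (by rw [phaseSteps]; omega)
  · exact works_stage R hi.le hφ

/-- The program. -/
noncomputable def program (P : Params n) :
    ProcProgram (Bool × Fin n) (Fin n) P.Key P.Val where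
  rounds := (phases P).length + 2
  machines := P.M
  memory := phaseSteps P + 13 * ((P.J + 1) * ((P.J + 1) * P.m)) * 2
  wordSize := max (Nat.card (Answer (Fin n) P.Val P.D)) (max (Nat.card P.Key) (Nat.card P.Val))
  drawSize := P.D
  machines_pos := P.M_pos
  finite_input := inferInstance
  finite_key := inferInstance
  finite_val := inferInstance
  card_answer := le_max_left _ _
  card_key := (le_max_left _ _).trans (le_max_right _ _)
  card_val := (le_max_right _ _).trans (le_max_right _ _)
  proc t I := if t = 0 then firstRound P I
    else if h : t - 1 < (phases P).length then (phases P)[t - 1].keeping I else lastRound P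

/-- The seeds of the program. -/
abbrev Coins (P : Params n) : Type := (program P).toProgram.Seed

lemma lt_memory {s : ℕ} (hs : s < P.J + 2) : s < (program P).memory := by
  change s < phaseSteps P + _
  rw [phaseSteps]
  omega

/-- A draw in the first round. -/
noncomputable def draw (ω : Coins P) (e s : ℕ) (b : Fin P.D) (he : e < P.M) (hs : s < P.J + 2) :
    Fin (b + 1) :=
  ω ⟨0, Nat.succ_pos _⟩ ⟨e, he⟩ ⟨s, lt_memory hs⟩ (b.castLE (program P).drawSize_le)

/-- The sampled numbers. -/
noncomputable def sample (ω : Coins P) (j e : ℕ) : ℕ :=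
  if h : j < P.J ∧ e < P.M then draw ω e j (sampleBound P) h.2 (by omega) else 0

/-- The coordinates of the point of evaluation. -/
noncomputable def point (ω : Coins P) (c : Fin 2) : ZMod P.p :=
  ((draw ω 0 (P.J + c) (pointBound P) P.M_pos (by omega) : ℕ) : ZMod P.p)

lemma sample_lt (ω : Coins P) (j e : ℕ) : sample ω j e < P.m := by
  have := P.m_pos
  unfold sample
  split_ifs with h
  · refine lt_of_lt_of_le (draw ω e j (sampleBound P) h.2 (by omega)).2 ?_
    change P.m - 1 + 1 ≤ P.m
    omega
  · exact this

/-- The run of the algorithm with some seed. -/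
noncomputable def runOf (F : Bool → LabeledRootedTree n) (ω : Coins P)
    (hg : ∀ j < P.J, Good P.m P.L (P.m ^ (P.J - j)) (level P.m (succId F P.N) (sample ω) j)
      (sample ω j)) : Run P where
  F := F
  r := sample ω
  x := point ω 0
  y := point ω 1
  r_lt := sample_lt ω
  good := hg

lemma coin_env {inp : Bool × Fin n → Option (Fin n)} {ω : Coins P} {t : Fin (program P).rounds}
    (ht : (t : ℕ) = 0) {I : Fin (program P).machines} {view : P.Key → Option P.Val} {s : ℕ}
    (hs : s < P.J + 2) (b : Fin P.D) :
    (((program P).env inp ω t I view).coin s b : ℕ) = draw ω I s b I.2 hs := by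
  obtain rfl : t = ⟨0, Nat.succ_pos _⟩ := Fin.ext ht
  have h : ((program P).env inp ω ⟨0, Nat.succ_pos _⟩ I view).coin s b = _ :=
    dif_pos (lt_memory hs)
  rw [h]
  rfl

theorem run_program (F : Bool → LabeledRootedTree n) (ω : Coins P)
    (hg : ∀ j < P.J, Good P.m P.L (P.m ^ (P.J - j)) (level P.m (succId F P.N) (sample ω) j)
      (sample ω j)) (tab : ℕ → Option ℕ) (σ : (program P).toProgram.Ordering) :
    (program P).toProgram.run ((F false).pairInput (F true)) tab σ ω =
      decide ((F false).hash (point ω 0) (point ω 1) (F false).root ≠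
        (F true).hash (point ω 0) (point ω 1) (F true).root) := by
  set R := runOf F ω hg with hR
  set A : ℕ → Set Slot := fun t => ((phases P).take t).foldl after (firstSlots P) with hA
  have hinp : ∀ b v, (F false).pairInput (F true) (b, v) =
      if v = (R.F b).root then none else some ((R.F b).parent v) := by
    rintro (_ | _) v <;> rfl
  have hmem : (program P).memory = phaseSteps P + (kept P 0).length * 2 := by
    rw [length_kept]
    rfl
  refine ProcProgram.run_eq _ tab σ ω R.store
    (fun t => if 0 < t ∧ t ≤ (phases P).length + 1 then R.keys (A (t - 1)) else ∅) (by simp)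
    (Nat.succ_pos _) (fun t view hview => ?_) _ fun t view ht hview => ?_
  · have ht := t.2
    change (t : ℕ) < (phases P).length + 2 at ht
    have hproc : ∀ I, (program P).proc t I = if (t : ℕ) = 0 then firstRound P I
      else if h : (t : ℕ) - 1 < (phases P).length then (phases P)[(t : ℕ) - 1].keeping I
      else lastRound P := fun I => rfl
    by_cases h0 : (t : ℕ) = 0
    · have hspec := fun I : Fin (program P).machines => firstRound_spec (R := R)
        (e := (program P).env ((F false).pairInput (F true)) ω t I view) (I := I) I.2
        (fun b v => by
          rw [ProcProgram.env]
          simp only [if_pos h0]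
          exact hinp b v)
        (fun j hj => by
          rw [coin_env h0 (by omega)]
          exact dif_pos ⟨hj, I.2⟩)
        (fun hI => by
          rw [coin_env h0 (by omega)]
          obtain rfl : I = ⟨0, P.M_pos⟩ := Fin.ext hI
          rfl)
        (fun hI => by
          rw [coin_env h0 (by omega)]
          obtain rfl : I = ⟨0, P.M_pos⟩ := Fin.ext hI
          rfl)
      simp only [hproc, if_pos h0]
      refine ⟨fun I => ⟨(hspec I).1.trans ?_, (hspec I).2.1⟩, fun k hk v hv => ?_⟩
      · have h1 : P.m * (2 * P.H + 12) = 2 * (P.m * P.H) + 12 * P.m := by ring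
        have h2 : P.m * (P.H + 4) = P.m * P.H + 4 * P.m := by ring
        rw [hmem, phaseSteps]
        omega
      · rw [if_pos ⟨by omega, by omega⟩, h0] at hk
        obtain ⟨I, hI, h1⟩ := firstRound_cover hk (by rw [hv]; simp)
        exact ⟨⟨I, hI⟩, (hspec ⟨I, hI⟩).2.2 k h1 v hv⟩
    · by_cases h1 : (t : ℕ) - 1 < (phases P).length
      · rw [if_pos ⟨by omega, by omega⟩] at hview
        have hneed := valid_phases.getElem h1
        have hw := works_phases R (List.getElem_mem h1)
        simp only [hproc, if_neg h0, dif_pos h1]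
        obtain ⟨O, hO1, hO2⟩ := hw.keeping hneed
        have hspec := fun I : Fin (program P).machines => hO1
          ((program P).env ((F false).pairInput (F true)) ω t I view) hview I I.2 0
        refine ⟨fun I => ⟨(hspec I).1.trans ?_, (hspec I).2.1⟩, fun k hk v hv => ?_⟩
        · rw [hmem, length_kept, length_kept, zero_add]
        · rw [if_pos ⟨by omega, by omega⟩] at hk
          have hk' : k ∈ R.keys (after (A ((t : ℕ) - 1)) (phases P)[(t : ℕ) - 1]) := by
            simp only [hA]
            rw [← foldl_after_take h1]
            have : (t : ℕ) - 1 + 1 = (t : ℕ) + 1 - 1 := by omega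
            rw [this]
            exact hk
          obtain ⟨I, hI, h2⟩ := hO2 k hk' (by rw [hv]; simp)
          exact ⟨⟨I, hI⟩, (hspec ⟨I, hI⟩).2.2 k h2 v hv⟩
      · have hfin := fun I : Fin (program P).machines => ensures_lastRound (R := R)
          (A := (phases P).foldl after (firstSlots P))
          (e := (program P).env ((F false).pairInput (F true)) ω t I view) (by
            rw [if_pos ⟨by omega, by omega⟩] at hview
            have : A ((t : ℕ) - 1) = (phases P).foldl after (firstSlots P) := by
              simp only [hA]
              rw [List.take_of_length_le (by omega)]
            rw [this] at hview
            exact hview) rootSlot_mem 0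
        simp only [hproc, if_neg h0, dif_neg h1]
        refine ⟨fun I => ⟨(hfin I).1.trans ?_, ?_⟩, fun k hk => ?_⟩
        · rw [hmem, phaseSteps]
          omega
        · exact fun kv hkv => (List.eq_nil_iff_forall_not_mem.mp (hfin I).2.1 kv hkv).elim
        · rw [if_neg (by omega)] at hk
          cases hk
  · have ht' : (t : ℕ) = (phases P).length + 1 := ht
    rw [if_pos ⟨by omega, by omega⟩] at hview
    have hproc : (program P).proc t ⟨0, P.M_pos⟩ = lastRound P := by
      change (if (t : ℕ) = 0 then firstRound P _
        else if h : (t : ℕ) - 1 < (phases P).length then (phases P)[(t : ℕ) - 1].keeping _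
        else lastRound P) = _
      rw [if_neg (by omega), dif_neg (by omega)]
    have hfin := ensures_lastRound (R := R) (A := (phases P).foldl after (firstSlots P))
      (e := (program P).env ((F false).pairInput (F true)) ω t ⟨0, P.M_pos⟩ view) (by
        have : A ((t : ℕ) - 1) = (phases P).foldl after (firstSlots P) := by
          simp only [hA]
          rw [List.take_of_length_le (by omega)]
        rw [this] at hview
        exact hview) rootSlot_mem 0
    change (exec _ 0 ((program P).proc t ⟨0, P.M_pos⟩)).1 = _
    rw [hproc]
    exact hfin.2.2

end TreeIso

/-! ### The error probability -/

lemma natCard_subtype {ι : Type*} [Fintype ι] (p : ι → Prop) [DecidablePred p] :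
    Nat.card {x // p x} = (Finset.univ.filter p).card := by
  rw [Nat.card_eq_fintype_card, Fintype.card_subtype]

namespace AMPC.Program

variable {Q A : Type} (M : Program Q A)

/-- The places of the draws. -/
abbrev DrawIndex : Type :=
  Fin M.rounds × Fin M.machines × Fin M.memory × Fin M.wordSize

variable {M}

/-- The outcome of a draw. -/
def Seed.at (ω : M.Seed) (i : M.DrawIndex) : Fin (i.2.2.2 + 1) := ω i.1 i.2.1 i.2.2.1 i.2.2.2

variable (M)

/-- A seed as a family of draws. -/
def seedEquiv : M.Seed ≃ ((i : M.DrawIndex) → Fin (i.2.2.2 + 1)) where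
  toFun ω i := Seed.at ω i
  invFun f t i s b := f (t, i, s, b)
  left_inv _ := rfl
  right_inv _ := rfl

/-- An event has a small probability if it has a small probability for all outcomes of the other
draws, where the draws in question are from `{0, …, d - 1}`. -/
lemma card_seed_le {κ : Type} [Finite κ] (g : κ → M.DrawIndex) (hg : Function.Injective g) (d : ℕ)
    (hd : ∀ k, ((g k).2.2.2 : ℕ) + 1 = d) (E : M.Seed → Prop) (c : ℝ)
    (h : ∀ ω : M.Seed, (Nat.card {η : κ → Fin d // ∃ ω' : M.Seed, E ω' ∧
      (∀ k, (Seed.at ω' (g k) : ℕ) = η k) ∧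
        ∀ i, (∀ k, g k ≠ i) → Seed.at ω' i = Seed.at ω i} : ℝ) ≤ c * Nat.card (κ → Fin d)) :
    (Nat.card {ω // E ω} : ℝ) ≤ c * Nat.card M.Seed := by
  classical
  have := Fintype.ofFinite κ
  have h1 := card_filter_le_of_fibers (β := fun i : M.DrawIndex => Fin (i.2.2.2 + 1)) g hg
    (fun f => E (M.seedEquiv.symm f)) c fun f => by
      refine le_trans ?_ ((h (M.seedEquiv.symm f)).trans_eq ?_)
      · rw [← natCard_subtype]
        refine Nat.cast_le.mpr (Nat.card_le_card_of_injective (fun η =>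
          ⟨fun k => finCongr (hd k) (η.1 k), ?_⟩) fun η η' hη => ?_)
        · obtain ⟨f', h2, h3, h4⟩ := η.2
          exact ⟨M.seedEquiv.symm f', h2, fun k => congrArg Fin.val (h3 k), h4⟩
        · refine Subtype.ext (funext fun k => ?_)
          exact (finCongr (hd k)).injective (congrFun (congrArg Subtype.val hη) k)
      · rw [← Nat.card_eq_fintype_card,
          Nat.card_congr (Equiv.piCongrRight fun k => finCongr (hd k))]
  rw [Nat.card_congr M.seedEquiv, Nat.card_congr (M.seedEquiv.subtypeEquiv
    (q := fun f => E (M.seedEquiv.symm f)) fun ω => by rw [Equiv.symm_apply_apply]),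
    natCard_subtype, Nat.card_eq_fintype_card]
  convert h1

lemma finite_seed : Finite M.Seed := Finite.of_equiv _ M.seedEquiv.symm

end AMPC.Program

namespace TreeIso

open AMPC AMPC.Proc TreePair CycleContraction Params

variable {n : ℕ} {P : Params n}

/-- The place of a draw in the first round. -/
noncomputable def drawIndex (P : Params n) (e s : ℕ) (b : Fin P.D) (he : e < P.M)
    (hs : s < P.J + 2) : (program P).toProgram.DrawIndex :=
  (⟨0, Nat.succ_pos _⟩, ⟨e, he⟩, ⟨s, lt_memory hs⟩, b.castLE (program P).drawSize_le)

lemma draw_eq (ω : Coins P) {e s : ℕ} {b : Fin P.D} (he : e < P.M) (hs : s < P.J + 2) :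
    draw ω e s b he hs = Program.Seed.at ω (drawIndex P e s b he hs) := rfl

lemma sample_congr {ω ω' : Coins P} {j : ℕ} (hj : j < P.J)
    (h : ∀ e, (he : e < P.M) → Program.Seed.at ω (drawIndex P e j (sampleBound P) he (by omega)) =
      Program.Seed.at ω' (drawIndex P e j (sampleBound P) he (by omega))) :
    sample ω j = sample ω' j := by
  funext e
  unfold sample
  by_cases he : e < P.M
  · rw [dif_pos ⟨hj, he⟩, dif_pos ⟨hj, he⟩, draw_eq, draw_eq, h e he]
  · rw [dif_neg fun h => he h.2, dif_neg fun h => he h.2]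

/-- The contractions with the samples of a seed. -/
noncomputable abbrev levelOf (F : Bool → LabeledRootedTree n) (ω : Coins P) (j : ℕ) : ℕ → ℕ :=
  level P.m (succId F P.N) (sample ω) j

/-- The contraction at level `j` succeeds. -/
def GoodAt (F : Bool → LabeledRootedTree n) (ω : Coins P) (j : ℕ) : Prop :=
  Good P.m P.L (P.m ^ (P.J - j)) (levelOf F ω j) (sample ω j)

lemma card_miss_le (F : Bool → LabeledRootedTree n) {j i : ℕ} (hj : j < P.J)
    (hi : i < P.m ^ (P.J - j)) :
    (Nat.card {ω : Coins P // (∀ j' < j, GoodAt F ω j') ∧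
      ∀ k, 1 ≤ k → k ≤ P.L → ¬ Sampled P.m (sample ω j) ((levelOf F ω j)^[k] i)} : ℝ) ≤
      Real.exp (-((P.L : ℝ) / P.m)) * Nat.card (Coins P) := by
  classical
  have hm : P.m - 1 + 1 = P.m := by have := P.m_pos; omega
  have hinj : Function.Injective fun e : Fin P.M =>
      drawIndex P e j (sampleBound P) e.2 (by omega) := fun e e' h => by
    have := congrArg (fun i : (program P).toProgram.DrawIndex => (i.2.1 : ℕ)) h
    exact Fin.ext this
  refine Program.card_seed_le _ _ hinj P.m (fun _ => hm) _ _ fun ω => ?_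
  have hsame : ∀ ω' : Coins P, (∀ i, (∀ e : Fin P.M, drawIndex P e j (sampleBound P) e.2
      (by omega) ≠ i) → Program.Seed.at ω' i = Program.Seed.at ω i) →
      ∀ j' < j, sample ω' j' = sample ω j' := fun ω' h6 j' hj' =>
    sample_congr (by omega) fun e he => h6 _ fun e' h => by
      have := congrArg (fun i : (program P).toProgram.DrawIndex => (i.2.2.1 : ℕ)) h
      change j = j' at this
      omega
  by_cases hgood : ∀ j' < j, GoodAt F ω j'
  · have htr : Transitive (levelOf F ω j) (P.m ^ (P.J - j)) :=
      transitive_level (sample_lt ω) ⟨fun _ hi => succId_lt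
        ((by omega : 4 * n + 3 ≤ 4 * n + 4).trans P.le_N) hi, fun _ hi _ hj =>
          exists_iterate_succId ((by omega : 4 * n + 3 ≤ 4 * n + 4).trans P.le_N) hi hj⟩ hj.le hgood
    rw [pow_sub_eq hj] at htr hi
    have hmiss := card_not_hit_le P.m_pos htr (pow_sub_succ_le j) hi P.L
    rw [← natCard_subtype, ← Nat.card_eq_fintype_card] at hmiss
    refine le_trans (Nat.cast_le.mpr (Nat.card_mono (Set.toFinite _) fun η hη => ?_)) hmiss
    obtain ⟨ω', ⟨h3, h4⟩, h5, h6⟩ := hη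
    have hlev : levelOf F ω' j = levelOf F ω j := level_congr (hsame ω' h6)
    have hsam : ∀ e < P.M, sample ω' j e = ofChoices P.m_pos η e := fun e he => by
      rw [sample, dif_pos ⟨hj, he⟩, draw_eq, ofChoices, dif_pos he]
      exact h5 ⟨e, he⟩
    intro k hk1 hk2 hs
    refine h4 k hk1 hk2 ?_
    rw [hlev]
    have hlt : (levelOf F ω j)^[k] i / P.m < P.M :=
      (Nat.div_lt_of_lt_mul (iterate_lt htr.1 hi k)).trans_le (pow_sub_succ_le j)
    unfold Sampled at hs ⊢
    rw [hsam _ hlt]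
    exact hs
  · refine le_of_eq_of_le ?_ (by positivity)
    rw [Nat.cast_eq_zero, Nat.card_eq_zero]
    refine Or.inl ⟨?_⟩
    rintro ⟨η, ω', ⟨h3, -⟩, -, h6⟩
    refine hgood fun j' hj' => ?_
    have := h3 j' hj'
    unfold GoodAt levelOf at this ⊢
    rw [level_congr fun j'' h'' => hsame ω' h6 j'' (by omega), hsame ω' h6 j' hj'] at this
    exact this

lemma card_collision_le (T T' : LabeledRootedTree n) (h : ¬ T.Isomorphic T') :
    (Nat.card {ω : Coins P // T.hash (point ω 0) (point ω 1) T.root =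
      T'.hash (point ω 0) (point ω 1) T'.root} : ℝ) ≤ n / P.p * Nat.card (Coins P) := by
  classical
  have hp : P.p - 1 + 1 = P.p := by have := P.prime_p.pos; omega
  have hinj : Function.Injective fun c : Fin 2 =>
      drawIndex P 0 (P.J + c) (pointBound P) P.M_pos (by omega) := fun c c' h => by
    have := congrArg (fun i : (program P).toProgram.DrawIndex => (i.2.2.1 : ℕ)) h
    change P.J + (c : ℕ) = P.J + c' at this
    exact Fin.ext (by omega)
  refine Program.card_seed_le _ _ hinj P.p (fun _ => hp) _ _ fun ω => ?_
  have h1 := LabeledRootedTree.card_hash_eq_le T T' (ZMod P.p) h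
  rw [ZMod.card, ← natCard_subtype, ← Nat.card_eq_fintype_card] at h1
  have hcard : Nat.card (Fin 2 → Fin P.p) = Nat.card (Fin 2 → ZMod P.p) := by
    rw [Nat.card_fun, Nat.card_fun, Nat.card_fin, Nat.card_zmod]
  rw [hcard]
  refine le_trans (Nat.cast_le.mpr (Nat.card_le_card_of_injective
    (fun η => ⟨fun c => ((η.1 c : ℕ) : ZMod P.p), ?_⟩) fun η η' hηη => ?_)) h1
  rotate_left
  · obtain ⟨ω', h3, h4, -⟩ := η.2
    beta_reduce
    rw [← h4 0, ← h4 1]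
    exact h3
  · refine Subtype.ext (funext fun c => ?_)
    have := congrFun (congrArg Subtype.val hηη) c
    simp only at this
    rw [ZMod.natCast_eq_natCast_iff', Nat.mod_eq_of_lt (η.1 c).2,
      Nat.mod_eq_of_lt (η'.1 c).2] at this
    exact Fin.ext this

/-- The trees of an input. -/
def pair (T T' : LabeledRootedTree n) (b : Bool) : LabeledRootedTree n := if b then T' else T

theorem errorProb_le (T T' : LabeledRootedTree n) (tab : ℕ → Option ℕ)
    (σ : (program P).toProgram.Ordering) :
    (program P).toProgram.errorProb (T.pairInput T') tab σ (¬ T.Isomorphic T') ≤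
      P.J * P.N * Real.exp (-((P.L : ℝ) / P.m)) + n / P.p := by
  classical
  set B : Coins P → Prop := fun ω => ¬ ((program P).toProgram.run (T.pairInput T') tab σ ω = true ↔
    ¬ T.Isomorphic T') with hB
  set E : Fin P.J × Fin P.N → Coins P → Prop := fun x ω => (x.2 : ℕ) < P.m ^ (P.J - x.1) ∧
    (∀ j' < (x.1 : ℕ), GoodAt (pair T T') ω j') ∧ ∀ k, 1 ≤ k → k ≤ P.L →
      ¬ Sampled P.m (sample ω x.1) ((levelOf (pair T T') ω x.1)^[k] x.2) with hE
  set E' : Coins P → Prop := fun ω => ¬ T.Isomorphic T' ∧ T.hash (point ω 0) (point ω 1) T.root =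
      T'.hash (point ω 0) (point ω 1) T'.root with hE'
  have := Program.finite_seed (program P).toProgram
  have hsub : {ω | B ω} ⊆ (⋃ x, {ω | E x ω}) ∪ {ω | E' ω} := by
    intro ω hω
    simp only [Set.mem_union, Set.mem_iUnion, Set.mem_ofPred_eq] at hω ⊢
    by_cases hgood : ∀ j < P.J, GoodAt (pair T T') ω j
    · right
      have hrun := run_program (pair T T') ω hgood tab σ
      change (program P).toProgram.run (T.pairInput T') tab σ ω = decide
        (T.hash (point ω 0) (point ω 1) T.root ≠ T'.hash (point ω 0) (point ω 1) T'.root) at hrun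
      rw [hB, hrun, decide_eq_true_iff] at hω
      by_cases hiso : T.Isomorphic T'
      · exact absurd (iff_of_false (not_not.mpr (LabeledRootedTree.hash_eq_of_isomorphic hiso _ _))
          (not_not.mpr hiso)) hω
      · refine ⟨hiso, ?_⟩
        by_contra h
        exact hω (iff_of_true h hiso)
    · left
      obtain ⟨j, h1, h2, h3⟩ : ∃ j < P.J, ¬ GoodAt (pair T T') ω j ∧
          ∀ j' < j, GoodAt (pair T T') ω j' := by
        by_contra! h
        exact hgood fun j => Nat.strong_induction_on j fun j ih hj => by
          by_contra hb
          obtain ⟨j', h1, h2⟩ := h j hj hb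
          exact h2 (ih j' h1 (h1.trans hj))
      unfold GoodAt Good at h2
      push Not at h2
      obtain ⟨i, hi, h4⟩ := h2
      refine ⟨(⟨j, h1⟩, ⟨i, hi.trans_le (pow_sub_le _)⟩), ?_⟩
      simp only [hE]
      exact ⟨hi, h3, h4⟩
  have hcardE : ∀ x, (Nat.card {ω // E x ω} : ℝ) ≤
      Real.exp (-((P.L : ℝ) / P.m)) * Nat.card (Coins P) := fun x => by
    by_cases hx : (x.2 : ℕ) < P.m ^ (P.J - x.1)
    · exact le_trans (Nat.cast_le.mpr (Nat.card_mono (Set.toFinite _) fun ω hω => hω.2))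
        (card_miss_le (pair T T') x.1.2 hx)
    · have : IsEmpty {ω // E x ω} := ⟨fun ω => hx ω.2.1⟩
      rw [Nat.card_of_isEmpty, Nat.cast_zero]
      positivity
  have hcardE' : (Nat.card {ω // E' ω} : ℝ) ≤ n / P.p * Nat.card (Coins P) := by
    by_cases hiso : T.Isomorphic T'
    · have : IsEmpty {ω // E' ω} := ⟨fun ω => ω.2.1 hiso⟩
      rw [Nat.card_of_isEmpty, Nat.cast_zero]
      positivity
    · exact le_trans (Nat.cast_le.mpr (Nat.card_mono (Set.toFinite _) fun ω hω => hω.2))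
        (card_collision_le T T' hiso)
  unfold Program.errorProb
  refine div_le_of_le_mul₀ (Nat.cast_nonneg _) (by positivity) ?_
  calc (Nat.card {ω // B ω} : ℝ)
      ≤ ((((⋃ x, {ω | E x ω}) ∪ {ω | E' ω}).ncard : ℕ) : ℝ) :=
        Nat.cast_le.mpr (Nat.card_mono (Set.toFinite _) hsub)
    _ ≤ ∑ x, (Nat.card {ω // E x ω} : ℝ) + (Nat.card {ω // E' ω} : ℝ) := by
      refine le_trans (Nat.cast_le.mpr (Set.ncard_union_le _ _)) ?_
      rw [Nat.cast_add]
      refine add_le_add_left ?_ _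
      refine le_trans (Nat.cast_le.mpr (Set.ncard_iUnion_le_of_fintype _)) ?_
      rw [Nat.cast_sum]
      exact le_rfl
    _ ≤ ∑ _x : Fin P.J × Fin P.N, Real.exp (-((P.L : ℝ) / P.m)) * Nat.card (Coins P) +
        n / P.p * Nat.card (Coins P) :=
      add_le_add (Finset.sum_le_sum fun x _ => hcardE x) hcardE'
    _ = _ := by
      rw [Finset.sum_const, Finset.card_univ, Fintype.card_prod, Fintype.card_fin,
        Fintype.card_fin, nsmul_eq_mul]
      push_cast
      ring

end TreeIso

/-! ### The choice of the parameters -/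

namespace TreeIso

open AMPC AMPC.Proc Params

variable {n : ℕ}

lemma exists_base (hn : 0 < n) {J : ℕ} (hJ : 1 ≤ J) :
    ∃ m : ℕ, 2 ≤ m ∧ 4 * n + 4 ≤ m ^ J ∧ (m : ℝ) ≤ 16 * (n : ℝ) ^ (1 / J : ℝ) := by
  have hn1 : (1 : ℝ) ≤ n := by exact_mod_cast hn
  have hJ0 : (0 : ℝ) < J := by exact_mod_cast hJ
  have hJ1 : (1 / J : ℝ) ≤ 1 := by
    rw [div_le_one hJ0]
    exact_mod_cast hJ
  set a : ℝ := (4 * n + 4 : ℝ) ^ (1 / J : ℝ) with ha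
  have ha1 : 1 < a := Real.one_lt_rpow (by linarith) (by positivity)
  refine ⟨⌈a⌉₊, Nat.lt_ceil.mpr (by exact_mod_cast ha1), ?_, ?_⟩
  · have h1 : a ^ J = 4 * n + 4 := by
      rw [ha, one_div, Real.rpow_inv_natCast_pow (by positivity) (by omega)]
    have h2 : ((4 * n + 4 : ℕ) : ℝ) ≤ ((⌈a⌉₊ ^ J : ℕ) : ℝ) := by
      push_cast
      rw [← h1]
      exact pow_le_pow_left₀ (by linarith) (Nat.le_ceil a) J
    exact_mod_cast h2
  · have h1 : a ≤ 8 * (n : ℝ) ^ (1 / J : ℝ) := by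
      calc a ≤ (8 * n : ℝ) ^ (1 / J : ℝ) :=
            Real.rpow_le_rpow (by positivity) (by linarith) (by positivity)
        _ = 8 ^ (1 / J : ℝ) * (n : ℝ) ^ (1 / J : ℝ) := Real.mul_rpow (by norm_num) (by positivity)
        _ ≤ 8 * (n : ℝ) ^ (1 / J : ℝ) := by
          gcongr
          calc (8 : ℝ) ^ (1 / J : ℝ) ≤ 8 ^ (1 : ℝ) :=
                Real.rpow_le_rpow_of_exponent_le (by norm_num) hJ1
            _ = 8 := Real.rpow_one _
    have h2 := (Nat.ceil_lt_add_one (show 0 ≤ a by linarith)).le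
    linarith

lemma clog_le_log (hn : 0 < n) : (Nat.clog 2 n : ℝ) ≤ 2 * (1 + Real.log n) := by
  have hn1 : (1 : ℝ) ≤ n := by exact_mod_cast hn
  have h0 := Real.log_nonneg hn1
  rcases Nat.lt_or_ge 1 n with h | h
  · have h1 := Nat.pow_pred_clog_lt_self one_lt_two h
    have h2 : Real.log ((2 ^ (Nat.clog 2 n).pred : ℕ) : ℝ) ≤ Real.log n :=
      Real.log_le_log (by positivity) (by exact_mod_cast h1.le)
    rw [Nat.cast_pow, Real.log_pow] at h2
    have h3 := Real.log_two_gt_d9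
    have h4 : (Nat.clog 2 n : ℝ) ≤ (Nat.clog 2 n).pred + 1 := by
      exact_mod_cast Nat.le_succ_of_pred_le le_rfl
    have h5 : (0 : ℝ) ≤ (Nat.clog 2 n).pred := Nat.cast_nonneg _
    push_cast at h2
    nlinarith
  · have : n = 1 := by omega
    subst this
    simp

/-- Parameters of the right size. -/
structure Params.Suitable (P : Params n) (α : ℝ) (ℓ : ℕ) : Prop where
  m_le : (P.m : ℝ) ≤ 16 * (n : ℝ) ^ (1 / P.J : ℝ)
  L_eq : P.L = P.m * ℓ
  le_ℓ : Real.log (8 * P.J * 16 ^ P.J) + (1 + α) * Real.log n ≤ ℓ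
  ℓ_le : (ℓ : ℝ) ≤ Real.log (8 * P.J * 16 ^ P.J) + (1 + α) * Real.log n + 1
  H_le : (P.H : ℝ) ≤ 2 * (1 + Real.log n)
  le_p : 8 * (n : ℝ) ^ (α + 1) ≤ P.p
  p_le : (P.p : ℝ) ≤ 18 * (n : ℝ) ^ (α + 1)

lemma exists_suitable (hn : 0 < n) {J : ℕ} (hJ : 1 ≤ J) {α : ℝ} (hα : 0 < α) :
    ∃ (P : Params n) (ℓ : ℕ), P.J = J ∧ P.Suitable α ℓ := by
  have hn1 : (1 : ℝ) ≤ n := by exact_mod_cast hn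
  have hJ1 : (1 : ℝ) ≤ J := by exact_mod_cast hJ
  obtain ⟨m, hm2, hm, hm'⟩ := exists_base hn hJ
  have hx : (1 : ℝ) ≤ (n : ℝ) ^ (α + 1) := Real.one_le_rpow hn1 (by linarith)
  have hq := Nat.le_ceil (8 * (n : ℝ) ^ (α + 1))
  have hq' := Nat.ceil_lt_add_one (show 0 ≤ 8 * (n : ℝ) ^ (α + 1) by linarith)
  obtain ⟨p, hp, hp1, hp2⟩ := Nat.exists_prime_lt_and_le_two_mul ⌈8 * (n : ℝ) ^ (α + 1)⌉₊
    (Nat.ceil_pos.mpr (by linarith)).ne'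
  have hp1' : ((⌈8 * (n : ℝ) ^ (α + 1)⌉₊ : ℕ) : ℝ) ≤ p := by exact_mod_cast hp1.le
  have hp2' : (p : ℝ) ≤ 2 * (⌈8 * (n : ℝ) ^ (α + 1)⌉₊ : ℕ) := by exact_mod_cast hp2
  have h0 : 0 ≤ Real.log (8 * J * 16 ^ J) + (1 + α) * Real.log n := by
    have h1 := Real.log_nonneg hn1
    have h2 : 0 ≤ Real.log (8 * J * 16 ^ J) := by
      refine Real.log_nonneg (one_le_mul_of_one_le_of_one_le (by linarith) ?_)
      exact one_le_pow₀ (by norm_num)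
    positivity
  set ℓ := ⌈Real.log (8 * J * 16 ^ J) + (1 + α) * Real.log n⌉₊ with hℓ
  refine ⟨⟨m, J, m * ℓ, p, Nat.clog 2 n, hm2, hJ, hm, hp, Nat.le_pow_clog one_lt_two n, ?_⟩, ℓ, rfl,
    hm', rfl, Nat.le_ceil _, (Nat.ceil_lt_add_one h0).le, clog_le_log hn, ?_, ?_⟩
  · have := Nat.clog_le_of_le_pow (Nat.lt_two_pow_self (n := n)).le
    omega
  · exact hq.trans hp1'
  · change (p : ℝ) ≤ _
    linarith

namespace Params.Suitable

variable {P : Params n} {α : ℝ} {ℓ : ℕ}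

lemma N_le (h : P.Suitable α ℓ) : (P.N : ℝ) ≤ 16 ^ P.J * n := by
  have hJ := P.one_le_J
  rw [N, Nat.cast_pow]
  calc (P.m : ℝ) ^ P.J ≤ (16 * (n : ℝ) ^ (1 / P.J : ℝ)) ^ P.J :=
        pow_le_pow_left₀ (Nat.cast_nonneg _) h.m_le _
    _ = 16 ^ P.J * n := by
      rw [mul_pow, one_div, Real.rpow_inv_natCast_pow (Nat.cast_nonneg _) (by omega)]

lemma error_le (h : P.Suitable α ℓ) (hn : 0 < n) :
    P.J * P.N * Real.exp (-((P.L : ℝ) / P.m)) + n / P.p ≤ 1 / 4 * (1 / (n : ℝ) ^ α) := by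
  have hn0 : (0 : ℝ) < n := by exact_mod_cast hn
  have hJ0 : (0 : ℝ) < P.J := by exact_mod_cast P.one_le_J
  have hm0 : (P.m : ℝ) ≠ 0 := by exact_mod_cast P.m_pos.ne'
  have hx : 0 < (n : ℝ) ^ α := Real.rpow_pos_of_pos hn0 _
  have hx' : (n : ℝ) ^ (α + 1) = (n : ℝ) ^ α * n := by rw [Real.rpow_add hn0, Real.rpow_one]
  have h1 : Real.exp (-((P.L : ℝ) / P.m)) ≤ 1 / (8 * P.J * 16 ^ P.J * ((n : ℝ) ^ α * n)) := by
    rw [h.L_eq, Nat.cast_mul, mul_div_cancel_left₀ _ hm0, Real.exp_neg, ← one_div]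
    refine one_div_le_one_div_of_le (by positivity) ?_
    calc 8 * P.J * 16 ^ P.J * ((n : ℝ) ^ α * n)
        = Real.exp (Real.log (8 * P.J * 16 ^ P.J) + (1 + α) * Real.log n) := by
          rw [Real.exp_add, Real.exp_log (by positivity), mul_comm (1 + α),
            ← Real.rpow_def_of_pos hn0, add_comm 1 α, hx']
      _ ≤ Real.exp ℓ := Real.exp_le_exp.mpr h.le_ℓ
  have h2 : P.J * P.N * Real.exp (-((P.L : ℝ) / P.m)) ≤ 1 / 8 * (1 / (n : ℝ) ^ α) := by
    calc P.J * P.N * Real.exp (-((P.L : ℝ) / P.m))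
        ≤ P.J * (16 ^ P.J * n) * (1 / (8 * P.J * 16 ^ P.J * ((n : ℝ) ^ α * n))) := by
          gcongr
          exact h.N_le
      _ = _ := by field_simp
  have h3 : (n : ℝ) / P.p ≤ 1 / 8 * (1 / (n : ℝ) ^ α) := by
    calc (n : ℝ) / P.p ≤ n / (8 * ((n : ℝ) ^ α * n)) := by
          rw [← hx']
          exact div_le_div_of_nonneg_left hn0.le (by positivity) h.le_p
      _ = _ := by field_simp
  linarith

/-- The factor in the bound on the local memory. -/
noncomputable def memoryFactor (J : ℕ) (α : ℝ) : ℝ :=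
  3 * (Real.log (8 * J * 16 ^ J) + (1 + α) + 1) + 4 + 12 + 2 * J + 4 + 26 * (J + 1) ^ 2

lemma memory_le (h : P.Suitable α ℓ) (hn : 0 < n) (hα : 0 < α) :
    ((program P).memory : ℝ) ≤ P.m * (memoryFactor P.J α * (1 + Real.log n)) := by
  have hn1 : (1 : ℝ) ≤ n := by exact_mod_cast hn
  have hJ1 : (1 : ℝ) ≤ P.J := by exact_mod_cast P.one_le_J
  have hm1 : (1 : ℝ) ≤ P.m := by exact_mod_cast P.m_pos
  have hlog := Real.log_nonneg hn1
  have hlog' : 0 ≤ Real.log (8 * P.J * 16 ^ P.J) :=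
    Real.log_nonneg (one_le_mul_of_one_le_of_one_le (by linarith) (one_le_pow₀ (by norm_num)))
  have hmem : (program P).memory = 3 * P.L + P.m * (2 * P.H + 12) + 2 * P.J + 4 +
    13 * ((P.J + 1) * ((P.J + 1) * P.m)) * 2 := rfl
  have h1 : (ℓ : ℝ) ≤ (Real.log (8 * P.J * 16 ^ P.J) + (1 + α) + 1) * (1 + Real.log n) := by
    nlinarith [h.ℓ_le, mul_nonneg hlog' hlog]
  have h2 : ((program P).memory : ℝ) ≤
      P.m * (3 * ℓ + 2 * P.H + (12 + 2 * P.J + 4 + 26 * (P.J + 1) ^ 2)) := by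
    rw [hmem, h.L_eq]
    push_cast
    nlinarith
  refine h2.trans (mul_le_mul_of_nonneg_left ?_ (by positivity))
  have h3 := h.H_le
  have h4 : (12 + 2 * P.J + 4 + 26 * (P.J + 1) ^ 2 : ℝ) ≤
      (12 + 2 * P.J + 4 + 26 * (P.J + 1) ^ 2) * (1 + Real.log n) :=
    le_mul_of_one_le_right (by positivity) (by linarith)
  rw [memoryFactor]
  linarith

lemma totalMemory_le (h : P.Suitable α ℓ) (hn : 0 < n) (hα : 0 < α) :
    ((program P).toProgram.totalMemory : ℝ) ≤
      16 ^ P.J * memoryFactor P.J α * (n * (1 + Real.log n)) := by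
  have hn1 : (1 : ℝ) ≤ n := by exact_mod_cast hn
  have h0 : 0 ≤ memoryFactor P.J α * (1 + Real.log n) :=
    nonneg_of_mul_nonneg_right ((Nat.cast_nonneg _).trans (h.memory_le hn hα))
      (by exact_mod_cast P.m_pos)
  have hM : (program P).toProgram.totalMemory = P.M * (program P).memory := rfl
  rw [hM, Nat.cast_mul]
  calc (P.M : ℝ) * (program P).memory
      ≤ P.M * (P.m * (memoryFactor P.J α * (1 + Real.log n))) :=
        mul_le_mul_of_nonneg_left (h.memory_le hn hα) (Nat.cast_nonneg _)
    _ = P.N * (memoryFactor P.J α * (1 + Real.log n)) := by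
      rw [P.N_eq, Nat.cast_mul]
      ring
    _ ≤ 16 ^ P.J * n * (memoryFactor P.J α * (1 + Real.log n)) :=
      mul_le_mul_of_nonneg_right h.N_le h0
    _ = _ := by ring

/-- The exponent in the bound on the numbers that occur. -/
noncomputable def sizeExponent (J : ℕ) (α : ℝ) : ℕ := 4 * J + ⌈α⌉₊ + 7

lemma N_le_pow (h : P.Suitable α ℓ) (hn : 0 < n) : P.N ≤ (n + 1) ^ sizeExponent P.J α := by
  have h1 : P.N ≤ 16 ^ P.J * n := by exact_mod_cast h.N_le
  calc P.N ≤ 16 ^ P.J * n := h1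
    _ = 2 ^ (4 * P.J) * n := by rw [pow_mul]; norm_num
    _ ≤ (n + 1) ^ (4 * P.J) * (n + 1) := by gcongr <;> omega
    _ = (n + 1) ^ (4 * P.J + 1) := (pow_succ _ _).symm
    _ ≤ _ := Nat.pow_le_pow_right (by omega) (by rw [sizeExponent]; omega)

lemma p_le_pow (h : P.Suitable α ℓ) (hn : 0 < n) : P.p ≤ (n + 1) ^ sizeExponent P.J α := by
  have hn1 : (1 : ℝ) ≤ n := by exact_mod_cast hn
  have h1 : (P.p : ℝ) ≤ ((18 * n ^ (⌈α⌉₊ + 1) : ℕ) : ℝ) := by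
    refine h.p_le.trans ?_
    push_cast
    gcongr
    rw [← Real.rpow_natCast]
    refine Real.rpow_le_rpow_of_exponent_le hn1 ?_
    push_cast
    linarith [Nat.le_ceil α]
  calc P.p ≤ 18 * n ^ (⌈α⌉₊ + 1) := by exact_mod_cast h1
    _ ≤ 2 ^ 5 * (n + 1) ^ (⌈α⌉₊ + 1) := by gcongr <;> omega
    _ ≤ (n + 1) ^ 5 * (n + 1) ^ (⌈α⌉₊ + 1) := by gcongr; omega
    _ = (n + 1) ^ (5 + (⌈α⌉₊ + 1)) := (pow_add _ _ _).symm
    _ ≤ _ := Nat.pow_le_pow_right (by omega) (by rw [sizeExponent]; omega)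

end Params.Suitable

lemma card_tag : Nat.card Tag = 13 := by
  rw [Nat.card_eq_fintype_card]
  rfl

lemma wordSize_le (P : Params n) {B : ℕ} (hB : 7 ≤ B) (hJ : P.J + 1 ≤ B) (hN : P.N ≤ B)
    (hp : P.p ≤ B) : (program P).wordSize ≤ B ^ 6 := by
  have hw : (program P).wordSize =
    max (Nat.card (Answer (Fin n) P.Val P.D)) (max (Nat.card P.Key) (Nat.card P.Val)) := rfl
  have hm : P.m ≤ B := (Nat.le_self_pow (by have := P.one_le_J; omega) _).trans hN
  have hbool : Nat.card Bool = 2 := by rw [Nat.card_eq_fintype_card, Fintype.card_bool]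
  have hval : Nat.card P.Val = P.N * (P.N * (P.p * (P.p * (P.N * 2 + 1)))) := by
    simp only [Nat.card_prod, Nat.card_fin, Nat.card_zmod, Finite.card_option, hbool]
  have hkey : Nat.card P.Key = 13 * ((P.J + 1) * ((P.J + 1) * P.N)) +
      2 * (P.N * (P.N * P.N)) := by
    simp only [Nat.card_sum, Nat.card_prod, Nat.card_fin, card_tag, hbool]
  have hans : Nat.card (Answer (Fin n) P.Val P.D) = n + 1 + (Nat.card P.Val + 1 + P.D) := by
    simp only [Answer, Nat.card_sum, Finite.card_option, Nat.card_fin]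
  have h1 : P.N * 2 + 1 ≤ 3 * B := by omega
  have hv : Nat.card P.Val ≤ 3 * B ^ 5 := by
    calc Nat.card P.Val ≤ B * (B * (B * (B * (3 * B)))) := by rw [hval]; gcongr
      _ = 3 * B ^ 5 := by ring
  have hk : Nat.card P.Key ≤ 15 * B ^ 3 := by
    calc Nat.card P.Key ≤ 13 * (B * (B * B)) + 2 * (B * (B * B)) := by rw [hkey]; gcongr
      _ = 15 * B ^ 3 := by ring
  have hD : P.D ≤ B := max_le hm hp
  have hn : n ≤ B := (by omega : n ≤ 4 * n + 4).trans (P.le_pow.trans hN)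
  have h6 : 7 * B ^ 5 ≤ B ^ 6 := by rw [pow_succ B 5, mul_comm]; gcongr
  have hB1 : B ≤ B ^ 5 := Nat.le_self_pow (by norm_num) B
  have hB3 : 49 * B ^ 3 ≤ B ^ 5 := by
    rw [show B ^ 5 = B ^ 2 * B ^ 3 by ring]
    gcongr
    nlinarith
  rw [hw, hans]
  refine max_le ?_ (max_le ?_ ?_) <;> omega

lemma Params.Suitable.wordSize_le_pow {P : Params n} {α : ℝ} {ℓ : ℕ} (h : P.Suitable α ℓ)
    (hn : 0 < n) : (program P).wordSize ≤ (n + 1) ^ (6 * sizeExponent P.J α) := by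
  rw [mul_comm, pow_mul]
  have h2 : ∀ j ≤ sizeExponent P.J α, 2 ^ j ≤ (n + 1) ^ sizeExponent P.J α := fun j hj =>
    (Nat.pow_le_pow_left (by omega) j).trans (Nat.pow_le_pow_right (by omega) hj)
  refine wordSize_le P ?_ ?_ (h.N_le_pow hn) (h.p_le_pow hn)
  · exact le_trans (by norm_num) (h2 3 (by rw [sizeExponent]; omega))
  · exact le_trans Nat.lt_two_pow_self (h2 P.J (by rw [sizeExponent]; omega))

instance : Nonempty (Params n) :=
  ⟨⟨4 * n + 4, 1, 0, 2, n, by omega, le_rfl, (pow_one _).ge, Nat.prime_two,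
    Nat.lt_two_pow_self.le, by rw [pow_one]; omega⟩⟩

lemma rounds_le {ε : ℝ} (h0 : 0 < ε) (h1 : ε < 1) {P : Params n} (hJ : P.J = ⌈2 / ε⌉₊) :
    ((program P).rounds : ℝ) ≤ 34 / ε ^ 2 := by
  have hr : (program P).rounds = (phases P).length + 2 := rfl
  have h2 : (P.J : ℝ) ≤ 3 / ε := by
    rw [hJ]
    have h3 := Nat.ceil_lt_add_one (show 0 ≤ 2 / ε by positivity)
    have h4 : 1 ≤ 1 / ε := by rw [le_div_iff₀ h0]; linarith
    have h5 : 3 / ε = 2 / ε + 1 / ε := by ring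
    linarith
  have h3 : (P.J : ℝ) * ε ≤ 3 := (le_div_iff₀ h0).mp h2
  have h4 : 0 ≤ (P.J : ℝ) * ε := by positivity
  rw [hr, length_phases, le_div_iff₀ (by positivity)]
  push_cast
  nlinarith

lemma Params.Suitable.memory_le_rpow {P : Params n} {α : ℝ} {ℓ : ℕ} (h : P.Suitable α ℓ)
    (hn : 0 < n) (hα : 0 < α) {ε : ℝ} (h0 : 0 < ε) (hJ : 2 / ε ≤ P.J) :
    ((program P).memory : ℝ) ≤ 16 * memoryFactor P.J α * (1 + 2 / ε) * (n : ℝ) ^ ε := by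
  have hn1 : (1 : ℝ) ≤ n := by exact_mod_cast hn
  have hn0 : (0 : ℝ) < n := by linarith
  have hJ0 : (0 : ℝ) < P.J := by exact_mod_cast P.one_le_J
  have hlog := Real.log_nonneg hn1
  have hf : 0 ≤ memoryFactor P.J α * (1 + Real.log n) :=
    nonneg_of_mul_nonneg_right ((Nat.cast_nonneg _).trans (h.memory_le hn hα))
      (by exact_mod_cast P.m_pos)
  have hf' : 0 ≤ memoryFactor P.J α := nonneg_of_mul_nonneg_left hf (by linarith)
  have hx : (n : ℝ) ^ (1 / P.J : ℝ) ≤ (n : ℝ) ^ (ε / 2) := by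
    refine Real.rpow_le_rpow_of_exponent_le hn1 ?_
    rw [div_le_iff₀ hJ0]
    rw [div_le_iff₀ h0] at hJ
    linarith
  have hy : 1 + Real.log n ≤ (1 + 2 / ε) * (n : ℝ) ^ (ε / 2) := by
    have h1 := Real.log_le_rpow_div hn0.le (half_pos h0)
    have h2 : (1 : ℝ) ≤ (n : ℝ) ^ (ε / 2) := Real.one_le_rpow hn1 (by positivity)
    have h3 : (n : ℝ) ^ (ε / 2) / (ε / 2) = 2 / ε * (n : ℝ) ^ (ε / 2) := by field_simp
    linarith
  have hz : (n : ℝ) ^ ε = (n : ℝ) ^ (ε / 2) * (n : ℝ) ^ (ε / 2) := by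
    rw [← Real.rpow_add hn0, add_halves]
  calc ((program P).memory : ℝ) ≤ P.m * (memoryFactor P.J α * (1 + Real.log n)) :=
        h.memory_le hn hα
    _ ≤ 16 * (n : ℝ) ^ (ε / 2) * (memoryFactor P.J α * ((1 + 2 / ε) * (n : ℝ) ^ (ε / 2))) := by
      gcongr
      exact h.m_le.trans (by gcongr)
    _ = _ := by rw [hz]; ring

end TreeIso

theorem mainTheorem3 :
    ∃ c₀ : ℝ, ∀ ε α : ℝ, 0 < ε → ε < 1 → 0 < α →
      ∃ (C : ℝ) (k : ℕ) (M : (n : ℕ) → AMPC.Program (Bool × Fin n) (Fin n)),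
        ∀ n : ℕ, 0 < n →
          ((M n).rounds : ℝ) ≤ c₀ / ε ^ 2 ∧
          ((M n).memory : ℝ) ≤ C * (n : ℝ) ^ ε ∧
          ((M n).totalMemory : ℝ) ≤ C * (n * (1 + Real.log n) ^ k) ∧
          (M n).wordSize ≤ (n + 1) ^ k ∧
          ∀ (h : ℕ) (T T' : LabeledRootedTree n), T.height = h → T'.height = h →
            ∀ σ : (M n).Ordering,
              (M n).errorProb (T.pairInput T') (primeTable (h * (n : ℝ) ^ (α + 1))) σ
                  (¬ T.Isomorphic T') < 1 / (n : ℝ) ^ α ∧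
              (M n).errorProb (T.pairInput T') noTable σ (¬ T.Isomorphic T') < 1 / 2 := by
  refine ⟨34, fun ε α hε hε1 hα => ?_⟩
  have hJ : 1 ≤ ⌈2 / ε⌉₊ := Nat.ceil_pos.mpr (by positivity)
  have hJ1 : (1 : ℝ) ≤ (⌈2 / ε⌉₊ : ℕ) := by exact_mod_cast hJ
  set f := TreeIso.Params.Suitable.memoryFactor ⌈2 / ε⌉₊ α with hf
  set s := TreeIso.Params.Suitable.sizeExponent ⌈2 / ε⌉₊ α with hs
  have hs1 : 1 ≤ s := by rw [hs, TreeIso.Params.Suitable.sizeExponent]; omega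
  have hf0 : 0 ≤ f := by
    have : 0 ≤ Real.log (8 * (⌈2 / ε⌉₊ : ℕ) * 16 ^ ⌈2 / ε⌉₊) :=
      Real.log_nonneg (one_le_mul_of_one_le_of_one_le (by linarith) (one_le_pow₀ (by norm_num)))
    rw [hf, TreeIso.Params.Suitable.memoryFactor]
    positivity
  choose! P ℓ hPJ hP using fun (n : ℕ) (hn : 0 < n) => TreeIso.exists_suitable hn hJ hα
  refine ⟨16 * f * (1 + 2 / ε) + 16 ^ ⌈2 / ε⌉₊ * f, 6 * s,
    fun n => (TreeIso.program (P n)).toProgram, fun n hn => ?_⟩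
  have hn1 : (1 : ℝ) ≤ n := by exact_mod_cast hn
  have hlog := Real.log_nonneg hn1
  have h := hP n hn
  have hx : (1 : ℝ) ≤ (n : ℝ) ^ α := Real.one_le_rpow hn1 hα.le
  have hx' : 1 / (n : ℝ) ^ α ≤ 1 := by rw [div_le_one (by linarith)]; exact hx
  have hx0 : 0 < 1 / (n : ℝ) ^ α := by positivity
  refine ⟨TreeIso.rounds_le hε hε1 (hPJ n hn), ?_, ?_, ?_, fun d T T' _ _ σ => ⟨?_, ?_⟩⟩
  · have h1 := h.memory_le_rpow hn hα hε (by rw [hPJ n hn]; exact Nat.le_ceil _)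
    rw [hPJ n hn] at h1
    refine h1.trans (mul_le_mul_of_nonneg_right (le_add_of_nonneg_right ?_) ?_) <;> positivity
  · have h1 := h.totalMemory_le hn hα
    rw [hPJ n hn] at h1
    refine h1.trans (mul_le_mul ?_ ?_ (by positivity) (by positivity))
    · exact le_add_of_nonneg_left (by positivity)
    · exact mul_le_mul_of_nonneg_left (le_self_pow₀ (by linarith) (by omega)) (by positivity)
  · have h1 := h.wordSize_le_pow hn
    rwa [hPJ n hn] at h1
  · have h1 := TreeIso.errorProb_le T T' (primeTable (d * (n : ℝ) ^ (α + 1))) σ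
    linarith [h.error_le hn]
  · have h1 := TreeIso.errorProb_le T T' noTable σ
    linarith [h.error_le hn]
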